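/- **Setting.** Let $d\ge 1$ and let $(\Omega,\mathcal F,\mathbb P)$ be a probability space with a jointly measurable action $(\tau_x)_{x\in\mathbb R^d}$ of $\mathbb R^d$ on $\Omega$ ($\tau_0=\mathrm{Id}$, $\tau_{x+y}=\tau_x\circ\tau_y$) that is stationary, $\mathbb P(\tau_x^{-1}E)=\mathbb P(E)$ for all $x\in\mathbb R^d$, $E\in\mathcal F$, and ergodic: if $E\in\mathcal F$ and $\tau_x^{-1}E=E$ for all $x$, then $\mathbb P(E)\in\{0,1\}$. Let $A$ be a random symmetric $d\times d$ matrix and $\Theta$ a random variable such that, for some positive constants $\lambda,\Lambda,\theta_*,\theta^*$, almost surely $\lambda\,\mathrm{Id}\le A\le\Lambda\,\mathrm{Id}$ and $\theta_*\le\Theta\le\theta^*$. The stationary ergodic medium $(a,\theta)$ is given by $a(x,\omega)=A(\tau_x\omega)$, $\theta(x,\omega)=\Theta(\tau_x\omega)$; put $\bar\theta=\mathbb E[\Theta]$. **Correctors.** Correctors of the medium are jointly measurable random fields $\phi=(\phi_i)_{1\le i\le d}$ and $\sigma=(\sigma_{ijk})_{1\le i,j,k\le d}$ on $\mathbb R^d$,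 almost surely in $H^1_{\rm loc}(\mathbb R^d)$, with $\sigma_{ijk}=-\sigma_{ikj}$, whose gradients are stationary (of the form $x\mapsto G(\tau_x\omega)$), square integrable over $\Omega$ and of mean zero, and which almost surely satisfy, weakly in $\mathbb R^d$, $$-\nabla\cdot\big(a(e_i+\nabla\phi_i)\big)=0,\qquad -\Delta\sigma_{ijk}=\partial_j q_{i,k}-\partial_k q_{i,j},\qquad q_i=a(e_i+\nabla\phi_i).$$ **The quantities Sub and Osc.** Let $Q_R(x)=x+(-\tfrac R2,\tfrac R2)^d$. For $r>0$, $$\mathrm{Sub}_x(r)=\sup_{R\ge r}\frac1R\,\Big\langle\big|(\phi,\sigma)-\langle(\phi,\sigma)\rangle_{Q_R(x)}\big|^2\Big\rangle_{Q_R(x)}^{1/2},\qquad \mathrm{Osc}_x(r)=\sup_{R\ge r}\frac1R\,\|\theta-\bar\theta\|_{H^{-1}(Q_R(x))},$$ where $\langle f\rangle_U=\frac1{|U|}\int_U f\,dx$ denotes the average over $U$ and $\|f\|_{H^{-1}(U)}=\sup\{\langle fv\rangle_U : v\in H^1_0(U),\ \langle|\nabla v|^2\rangle_U\le1\}$. **Proposition.**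 For every medium as above, correctors $(\phi,\sigma)$ exist, and there is a scale $\delta_*:(0,\infty)\to(0,\infty)$ with $\delta_*(\epsilon)/\epsilon\to0$ as $\epsilon\to0$, which depends only on the medium, such that the following holds for any choice of the correctors $(\phi,\sigma)$: if $0<\delta(\epsilon)\le\delta_*(\epsilon)$ for all sufficiently small $\epsilon>0$, then for every $\nu>0$ $$\lim_{\epsilon\to0}\frac1{\epsilon^d}\,\mathbb P\Big\{\mathrm{Sub}_0\Big(\frac{\epsilon}{\delta(\epsilon)}\Big)>\nu\Big\}=0\qquad\text{and}\qquad \lim_{\epsilon\to0}\frac1{\epsilon^d}\,\mathbb P\Big\{\mathrm{Osc}_0\Big(\frac{\epsilon}{\delta(\epsilon)}\Big)>\nu\Big\}=0.$$ -/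

import Mathlib

open MeasureTheory Filter Topology
open scoped ENNReal Matrix

noncomputable section

/-- Euclidean space `ℝ^d`. -/
abbrev Euc (d : ℕ) : Type := EuclideanSpace ℝ (Fin d)

/-- The open cube `Q_R(x)` with centre `x` and side length `R`. -/
def cube {d : ℕ} (x : Euc d) (R : ℝ) : Set (Euc d) :=
  {y | ∀ i, |y i - x i| < R / 2}

/-- `C_c^∞(U)`: smooth functions on `ℝ^d` whose support is a compact subset of `U`. -/
def IsTestFunction {d : ℕ} (U : Set (Euc d)) (ψ : Euc d → ℝ) : Prop :=
  ContDiff ℝ ((⊤ : ℕ∞) : WithTop ℕ∞) ψ ∧ HasCompactSupport ψ ∧ tsupport ψ ⊆ U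

/-- `u ∈ H^1_loc(ℝ^d)` and its weak gradient is `g`. -/
def HasWeakGradient {d : ℕ} (u : Euc d → ℝ) (g : Euc d → Euc d) : Prop :=
  (∀ K : Set (Euc d), IsCompact K → MemLp u 2 (volume.restrict K)) ∧
  (∀ K : Set (Euc d), IsCompact K → MemLp g 2 (volume.restrict K)) ∧
  ∀ ψ : Euc d → ℝ, IsTestFunction Set.univ ψ → ∀ j : Fin d,
    ∫ x, u x * gradient ψ x j = - ∫ x, g x j * ψ x

/-- `v ∈ H^1_0(U)` and its gradient is `g`: the closure of `C_c^∞(U)` in the norm of `H^1(U)`. -/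
def MemH10 {d : ℕ} (U : Set (Euc d)) (v : Euc d → ℝ) (g : Euc d → Euc d) : Prop :=
  MemLp v 2 (volume.restrict U) ∧ MemLp g 2 (volume.restrict U) ∧
  ∃ ψ : ℕ → Euc d → ℝ, (∀ n, IsTestFunction U (ψ n)) ∧
    Tendsto (fun n => eLpNorm (fun x => ψ n x - v x) 2 (volume.restrict U)) atTop (𝓝 0) ∧
    Tendsto (fun n => eLpNorm (fun x => gradient (ψ n) x - g x) 2 (volume.restrict U))
      atTop (𝓝 0)

/-- The normalized dual norm
`‖f‖_{H^{-1}(U)} = sup { ⨍_U f v : v ∈ H^1_0(U), ⨍_U |∇v|² ≤ 1 }`, with values in `[0,∞]`. -/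
def hMinusOneNorm {d : ℕ} (U : Set (Euc d)) (f : Euc d → ℝ) : ℝ≥0∞ :=
  ⨆ (v : Euc d → ℝ) (g : Euc d → Euc d) (_ : MemH10 U v g) (_ : ⨍ x in U, ‖g x‖ ^ 2 ≤ 1),
    ENNReal.ofReal (⨍ x in U, f x * v x)

/-- A stationary ergodic medium on the probability space `(Ω, P)`: a measurable,
measure-preserving, ergodic action `τ` of `ℝ^d`, a symmetric, uniformly elliptic random matrix `A`
and a random variable `Θ` bounded above and below by positive constants. The coefficient fields
are `a(x,ω) = A(τ_x ω)` and `θ(x,ω) = Θ(τ_x ω)`. -/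
structure Medium (d : ℕ) {Ω : Type*} [MeasurableSpace Ω] (P : Measure Ω) where
  τ : Euc d → Ω → Ω
  τ_zero : ∀ ω, τ 0 ω = ω
  τ_add : ∀ x y ω, τ (x + y) ω = τ x (τ y ω)
  τ_measurable : Measurable (fun p : Ω × Euc d => τ p.2 p.1)
  stationary : ∀ (S : Set Ω), MeasurableSet S → ∀ x, P (τ x ⁻¹' S) = P S
  ergodic : ∀ (S : Set Ω), MeasurableSet S → (∀ x, τ x ⁻¹' S = S) → P S = 0 ∨ P S = 1
  A : Ω → Matrix (Fin d) (Fin d) ℝ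
  A_measurable : ∀ i j, Measurable (fun ω => A ω i j)
  A_symm : ∀ᵐ ω ∂P, (A ω).IsSymm
  ellLo : ℝ
  ellHi : ℝ
  ellLo_pos : 0 < ellLo
  ellHi_pos : 0 < ellHi
  A_elliptic : ∀ᵐ ω ∂P, ∀ v : Fin d → ℝ,
    ellLo * (v ⬝ᵥ v) ≤ v ⬝ᵥ (A ω *ᵥ v) ∧ v ⬝ᵥ (A ω *ᵥ v) ≤ ellHi * (v ⬝ᵥ v)
  Θ : Ω → ℝ
  Θ_measurable : Measurable Θ
  θLo : ℝ
  θHi : ℝ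
  θLo_pos : 0 < θLo
  θHi_pos : 0 < θHi
  Θ_bounds : ∀ᵐ ω ∂P, θLo ≤ Θ ω ∧ Θ ω ≤ θHi

namespace Medium

variable {d : ℕ} {Ω : Type*} [MeasurableSpace Ω] {P : Measure Ω}

/-- The mean `E[θ(0)]`. -/
def θbar (M : Medium d P) : ℝ := ∫ ω, M.Θ ω ∂P

/-- `u` is a random field in `H^1_loc` with a stationary, mean-zero, square integrable gradient,
`∇u(x,ω) = G(τ_x ω)`. -/
structure HasStationaryGradient (M : Medium d P) (u : Ω → Euc d → ℝ) (G : Ω → Euc d) : Prop where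
  measurable_field : Measurable (fun p : Ω × Euc d => u p.1 p.2)
  measurable_grad : Measurable G
  memLp : MemLp G 2 P
  mean_zero : ∫ ω, G ω ∂P = 0
  weak_grad : ∀ᵐ ω ∂P, HasWeakGradient (u ω) (fun x => G (M.τ x ω))

/-- The flux `A (e_i + G)`; evaluated at `τ_x ω` with `G(τ_x ω) = ∇φ_i(x,ω)` it is `q_i(x,ω)`. -/
def flux (M : Medium d P) (i : Fin d) (G : Ω → Euc d) (ω : Ω) : Euc d :=
  WithLp.toLp 2 (M.A ω *ᵥ fun j => (EuclideanSpace.single i (1 : ℝ) + G ω : Euc d) j)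

/-- `φ = (φ_i)` and `σ = (σ_{ijk})` are gradient and flux correctors of the medium: the gradients
are stationary with mean zero, `σ_i` is skew-symmetric, and almost surely, in the weak sense,
`-∇ · (a (e_i + ∇φ_i)) = 0` and `-Δ σ_{ijk} = ∂_j q_{i,k} - ∂_k q_{i,j}` on `ℝ^d`,
where `q_i = a (e_i + ∇φ_i)`. -/
def IsCorrector (M : Medium d P) (φ : Fin d → Ω → Euc d → ℝ)
    (σ : Fin d → Fin d → Fin d → Ω → Euc d → ℝ) : Prop :=
  ∃ (G : Fin d → Ω → Euc d) (H : Fin d → Fin d → Fin d → Ω → Euc d),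
    (∀ i, M.HasStationaryGradient (φ i) (G i)) ∧
    (∀ i j k, M.HasStationaryGradient (σ i j k) (H i j k)) ∧
    (∀ i j k ω x, σ i j k ω x = - σ i k j ω x) ∧
    (∀ i, ∀ᵐ ω ∂P, ∀ ψ : Euc d → ℝ, IsTestFunction Set.univ ψ →
      ∫ x, inner ℝ (M.flux i (G i) (M.τ x ω)) (gradient ψ x) = 0) ∧
    (∀ i j k, ∀ᵐ ω ∂P, ∀ ψ : Euc d → ℝ, IsTestFunction Set.univ ψ →
      ∫ x, inner ℝ (H i j k (M.τ x ω)) (gradient ψ x) =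
        ∫ x, (M.flux i (G i) (M.τ x ω) j * gradient ψ x k
          - M.flux i (G i) (M.τ x ω) k * gradient ψ x j))

/-- `Osc_x(r) = sup_{R ≥ r} R⁻¹ ‖θ - θbar‖_{H^{-1}(Q_R(x))}`, with values in `[0,∞]`. -/
def Osc (M : Medium d P) (x : Euc d) (r : ℝ) (ω : Ω) : ℝ≥0∞ :=
  ⨆ (R : ℝ) (_ : r ≤ R), (ENNReal.ofReal R)⁻¹ *
    hMinusOneNorm (cube x R) (fun y => M.Θ (M.τ y ω) - M.θbar)

end Medium

/-- `Sub_x(r) = sup_{R ≥ r} R⁻¹ (⨍_{Q_R(x)} |(φ,σ) - ⨍_{Q_R(x)} (φ,σ)|²)^{1/2}`, with values in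
`[0,∞]`, where `|·|` is the Euclidean norm over all the components of `(φ,σ)`. -/
def SubGrowth {d : ℕ} {Ω : Type*} (φ : Fin d → Ω → Euc d → ℝ)
    (σ : Fin d → Fin d → Fin d → Ω → Euc d → ℝ) (x : Euc d) (r : ℝ) (ω : Ω) : ℝ≥0∞ :=
  ⨆ (R : ℝ) (_ : r ≤ R), (ENNReal.ofReal R)⁻¹ *
    (⨍⁻ y, ENNReal.ofReal
      ((∑ i, (φ i ω y - ⨍ z in cube x R, φ i ω z) ^ 2) +
        ∑ i, ∑ j, ∑ k, (σ i j k ω y - ⨍ z in cube x R, σ i j k ω z) ^ 2)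
      ∂(volume.restrict (cube x R))) ^ (1 / 2 : ℝ)

/-- `ε⁻ᵈ P{Sub_0(ε/δ(ε)) > ν} → 0` as `ε → 0⁺`, for every `ν > 0`. -/
def SublinearityCondition {d : ℕ} {Ω : Type*} [MeasurableSpace Ω] (P : Measure Ω)
    (φ : Fin d → Ω → Euc d → ℝ) (σ : Fin d → Fin d → Fin d → Ω → Euc d → ℝ) (δ : ℝ → ℝ) : Prop :=
  ∀ ν : ℝ, 0 < ν → Tendsto
    (fun ε : ℝ => 1 / ε ^ d * P.real {ω | ENNReal.ofReal ν < SubGrowth φ σ 0 (ε / δ ε) ω})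
    (𝓝[>] 0) (𝓝 0)

/-- `ε⁻ᵈ P{Osc_0(ε/δ(ε)) > ν} → 0` as `ε → 0⁺`, for every `ν > 0`. -/
def AveragingCondition {d : ℕ} {Ω : Type*} [MeasurableSpace Ω] {P : Measure Ω}
    (M : Medium d P) (δ : ℝ → ℝ) : Prop :=
  ∀ ν : ℝ, 0 < ν → Tendsto
    (fun ε : ℝ => 1 / ε ^ d * P.real {ω | ENNReal.ofReal ν < M.Osc 0 (ε / δ ε) ω})
    (𝓝[>] 0) (𝓝 0)

/-- A microscopic scale: a positive function on `(0,∞)` with `δ(ε)/ε → 0` as `ε → 0⁺`. -/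
def IsScale (δ : ℝ → ℝ) : Prop :=
  (∀ ε, 0 < ε → 0 < δ ε) ∧ Tendsto (fun ε => δ ε / ε) (𝓝[>] 0) (𝓝 0)

end

/-! Ergodicity gives no rate of convergence, but none is needed because the scale is free. It
suffices that for every tolerance `ν > 0` and every `p > 0` there is a radius `r₀` such that
`Sub_0(r) > ν` and `Osc_0(r) > ν` have probability at most `p` for all `r ≥ r₀`. Taking `ν = ε` and
`p = ε^(d+1)`, and `δ_*(ε) = ε / r(ε)` with `r(ε)` at least both radii and at least `ε⁻¹`, handles
all tolerances with one scale; a smaller `δ` only enlarges `ε / δ`.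

The tail bound has to hold for all `R ≥ r` at once. Let `u` have the stationary, centred, square
integrable gradient `G(τ_x ω)`. By von Neumann's argument some finite convex combination `∑ c_i G ∘
τ_{a_i}` is small in `L²(Ω)` (`exists_convex_combination_small`). Put `v = ∑ c_i u(· + a_i)`. On
`Q_R` the difference `v - u` costs only `max |a_i|` times a quadratic mean of `∇u`, which is
negligible against `R`, while Poincaré bounds the oscillation of `v` by `R` times a quadratic mean
of the small averaged gradient (`setLaverage_sub_average_sq_le_ballMax`). The quadratic means over
all large balls are dominated by maximal functions, and Wiener's weak type inequality
(`measure_lt_ballMax_le`) makes these small with high probability (`exists_tail_bound`). For `θ -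
θbar` in `H⁻¹` the same works by duality, the translations being moved to the test function
(`hMinusOneNorm_le_ballMax`).

The correctors come from the Hilbert space of stationary potential fields, the closure in `L²(Ω)` of
gradients of mollified stationary functions. Its orthogonal complement consists of the
divergence-free fields (`toLp_mem_orthogonal_potential_iff`), so Lax–Milgram yields `∇φ` and an
orthogonal projection yields `∇σ`; integrating along rays from the origin yields the fields
themselves (`hasStationaryGradient_radialPrim`). Conversely every stationary gradient is a potential
field (`HasStationaryGradient.toLp_mem_potential`), so the gradients of any two choices of
correctors agree almost surely. The tail bounds depend on the gradients only, hence one scale serves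
every choice. -/

noncomputable section

/-! ### Test functions and gradients -/

section Gradient

variable {d : ℕ}

lemma gradient_apply_eq_fderiv (ψ : Euc d → ℝ) (x : Euc d) (j : Fin d) :
    gradient ψ x j = fderiv ℝ ψ x (EuclideanSpace.single j 1) := by
  rw [← inner_gradient_left, real_inner_comm, EuclideanSpace.inner_single_left]
  simp

lemma continuous_gradient {ψ : Euc d → ℝ} (h : ContDiff ℝ 1 ψ) : Continuous (gradient ψ) := by
  have := h.continuous_fderiv one_ne_zero
  exact (InnerProductSpace.toDual ℝ (Euc d)).symm.continuous.comp this

lemma gradient_comp_add_right (ψ : Euc d → ℝ) (h x : Euc d) :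
    gradient (fun y => ψ (y + h)) x = gradient ψ (x + h) := by
  unfold gradient
  rw [fderiv_comp_add_right]

lemma HasCompactSupport.gradient {ψ : Euc d → ℝ} (h : HasCompactSupport ψ) :
    HasCompactSupport (gradient ψ) :=
  (h.fderiv ℝ).comp_left (g := (InnerProductSpace.toDual ℝ (Euc d)).symm) (map_zero _)

namespace IsTestFunction

variable {U : Set (Euc d)} {ψ : Euc d → ℝ}

lemma mono {V : Set (Euc d)} (h : IsTestFunction U ψ) (hUV : U ⊆ V) : IsTestFunction V ψ :=
  ⟨h.1, h.2.1, h.2.2.trans hUV⟩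

lemma contDiff_one (h : IsTestFunction U ψ) : ContDiff ℝ 1 ψ :=
  h.1.of_le (by exact_mod_cast le_top)

lemma continuous (h : IsTestFunction U ψ) : Continuous ψ := h.1.continuous

lemma continuous_gradient (h : IsTestFunction U ψ) : Continuous (gradient ψ) :=
  _root_.continuous_gradient h.contDiff_one

lemma hasCompactSupport_gradient (h : IsTestFunction U ψ) : HasCompactSupport (gradient ψ) :=
  h.2.1.gradient

lemma continuous_gradient_apply (h : IsTestFunction U ψ) (j : Fin d) :
    Continuous (fun x => gradient ψ x j) :=
  (EuclideanSpace.proj (𝕜 := ℝ) j).continuous.comp h.continuous_gradient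

lemma hasCompactSupport_gradient_apply (h : IsTestFunction U ψ) (j : Fin d) :
    HasCompactSupport (fun x => gradient ψ x j) :=
  h.hasCompactSupport_gradient.comp_left (g := fun v : Euc d => v j) rfl

lemma comp_add_right (h : IsTestFunction Set.univ ψ) (a : Euc d) :
    IsTestFunction Set.univ (fun x => ψ (x + a)) :=
  ⟨h.1.comp (contDiff_id.add contDiff_const), h.2.1.comp_homeomorph (Homeomorph.addRight a),
    Set.subset_univ _⟩

lemma comp_neg (h : IsTestFunction Set.univ ψ) :
    IsTestFunction Set.univ (fun x => ψ (-x)) :=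
  ⟨h.1.comp contDiff_neg, h.2.1.comp_homeomorph (Homeomorph.neg _), Set.subset_univ _⟩

lemma integral_gradient (h : IsTestFunction U ψ) (j : Fin d) : ∫ x, gradient ψ x j = 0 := by
  have h1 := (h.continuous_gradient_apply j).integrable_of_hasCompactSupport
    (μ := volume) (h.hasCompactSupport_gradient_apply j)
  have := integral_mul_fderiv_eq_neg_fderiv_mul_of_integrable (μ := (volume : Measure (Euc d)))
    (f := fun _ => (1 : ℝ)) (g := ψ) (v := EuclideanSpace.single j (1:ℝ)) (by simp)
    (by simpa [← gradient_apply_eq_fderiv] using h1)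
    (by simpa using h.continuous.integrable_of_hasCompactSupport h.2.1) (fun x _ => by simp)
    (fun x _ => (h.contDiff_one.differentiable one_ne_zero) x)
  simpa [← gradient_apply_eq_fderiv] using this

end IsTestFunction

lemma inner_eq_sum (a b : Euc d) : inner ℝ a b = ∑ j, a j * b j := by
  simp [PiLp.inner_apply, mul_comm]

end Gradient

/-! ### Locally square integrable functions -/

section L2Loc

variable {d : ℕ} {F : Type*} [NormedAddCommGroup F]

/-- Local square integrability on `ℝ^d`. -/
def L2Loc (u : Euc d → F) : Prop :=
  ∀ K : Set (Euc d), IsCompact K → MemLp u 2 (volume.restrict K)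

namespace L2Loc

lemma of_ball {u : Euc d → F}
    (h : ∀ n : ℕ, MemLp u 2 (volume.restrict (Metric.closedBall 0 n))) : L2Loc u := by
  intro K hK
  obtain ⟨r, hr⟩ := hK.isBounded.subset_closedBall 0
  obtain ⟨n, hn⟩ := exists_nat_ge r
  exact (h n).mono_measure
    (Measure.restrict_mono (hr.trans (Metric.closedBall_subset_closedBall hn)) le_rfl)

lemma locallyIntegrable {u : Euc d → F} (h : L2Loc u) : LocallyIntegrable u := by
  rw [locallyIntegrable_iff]
  intro K hK
  have : IsFiniteMeasure (volume.restrict K) := ⟨by simpa using hK.measure_lt_top⟩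
  exact (h K hK).integrable one_le_two

lemma integrable_mul {u : Euc d → ℝ} (h : L2Loc u) {ψ : Euc d → ℝ} (hc : Continuous ψ)
    (hs : HasCompactSupport ψ) : Integrable (fun x => u x * ψ x) := by
  have := h.locallyIntegrable.integrable_smul_left_of_hasCompactSupport hc hs
  simpa [mul_comm] using this

lemma add {u v : Euc d → F} (hu : L2Loc u) (hv : L2Loc v) : L2Loc (fun x => u x + v x) :=
  fun K hK => (hu K hK).add (hv K hK)

lemma sub {u v : Euc d → F} (hu : L2Loc u) (hv : L2Loc v) : L2Loc (fun x => u x - v x) :=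
  fun K hK => (hu K hK).sub (hv K hK)

lemma const_smul [NormedSpace ℝ F] {u : Euc d → F} (hu : L2Loc u) (c : ℝ) :
    L2Loc (fun x => c • u x) :=
  fun K hK => (hu K hK).const_smul c

lemma comp_add_right {u : Euc d → F} (hu : L2Loc u) (a : Euc d) :
    L2Loc (fun x => u (x + a)) := by
  intro K hK
  have h1 := hu ((fun x => x + a) '' K) (hK.image (by fun_prop))
  have h2 : MeasurePreserving (fun x : Euc d => x + a) volume volume :=
    measurePreserving_add_right volume a
  have h3 := h2.restrict_preimage_emb (MeasurableEquiv.addRight a).measurableEmbedding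
    ((fun x => x + a) '' K)
  rw [Set.preimage_image_eq _ (add_left_injective a)] at h3
  exact h1.comp_measurePreserving h3

lemma apply {g : Euc d → Euc d} (hg : L2Loc g) (j : Fin d) : L2Loc (fun x => g x j) :=
  fun K hK => (EuclideanSpace.proj (𝕜 := ℝ) j).comp_memLp' (hg K hK)

lemma inner_const {g : Euc d → Euc d} (hg : L2Loc g) (h : Euc d) :
    L2Loc (fun x => inner ℝ (g x) h) :=
  fun K hK => by
    have := (innerSL ℝ h).comp_memLp' (hg K hK)
    simpa [Function.comp_def, real_inner_comm] using this

lemma of_continuous {u : Euc d → F} (hu : Continuous u) : L2Loc u := by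
  intro K hK
  obtain ⟨C, hC⟩ := hK.exists_bound_of_continuousOn hu.continuousOn
  have : IsFiniteMeasure (volume.restrict K) := ⟨by simpa using hK.measure_lt_top⟩
  refine MemLp.of_bound (hu.continuousOn.aestronglyMeasurable_of_isCompact hK hK.measurableSet) C ?_
  exact (ae_restrict_iff' hK.measurableSet).2 (ae_of_all _ hC)

lemma lintegral_sq_lt_top {u : Euc d → F} (hu : L2Loc u) {S : Set (Euc d)}
    (hS : Bornology.IsBounded S) : ∫⁻ x in S, ‖u x‖ₑ ^ 2 < ∞ := by
  obtain ⟨r, hr⟩ := hS.subset_closedBall 0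
  have := (hu _ (isCompact_closedBall (0 : Euc d) r)).2
  rw [eLpNorm_lt_top_iff_lintegral_rpow_enorm_lt_top two_ne_zero ENNReal.ofNat_ne_top] at this
  simp only [ENNReal.toReal_ofNat, ENNReal.rpow_ofNat] at this
  exact (lintegral_mono_set hr).trans_lt this

end L2Loc

end L2Loc

/-! ### Weak gradients -/

namespace HasWeakGradient

variable {d : ℕ} {u v : Euc d → ℝ} {g f : Euc d → Euc d}

lemma l2Loc (h : HasWeakGradient u g) : L2Loc u := h.1

lemma l2Loc_grad (h : HasWeakGradient u g) : L2Loc g := h.2.1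

lemma add (hu : HasWeakGradient u g) (hv : HasWeakGradient v f) :
    HasWeakGradient (fun x => u x + v x) (fun x => g x + f x) := by
  refine ⟨hu.l2Loc.add hv.l2Loc, hu.l2Loc_grad.add hv.l2Loc_grad, fun ψ hψ j => ?_⟩
  have h1 := hψ.continuous_gradient_apply j
  have h2 := hψ.hasCompactSupport_gradient_apply j
  simp only [add_mul, PiLp.add_apply]
  rw [integral_add (hu.l2Loc.integrable_mul h1 h2) (hv.l2Loc.integrable_mul h1 h2),
    integral_add ((hu.l2Loc_grad.apply j).integrable_mul hψ.continuous hψ.2.1)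
      ((hv.l2Loc_grad.apply j).integrable_mul hψ.continuous hψ.2.1),
    hu.2.2 ψ hψ j, hv.2.2 ψ hψ j, neg_add]

lemma const_smul (hu : HasWeakGradient u g) (c : ℝ) :
    HasWeakGradient (fun x => c * u x) (fun x => c • g x) := by
  refine ⟨hu.l2Loc.const_smul c, hu.l2Loc_grad.const_smul c, fun ψ hψ j => ?_⟩
  simp only [mul_assoc, PiLp.smul_apply, smul_eq_mul, integral_const_mul, hu.2.2 ψ hψ j, mul_neg]

lemma comp_add_right (hu : HasWeakGradient u g) (a : Euc d) :
    HasWeakGradient (fun x => u (x + a)) (fun x => g (x + a)) := by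
  refine ⟨hu.l2Loc.comp_add_right a, hu.l2Loc_grad.comp_add_right a, fun ψ hψ j => ?_⟩
  have h := hu.2.2 _ (hψ.comp_add_right (-a)) j
  simp only [gradient_comp_add_right] at h
  rw [← integral_add_right_eq_self _ a, ← integral_add_right_eq_self (fun x => g x j * _) a] at h
  simpa using h

lemma zero : HasWeakGradient (fun _ : Euc d => (0 : ℝ)) (fun _ => 0) := by
  refine ⟨L2Loc.of_continuous continuous_const, L2Loc.of_continuous continuous_const, fun ψ hψ j => by simp⟩

lemma sum {ι : Type*} (s : Finset ι) {u : ι → Euc d → ℝ} {g : ι → Euc d → Euc d}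
    (h : ∀ i ∈ s, HasWeakGradient (u i) (g i)) :
    HasWeakGradient (fun x => ∑ i ∈ s, u i x) (fun x => ∑ i ∈ s, g i x) := by
  classical
  induction s using Finset.induction_on with
  | empty => simpa using zero
  | insert i s hi ih =>
    simp only [Finset.sum_insert hi]
    exact (h i (by simp)).add (ih fun j hj => h j (by simp [hj]))

lemma integral_inner (hu : HasWeakGradient u g) {ψ : Euc d → ℝ}
    (hψ : IsTestFunction Set.univ ψ) (h : Euc d) :
    ∫ x, u x * inner ℝ (gradient ψ x) h = - ∫ x, inner ℝ (g x) h * ψ x := by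
  simp only [inner_eq_sum, Finset.mul_sum, Finset.sum_mul]
  rw [integral_finsetSum, integral_finsetSum, ← Finset.sum_neg_distrib]
  · refine Finset.sum_congr rfl fun j _ => ?_
    have := hu.2.2 ψ hψ j
    simp_rw [← mul_assoc, integral_mul_const, this, mul_right_comm _ (h j), integral_mul_const]
    ring
  · intro j _
    simpa only [mul_right_comm] using ((hu.l2Loc_grad.apply j).integrable_mul hψ.continuous
      hψ.2.1).mul_const (h j)
  · intro j _
    simpa only [mul_assoc] using (hu.l2Loc.integrable_mul (hψ.continuous_gradient_apply j)
      (hψ.hasCompactSupport_gradient_apply j)).mul_const (h j)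

lemma of_contDiff {u : Euc d → ℝ} (hu : ContDiff ℝ 1 u) : HasWeakGradient u (gradient u) := by
  refine ⟨L2Loc.of_continuous hu.continuous, L2Loc.of_continuous (continuous_gradient hu), fun ψ hψ j => ?_⟩
  have h1 : Continuous fun x => gradient u x j :=
    (EuclideanSpace.proj (𝕜 := ℝ) j).continuous.comp (continuous_gradient hu)
  have h2 := (L2Loc.of_continuous h1).integrable_mul hψ.continuous hψ.2.1
  have h3 := (L2Loc.of_continuous hu.continuous).integrable_mul (hψ.continuous_gradient_apply j)
    (hψ.hasCompactSupport_gradient_apply j)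
  have := integral_mul_fderiv_eq_neg_fderiv_mul_of_integrable (μ := (volume : Measure (Euc d)))
    (f := u) (g := ψ) (v := EuclideanSpace.single j (1:ℝ))
    (by simpa [← gradient_apply_eq_fderiv] using h2) (by simpa [← gradient_apply_eq_fderiv] using h3)
    ((L2Loc.of_continuous hu.continuous).integrable_mul hψ.continuous hψ.2.1)
    (fun x _ => hu.differentiable one_ne_zero x)
    (fun x _ => (hψ.contDiff_one.differentiable one_ne_zero) x)
  simpa [← gradient_apply_eq_fderiv] using this

end HasWeakGradient
end
noncomputable section

/-! ### Difference quotients of weakly differentiable functions -/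

section Segment

variable {d : ℕ}

instance : IsProbabilityMeasure (volume.restrict (Set.Ioc (0 : ℝ) 1)) := ⟨by simp⟩

lemma setLIntegral_ball_comp_add_le {f : Euc d → ℝ≥0∞} (hf : Measurable f) {a : Euc d}
    {R r : ℝ} (ha : ‖a‖ ≤ r) :
    ∫⁻ x in Metric.ball 0 R, f (x + a) ≤ ∫⁻ x in Metric.ball 0 (R + r), f x := by
  rw [← (measurePreserving_add_right volume a).setLIntegral_comp_preimage Metric.isOpen_ball.measurableSet hf]
  refine lintegral_mono_set fun x hx => ?_
  simp only [Set.mem_preimage, mem_ball_zero_iff] at hx ⊢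
  exact (norm_add_le _ _).trans_lt (by linarith)

/-- Tonelli: for each `s` the inner shift has length at most `‖h‖`, so it maps the ball into the
enlarged one. -/
lemma setLIntegral_ball_segment_le {f : Euc d → ℝ≥0∞} (hf : Measurable f) (h : Euc d) (R : ℝ) :
    ∫⁻ x in Metric.ball 0 R, ∫⁻ s in Set.Ioc (0 : ℝ) 1, f (x + s • h) ≤
      ∫⁻ x in Metric.ball 0 (R + ‖h‖), f x := by
  rw [lintegral_lintegral_swap (by fun_prop)]
  calc _ ≤ ∫⁻ s in Set.Ioc (0 : ℝ) 1, ∫⁻ x in Metric.ball 0 (R + ‖h‖), f x := by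
        refine setLIntegral_mono' measurableSet_Ioc fun s hs => ?_
        refine setLIntegral_ball_comp_add_le hf ?_
        rw [norm_smul, Real.norm_of_nonneg hs.1.le]
        exact mul_le_of_le_one_left (norm_nonneg _) hs.2
    _ = _ := by simp

/-- Jensen's inequality. No measurability is assumed, since the Bochner integral of a non-measurable
function is `0`. -/
lemma enorm_integral_sq_le {α : Type*} [MeasurableSpace α] (μ : Measure α)
    [IsProbabilityMeasure μ] {F : Type*} [NormedAddCommGroup F] [NormedSpace ℝ F] (f : α → F) :
    ‖∫ a, f a ∂μ‖ₑ ^ 2 ≤ ∫⁻ a, ‖f a‖ₑ ^ 2 ∂μ := by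
  by_cases hf : AEStronglyMeasurable f μ
  · have h1 := eLpNorm_le_eLpNorm_of_exponent_le (p := 1) (q := 2) one_le_two hf
    have h2 := enorm_integral_le_lintegral_enorm (μ := μ) f
    rw [eLpNorm_one_eq_lintegral_enorm] at h1
    have h3 := pow_le_pow_left' (h2.trans h1) 2
    refine h3.trans_eq ?_
    rw [eLpNorm_eq_lintegral_rpow_enorm_toReal two_ne_zero ENNReal.ofNat_ne_top]
    simp only [ENNReal.toReal_ofNat, ENNReal.rpow_ofNat]
    rw [← ENNReal.rpow_natCast, ← ENNReal.rpow_mul]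
    norm_num
  · rw [integral_non_aestronglyMeasurable hf]
    simp

lemma IsTestFunction.sub_eq_integral {U : Set (Euc d)} {ψ : Euc d → ℝ} (hψ : IsTestFunction U ψ)
    (x h : Euc d) :
    ψ (x - h) - ψ x = - ∫ s in Set.Ioc (0 : ℝ) 1, inner ℝ (gradient ψ (x - s • h)) h := by
  rw [← intervalIntegral.integral_of_le zero_le_one, ← intervalIntegral.integral_neg]
  have hc : Continuous fun s : ℝ => inner ℝ (gradient ψ (x - s • h)) h := by
    have := hψ.continuous_gradient
    fun_prop
  have := intervalIntegral.integral_eq_sub_of_hasDerivAt (a := 0) (b := 1)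
    (f := fun s : ℝ => ψ (x - s • h)) (f' := fun s => - inner ℝ (gradient ψ (x - s • h)) h)
    (fun s _ => ?_) (hc.neg.intervalIntegrable _ _)
  · simpa using this.symm
  · have h1 := ((hψ.contDiff_one.differentiable one_ne_zero) (x - s • h)).hasFDerivAt
    have h2 : HasDerivAt (fun s : ℝ => x - s • h) (-h) s := by
      simpa using ((hasDerivAt_id s).smul_const h).const_sub x
    simpa [inner_gradient_left, Function.comp_def] using h1.comp_hasDerivAt s h2

/-- A locally integrable weight against a bounded kernel supported in a fixed compact set. -/
lemma integrable_prod_of_compact {u : Euc d → ℝ} (hu : LocallyIntegrable u)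
    {k : Euc d × ℝ → ℝ} (hk : AEStronglyMeasurable k (volume.prod (volume.restrict (Set.Ioc (0 : ℝ) 1))))
    {C r : ℝ} (hC : ∀ p, ‖k p‖ ≤ C) (hr : ∀ x, ∀ s ∈ Set.Ioc (0 : ℝ) 1, r < ‖x‖ → k (x, s) = 0) :
    Integrable (fun p : Euc d × ℝ => u p.1 * k p) (volume.prod (volume.restrict (Set.Ioc (0 : ℝ) 1))) := by
  have h1 : Integrable ((Metric.closedBall (0 : Euc d) r).indicator u) :=
    (hu.integrableOn_isCompact (isCompact_closedBall _ _)).integrable_indicator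
      Metric.isClosed_closedBall.measurableSet
  have h2 := ((h1.comp_fst (volume.restrict (Set.Ioc (0 : ℝ) 1))).bdd_mul hk (ae_of_all _ hC))
  refine h2.congr ?_
  have h3 : ∀ᵐ p ∂((volume : Measure (Euc d)).prod (volume.restrict (Set.Ioc (0 : ℝ) 1))),
      p.2 ∈ Set.Ioc (0 : ℝ) 1 :=
    Measure.quasiMeasurePreserving_snd.ae (ae_restrict_mem measurableSet_Ioc)
  filter_upwards [h3] with p hp
  by_cases hx : ‖p.1‖ ≤ r
  · rw [Set.indicator_of_mem (by simpa using hx), mul_comm]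
  · rw [show k p = 0 from hr p.1 p.2 hp (not_le.1 hx)]; simp

lemma norm_smul_le_of_mem_Ioc {s : ℝ} (hs : s ∈ Set.Ioc (0 : ℝ) 1) (h : Euc d) : ‖s • h‖ ≤ ‖h‖ := by
  rw [norm_smul, Real.norm_of_nonneg hs.1.le]
  exact mul_le_of_le_one_left (norm_nonneg _) hs.2

lemma eq_zero_of_tsupport_subset_closedBall {F : Type*} [Zero F] {f : Euc d → F} {r : ℝ}
    (hr : tsupport f ⊆ Metric.closedBall 0 r) {x : Euc d} (hx : r < ‖x‖) : f x = 0 := by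
  by_contra h
  have := hr (subset_tsupport f (Function.mem_support.2 h))
  simp only [mem_closedBall_zero_iff] at this
  linarith

namespace HasWeakGradient

variable {u : Euc d → ℝ} {g : Euc d → Euc d}

lemma l2Loc_segment (hg : Measurable g) (hg2 : L2Loc g) (h : Euc d) (n : ℝ) :
    MemLp (fun p : Euc d × ℝ => g (p.1 + p.2 • h)) 2
      ((volume.restrict (Metric.ball 0 n)).prod (volume.restrict (Set.Ioc (0 : ℝ) 1))) := by
  refine ⟨(hg.comp (by fun_prop)).aestronglyMeasurable, ?_⟩
  rw [eLpNorm_lt_top_iff_lintegral_rpow_enorm_lt_top two_ne_zero ENNReal.ofNat_ne_top]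
  simp only [ENNReal.toReal_ofNat, ENNReal.rpow_ofNat]
  rw [lintegral_prod _ (by fun_prop)]
  exact (setLIntegral_ball_segment_le (f := fun x => ‖g x‖ₑ ^ 2) (by fun_prop) h n).trans_lt
    (hg2.lintegral_sq_lt_top Metric.isBounded_ball)

lemma l2Loc_integral_segment (hg : Measurable g) (hg2 : L2Loc g) (h : Euc d) :
    L2Loc (fun x => ∫ s in Set.Ioc (0 : ℝ) 1, inner ℝ (g (x + s • h)) h) := by
  refine L2Loc.of_ball fun n => ⟨?_, ?_⟩
  · refine (StronglyMeasurable.integral_prod_right (f := fun x (s : ℝ) => inner ℝ (g (x + s • h)) h)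
      ?_).aestronglyMeasurable
    refine Measurable.stronglyMeasurable ?_
    fun_prop
  rw [eLpNorm_lt_top_iff_lintegral_rpow_enorm_lt_top two_ne_zero ENNReal.ofNat_ne_top]
  simp only [ENNReal.toReal_ofNat, ENNReal.rpow_ofNat]
  have h1 : ∫⁻ x in Metric.ball (0 : Euc d) (n + 1), ∫⁻ s in Set.Ioc (0 : ℝ) 1,
      ‖(inner ℝ (g (x + s • h)) h : ℝ)‖ₑ ^ 2 < ∞ :=
    (setLIntegral_ball_segment_le (f := fun x => ‖(inner ℝ (g x) h : ℝ)‖ₑ ^ 2)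
      (by fun_prop) h (n + 1)).trans_lt
      ((hg2.inner_const h).lintegral_sq_lt_top Metric.isBounded_ball)
  refine lt_of_le_of_lt ?_ h1
  refine (lintegral_mono_set (Metric.closedBall_subset_ball (lt_add_one (n : ℝ)))).trans ?_
  exact lintegral_mono fun x => enorm_integral_sq_le _ _

/-- The fundamental theorem of calculus along the segment from `x` to `x + h` survives for weak
gradients, because it can be tested: after integration against `ψ` it becomes the classical formula
for `ψ`. This avoids approximating `u` by smooth functions. -/
lemma ae_sub_eq (hu : HasWeakGradient u g) (hg : Measurable g) (h : Euc d) :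
    ∀ᵐ x, u (x + h) - u x = ∫ s in Set.Ioc (0 : ℝ) 1, inner ℝ (g (x + s • h)) h := by
  set I : Euc d → ℝ := fun x => ∫ s in Set.Ioc (0 : ℝ) 1, inner ℝ (g (x + s • h)) h with hI
  have hI2 : L2Loc I := l2Loc_integral_segment hg hu.l2Loc_grad h
  have hw : L2Loc (fun x => u (x + h) - u x) := (hu.l2Loc.comp_add_right h).sub hu.l2Loc
  have key : ∀ᵐ x, (u (x + h) - u x) - I x = 0 := by
    refine ae_eq_zero_of_integral_contDiff_smul_eq_zero (hw.sub hI2).locallyIntegrable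
      fun ψ hψ hψs => ?_
    have hT : IsTestFunction Set.univ ψ := ⟨hψ, hψs, Set.subset_univ _⟩
    obtain ⟨r, hr⟩ := hψs.isCompact.isBounded.subset_closedBall 0
    obtain ⟨C, hC⟩ := hψs.exists_bound_of_continuous hT.continuous
    obtain ⟨C', hC'⟩ := hT.hasCompactSupport_gradient.exists_bound_of_continuous
      hT.continuous_gradient
    obtain ⟨r', hr'⟩ := hT.hasCompactSupport_gradient.isCompact.isBounded.subset_closedBall 0
    have hfar : ∀ (ρ : ℝ) (x : Euc d), ∀ s ∈ Set.Ioc (0 : ℝ) 1, ρ + ‖h‖ < ‖x‖ → ρ < ‖x - s • h‖ := by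
      intro ρ x s hs hx
      have := norm_sub_norm_le x (s • h)
      have := norm_smul_le_of_mem_Ioc hs h
      linarith
    have hcg := hT.continuous_gradient
    have hc := hT.continuous
    -- The increment is carried over to `ψ`, which is smooth and so is the line integral of its
    -- gradient; for fixed `s` the weak gradient identity applies to the shifted `ψ` (`e2`), and
    -- Fubini recovers `I` (`e3`).
    have e1 : ∫ x, u x * (ψ (x - h) - ψ x) =
        - ∫ s in Set.Ioc (0 : ℝ) 1, ∫ x, u x * inner ℝ (gradient ψ (x - s • h)) h := by
      simp_rw [hT.sub_eq_integral, mul_neg, ← integral_const_mul]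
      rw [integral_neg, integral_integral_swap]
      refine integrable_prod_of_compact (C := C' * ‖h‖) (r := r' + ‖h‖)
        (k := fun p : Euc d × ℝ => inner ℝ (gradient ψ (p.1 - p.2 • h)) h)
        hu.l2Loc.locallyIntegrable (Continuous.aestronglyMeasurable (by fun_prop)) ?_ ?_
      · intro p
        refine (norm_inner_le_norm _ _).trans ?_
        exact mul_le_mul_of_nonneg_right (hC' _) (norm_nonneg _)
      · intro x s hs hx
        simp [eq_zero_of_tsupport_subset_closedBall hr' (hfar r' x s hs hx)]
    have e2 : ∀ s : ℝ, ∫ x, u x * inner ℝ (gradient ψ (x - s • h)) h =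
        - ∫ x, inner ℝ (g (x + s • h)) h * ψ x := by
      intro s
      have := hu.integral_inner (hT.comp_add_right (-(s • h))) h
      simp only [gradient_comp_add_right] at this
      simp only [← sub_eq_add_neg] at this
      rw [this, ← integral_add_right_eq_self _ (s • h)]
      simp
    have e3 : ∫ s in Set.Ioc (0 : ℝ) 1, ∫ x, inner ℝ (g (x + s • h)) h * ψ x =
        ∫ x, I x * ψ x := by
      rw [integral_integral_swap]
      · simp_rw [integral_mul_const, hI]
      · rw [← integrable_swap_iff]
        have : IsFiniteMeasure (volume.restrict (Metric.ball (0 : Euc d) (r + 1))) :=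
          ⟨by simpa using measure_ball_lt_top⟩
        have h1 := (l2Loc_segment hg hu.l2Loc_grad h (r + 1)).integrable one_le_two
        have h2 := h1.inner_const (𝕜 := ℝ) h
        have h3 := h2.mul_bdd (c := C) (g := fun p : Euc d × ℝ => ψ p.1)
          (Continuous.aestronglyMeasurable (by fun_prop)) (ae_of_all _ fun p => hC p.1)
        have h4 : (volume.restrict (Metric.ball (0 : Euc d) (r + 1))).prod
            (volume.restrict (Set.Ioc (0 : ℝ) 1)) = (volume.prod
            (volume.restrict (Set.Ioc (0 : ℝ) 1))).restrict (Metric.ball 0 (r + 1) ×ˢ Set.univ) := by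
          rw [← Measure.prod_restrict, Measure.restrict_univ]
        rw [h4] at h3
        refine IntegrableOn.integrable_of_forall_notMem_eq_zero h3 fun p hp => ?_
        have : r < ‖p.1‖ := by
          simp only [Set.mem_prod, mem_ball_zero_iff, Set.mem_univ, and_true, not_lt] at hp
          linarith
        simp [Function.uncurry, eq_zero_of_tsupport_subset_closedBall hr this]
    have e4 : ∫ x, u (x + h) * ψ x = ∫ x, u x * ψ (x - h) := by
      rw [← integral_add_right_eq_self (fun x => u x * ψ (x - h)) h]
      simp
    have i1 := (hu.l2Loc.comp_add_right h).integrable_mul hc hψs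
    have i2 := hu.l2Loc.integrable_mul hc hψs
    have i3 := hI2.integrable_mul hc hψs
    have i4 : Integrable fun x => u x * ψ (x - h) :=
      hu.l2Loc.integrable_mul (by fun_prop) (by
        simpa [sub_eq_add_neg] using (hT.comp_add_right (-h)).2.1)
    simp_rw [smul_eq_mul, mul_comm (ψ _), sub_mul]
    have i5 := i1.sub i2
    simp only [Pi.sub_def] at i5
    rw [integral_sub i5 i3, integral_sub i1 i2, e4, ← e3, ← integral_sub i4 i2]
    simp_rw [← mul_sub, e1, e2, integral_neg]
    simp
  filter_upwards [key] with x hx using sub_eq_zero.1 hx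

/-- The `L²` norm of a translation increment is controlled by the gradient. -/
lemma setLIntegral_sub_sq_le (hu : HasWeakGradient u g) (hg : Measurable g) (h : Euc d) (R : ℝ) :
    ∫⁻ x in Metric.ball 0 R, ‖u (x + h) - u x‖ₑ ^ 2 ≤
      ‖h‖ₑ ^ 2 * ∫⁻ x in Metric.ball 0 (R + ‖h‖), ‖g x‖ₑ ^ 2 := by
  calc ∫⁻ x in Metric.ball 0 R, ‖u (x + h) - u x‖ₑ ^ 2
      ≤ ∫⁻ x in Metric.ball 0 R, ∫⁻ s in Set.Ioc (0 : ℝ) 1, ‖h‖ₑ ^ 2 * ‖g (x + s • h)‖ₑ ^ 2 := by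
        refine lintegral_mono_ae (ae_restrict_of_ae ?_)
        filter_upwards [hu.ae_sub_eq hg h] with x hx
        rw [hx]
        refine (enorm_integral_sq_le _ _).trans (lintegral_mono fun s => ?_)
        rw [← mul_pow, mul_comm]
        refine pow_le_pow_left' ?_ 2
        rw [← ofReal_norm, ← ofReal_norm, ← ofReal_norm,
          ← ENNReal.ofReal_mul (norm_nonneg _)]
        exact ENNReal.ofReal_le_ofReal (norm_inner_le_norm _ _)
    _ ≤ ∫⁻ x in Metric.ball 0 (R + ‖h‖), ‖h‖ₑ ^ 2 * ‖g x‖ₑ ^ 2 :=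
        setLIntegral_ball_segment_le (by fun_prop) h R
    _ = _ := lintegral_const_mul _ (by fun_prop)

end HasWeakGradient

end Segment
end
noncomputable section

/-! ### Cubes, balls and Poincaré's inequality -/

section Cube

variable {d : ℕ}

lemma cube_eq_preimage (x : Euc d) (R : ℝ) :
    cube x R = (WithLp.ofLp : Euc d → Fin d → ℝ) ⁻¹'
      (Set.univ.pi fun i => Set.Ioo (x i - R / 2) (x i + R / 2)) := by
  ext y
  simp only [cube, Set.mem_ofPred_eq, Set.mem_preimage, Set.mem_univ_pi, Set.mem_Ioo, abs_lt]
  refine forall_congr' fun i => ?_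
  constructor <;> rintro ⟨h1, h2⟩ <;> constructor <;> linarith

lemma isOpen_cube (x : Euc d) (R : ℝ) : IsOpen (cube x R) := by
  rw [cube_eq_preimage]
  exact (isOpen_set_pi Set.finite_univ fun i _ => isOpen_Ioo).preimage (PiLp.continuous_ofLp 2 _)

lemma measurableSet_cube (x : Euc d) (R : ℝ) : MeasurableSet (cube x R) :=
  (isOpen_cube x R).measurableSet

lemma volume_cube (x : Euc d) (R : ℝ) : volume (cube x R) = ENNReal.ofReal R ^ d := by
  rw [cube_eq_preimage, (PiLp.volume_preserving_ofLp (Fin d)).measure_preimage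
    (MeasurableSet.univ_pi fun i => measurableSet_Ioo).nullMeasurableSet, volume_pi_pi]
  have : ∀ i, x i + R / 2 - (x i - R / 2) = R := fun i => by ring
  simp [Real.volume_Ioo, this]

lemma norm_le_of_forall_abs_le {y : Euc d} {r : ℝ} (hr : 0 ≤ r) (h : ∀ i, |y i| ≤ r) :
    ‖y‖ ≤ d * r := by
  rw [EuclideanSpace.norm_eq]
  refine Real.sqrt_le_iff.2 ⟨by positivity, ?_⟩
  calc ∑ i, ‖y i‖ ^ 2 ≤ ∑ _i : Fin d, r ^ 2 :=
        Finset.sum_le_sum fun i _ => pow_le_pow_left₀ (norm_nonneg _) (h i) 2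
    _ = d * r ^ 2 := by simp
    _ ≤ (d * r) ^ 2 := by
        rw [mul_pow]
        refine mul_le_mul_of_nonneg_right ?_ (sq_nonneg r)
        exact_mod_cast Nat.le_self_pow two_ne_zero d

/-- A crude bound: the norm on the cube is at most `d * R / 2`, and `1 ≤ d` makes the inclusion in
the open ball strict. -/
lemma cube_subset_ball (hd : 1 ≤ d) {R : ℝ} (hR : 0 < R) :
    cube (0 : Euc d) R ⊆ Metric.ball 0 (d * R) := by
  intro y hy
  rw [mem_ball_zero_iff]
  have h1 : ‖y‖ ≤ d * (R / 2) :=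
    norm_le_of_forall_abs_le (by positivity) fun i => by simpa using (hy i).le
  have : (0 : ℝ) < d := by exact_mod_cast hd
  nlinarith

lemma volume_ball_eq (R : ℝ) (hR : 0 < R) :
    volume (Metric.ball (0 : Euc d) R) =
      ENNReal.ofReal R ^ d * volume (Metric.ball (0 : Euc d) 1) := by
  rw [Measure.addHaar_ball_of_pos _ _ hR, finrank_euclideanSpace_fin, ENNReal.ofReal_pow hR.le]

/-- The supremum over natural radii of the normalized integrals over centred balls. -/
def ballMax (f : Euc d → ℝ≥0∞) : ℝ≥0∞ :=
  ⨆ n : ℕ, (((n : ℝ≥0∞) + 1) ^ d)⁻¹ * ∫⁻ x in Metric.ball 0 (n + 1), f x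

/-- Rounding the radius up to `⌊r⌋ + 1 ≤ r + 1` reduces real radii to the countably many in
`ballMax`. -/
lemma setLIntegral_ball_le_ballMax (f : Euc d → ℝ≥0∞) {r : ℝ} (hr : 0 ≤ r) :
    ∫⁻ x in Metric.ball 0 r, f x ≤ ENNReal.ofReal (r + 1) ^ d * ballMax f := by
  set n := ⌊r⌋₊ with hn
  have h1 : (((n : ℝ≥0∞) + 1) ^ d)⁻¹ * ∫⁻ x in Metric.ball 0 (n + 1), f x ≤ ballMax f :=
    le_iSup (fun n : ℕ => (((n : ℝ≥0∞) + 1) ^ d)⁻¹ * ∫⁻ x in Metric.ball 0 (n + 1), f x) n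
  have h2 : ((n : ℝ≥0∞) + 1) ^ d ≠ 0 := by positivity
  have h3 : ((n : ℝ≥0∞) + 1) ^ d ≠ ∞ := by finiteness
  calc ∫⁻ x in Metric.ball 0 r, f x ≤ ∫⁻ x in Metric.ball 0 (n + 1), f x :=
        lintegral_mono_set (Metric.ball_subset_ball (Nat.lt_floor_add_one r).le)
    _ = ((n : ℝ≥0∞) + 1) ^ d *
        ((((n : ℝ≥0∞) + 1) ^ d)⁻¹ * ∫⁻ x in Metric.ball 0 (n + 1), f x) := by
        rw [← mul_assoc, ENNReal.mul_inv_cancel h2 h3, one_mul]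
    _ ≤ ENNReal.ofReal (r + 1) ^ d * ballMax f := by
        refine mul_le_mul' (pow_le_pow_left' ?_ d) h1
        rw [ENNReal.ofReal_add hr zero_le_one, ENNReal.ofReal_one]
        gcongr
        rw [← ENNReal.ofReal_natCast]
        exact ENNReal.ofReal_le_ofReal (Nat.floor_le hr)

/-- The rounding error is absorbed by `a * R + 1 ≤ (a + 1) * R`, which is where `1 ≤ R` enters. -/
lemma volume_cube_inv_mul_setLIntegral_ball_le (f : Euc d → ℝ≥0∞) {R a : ℝ} (hR : 1 ≤ R)
    (ha : 0 ≤ a) :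
    (volume (cube (0 : Euc d) R))⁻¹ * ∫⁻ x in Metric.ball 0 (a * R), f x ≤
      ENNReal.ofReal (a + 1) ^ d * ballMax f := by
  have hR0 : 0 < R := by linarith
  have h0 : ENNReal.ofReal R ^ d ≠ 0 := by simp [hR0]
  have h1 : ENNReal.ofReal R ^ d ≠ ∞ := by finiteness
  rw [volume_cube, mul_comm, ← div_eq_mul_inv]
  refine ENNReal.div_le_of_le_mul ?_
  refine (setLIntegral_ball_le_ballMax f (by positivity)).trans ?_
  calc ENNReal.ofReal (a * R + 1) ^ d * ballMax f
      ≤ (ENNReal.ofReal (a + 1) * ENNReal.ofReal R) ^ d * ballMax f := by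
        rw [← ENNReal.ofReal_mul (by positivity)]
        gcongr
        nlinarith
    _ = _ := by rw [mul_pow]; ring

lemma enorm_average_sq_le {α : Type*} [MeasurableSpace α] (μ : Measure α) [IsFiniteMeasure μ]
    (f : α → ℝ) : ‖⨍ a, f a ∂μ‖ₑ ^ 2 ≤ ⨍⁻ a, ‖f a‖ₑ ^ 2 ∂μ := by
  rcases eq_or_ne μ 0 with rfl | h
  · simp
  have : NeZero μ := ⟨h⟩
  exact enorm_integral_sq_le _ _

lemma isFiniteMeasure_restrict_cube (R : ℝ) :
    IsFiniteMeasure (volume.restrict (cube (0 : Euc d) R)) :=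
  ⟨by rw [Measure.restrict_apply_univ, volume_cube]; finiteness⟩

lemma neZero_restrict_cube {R : ℝ} (hR : 0 < R) :
    NeZero (volume.restrict (cube (0 : Euc d) R)) := by
  refine ⟨fun h => ?_⟩
  have := congrArg (fun μ => μ Set.univ) h
  simp only [Measure.restrict_apply_univ, volume_cube] at this
  simp at this
  linarith [this.1]

lemma setLaverage_eq_volume_inv_mul (S : Set (Euc d)) (f : Euc d → ℝ≥0∞) :
    ⨍⁻ x, f x ∂(volume.restrict S) = (volume S)⁻¹ * ∫⁻ x in S, f x := by
  rw [laverage_eq, Measure.restrict_apply_univ, div_eq_mul_inv, mul_comm]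

/-- Constant in Poincaré's inequality on cubes. -/
def poincareConst (d : ℕ) : ℝ≥0∞ :=
  ENNReal.ofReal (2 * d) ^ d * volume (Metric.ball (0 : Euc d) 1) * ENNReal.ofReal (2 * d) ^ 2

lemma poincareConst_ne_top (d : ℕ) : poincareConst d ≠ ∞ := by
  have : volume (Metric.ball (0 : Euc d) 1) ≠ ∞ := measure_ball_lt_top.ne
  unfold poincareConst
  finiteness

/-- Poincaré's inequality with the gradient on a larger ball, which is enough here. By Jensen the
left side is at most the double average of `|u(y) - u(x)|²`; with `y = x + h` the increment estimate
applies for each `h`. -/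
lemma HasWeakGradient.setLaverage_sub_average_sq_le (hd : 1 ≤ d) {u : Euc d → ℝ}
    {g : Euc d → Euc d} (hu : HasWeakGradient u g) (hum : Measurable u) (hg : Measurable g)
    {R : ℝ} (hR : 0 < R) :
    ⨍⁻ x, ‖u x - ⨍ z in cube 0 R, u z‖ₑ ^ 2 ∂(volume.restrict (cube 0 R)) ≤
      poincareConst d * ENNReal.ofReal R ^ 2 *
        ((volume (cube (0 : Euc d) R))⁻¹ * ∫⁻ x in Metric.ball 0 (3 * d * R), ‖g x‖ₑ ^ 2) := by
  set Q := cube (0 : Euc d) R with hQ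
  have := isFiniteMeasure_restrict_cube (d := d) R
  have := neZero_restrict_cube (d := d) hR
  have hd0 : (0 : ℝ) < d := by exact_mod_cast hd
  have hQint : Integrable u (volume.restrict Q) :=
    (hu.l2Loc.locallyIntegrable.integrableOn_isCompact (isCompact_closedBall 0 (d * R))).mono_set
      ((cube_subset_ball hd hR).trans Metric.ball_subset_closedBall)
  have h1 : ∀ x, ‖u x - ⨍ z in Q, u z‖ₑ ^ 2 ≤
      (volume Q)⁻¹ * ∫⁻ y in Q, ‖u y - u x‖ₑ ^ 2 := by
    intro x
    rw [← setLaverage_eq_volume_inv_mul]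
    have : u x - ⨍ z in Q, u z = - ⨍ y in Q, (u y - u x) := by
      rw [average_eq, average_eq, integral_sub hQint (integrable_const _), integral_const]
      have : (volume.restrict Q).real Set.univ ≠ 0 := by
        have h4 := this.out
        rw [Ne, Measure.real, ENNReal.toReal_eq_zero_iff, not_or]
        exact ⟨by simpa using h4, measure_ne_top _ _⟩
      simp only [smul_eq_mul]
      field_simp
      ring
    rw [this, enorm_neg]
    exact enorm_average_sq_le _ _
  -- Two points of `Q` lie in the ball of radius `d * R`, so `h = y - x` has norm below `2 * d * R`.
  -- The increment estimate then enlarges the ball to radius `3 * d * R`.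
  have h2 : ∫⁻ x in Q, ∫⁻ y in Q, ‖u y - u x‖ₑ ^ 2 ≤
      ∫⁻ h in Metric.ball (0 : Euc d) (2 * d * R), ∫⁻ x in Metric.ball (0 : Euc d) (d * R),
        ‖u (x + h) - u x‖ₑ ^ 2 := by
    rw [lintegral_lintegral_swap (f := fun h x => ‖u (x + h) - u x‖ₑ ^ 2) (by fun_prop)]
    refine (lintegral_mono_set (cube_subset_ball hd hR)).trans ?_
    refine setLIntegral_mono' Metric.isOpen_ball.measurableSet fun x hx => ?_
    have hmp := measurePreserving_add_left (volume : Measure (Euc d)) x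
    rw [← hmp.setLIntegral_comp_preimage (measurableSet_cube _ _) (by fun_prop)]
    refine lintegral_mono_set fun h hh => ?_
    have h3 := cube_subset_ball hd hR hh
    rw [mem_ball_zero_iff] at *
    have := norm_sub_le (x + h) x
    rw [add_sub_cancel_left] at this
    linarith
  have h3 : ∫⁻ h in Metric.ball (0 : Euc d) (2 * d * R), ∫⁻ x in Metric.ball (0 : Euc d) (d * R),
        ‖u (x + h) - u x‖ₑ ^ 2 ≤ volume (Metric.ball (0 : Euc d) (2 * d * R)) *
          (ENNReal.ofReal (2 * d * R) ^ 2 * ∫⁻ x in Metric.ball 0 (3 * d * R), ‖g x‖ₑ ^ 2) := by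
    rw [mul_comm (volume _), ← setLIntegral_const]
    refine setLIntegral_mono' Metric.isOpen_ball.measurableSet fun h hh => ?_
    rw [mem_ball_zero_iff] at hh
    refine (hu.setLIntegral_sub_sq_le hg h _).trans ?_
    gcongr
    · rw [← ofReal_norm]
      exact ENNReal.ofReal_le_ofReal hh.le
    · linarith
  rw [setLaverage_eq_volume_inv_mul]
  calc (volume Q)⁻¹ * ∫⁻ x in Q, ‖u x - ⨍ z in Q, u z‖ₑ ^ 2
      ≤ (volume Q)⁻¹ * ∫⁻ x in Q, (volume Q)⁻¹ * ∫⁻ y in Q, ‖u y - u x‖ₑ ^ 2 := by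
        gcongr with x
        exact h1 x
    _ = (volume Q)⁻¹ * ((volume Q)⁻¹ * ∫⁻ x in Q, ∫⁻ y in Q, ‖u y - u x‖ₑ ^ 2) := by
        rw [lintegral_const_mul]
        exact Measurable.lintegral_prod_right' (f := fun p : Euc d × Euc d => ‖u p.2 - u p.1‖ₑ ^ 2)
          (by fun_prop)
    _ ≤ (volume Q)⁻¹ * ((volume Q)⁻¹ * (volume (Metric.ball (0 : Euc d) (2 * d * R)) *
          (ENNReal.ofReal (2 * d * R) ^ 2 *
            ∫⁻ x in Metric.ball 0 (3 * d * R), ‖g x‖ₑ ^ 2))) := by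
        gcongr
        exact h2.trans h3
    _ = _ := by
        have hQ0 : ENNReal.ofReal R ^ d ≠ 0 := by
          simp [hR]
        rw [volume_ball_eq _ (by positivity), hQ, volume_cube, poincareConst,
          ENNReal.ofReal_mul (p := 2 * d) (by positivity), mul_pow, mul_pow]
        have := ENNReal.inv_mul_cancel hQ0 (by finiteness)
        calc _ = ((ENNReal.ofReal R ^ d)⁻¹ * ENNReal.ofReal R ^ d) * (ENNReal.ofReal (2 * d) ^ d *
              volume (Metric.ball (0 : Euc d) 1) * ENNReal.ofReal (2 * d) ^ 2 *
              ENNReal.ofReal R ^ 2 * ((ENNReal.ofReal R ^ d)⁻¹ *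
              ∫⁻ x in Metric.ball 0 (3 * d * R), ‖g x‖ₑ ^ 2)) := by ring
          _ = _ := by rw [this, one_mul]

end Cube
end
noncomputable section

/-! ### Approximation by averages of translates -/

section Translates

variable {d : ℕ} {ι : Type*}

/-- The average `∑ c_i f(x + a_i)` of translates. -/
def transAvg {F : Type*} [AddCommMonoid F] [SMul ℝ F] (s : Finset ι) (c : ι → ℝ) (a : ι → Euc d)
    (f : Euc d → F) (x : Euc d) : F :=
  ∑ i ∈ s, c i • f (x + a i)

protected lemma Measurable.transAvg {F : Type*} [NormedAddCommGroup F] [NormedSpace ℝ F] [MeasurableSpace F]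
    [BorelSpace F] [SecondCountableTopology F] (s : Finset ι) (c : ι → ℝ) (a : ι → Euc d)
    {f : Euc d → F} (hf : Measurable f) : Measurable (transAvg s c a f) := by
  unfold transAvg
  fun_prop

protected lemma HasWeakGradient.transAvg {u : Euc d → ℝ} {g : Euc d → Euc d} (hu : HasWeakGradient u g)
    (s : Finset ι) (c : ι → ℝ) (a : ι → Euc d) :
    HasWeakGradient (transAvg s c a u) (transAvg s c a g) :=
  HasWeakGradient.sum s fun i _ => (hu.comp_add_right (a i)).const_smul (c i)

/-- Convexity of the square of the norm. -/
lemma enorm_sum_smul_sq_le {F : Type*} [NormedAddCommGroup F] [NormedSpace ℝ F] (s : Finset ι)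
    {c : ι → ℝ} (hc : ∀ i ∈ s, 0 ≤ c i) (hc1 : ∑ i ∈ s, c i = 1) (v : ι → F) :
    ‖∑ i ∈ s, c i • v i‖ₑ ^ 2 ≤ ∑ i ∈ s, ENNReal.ofReal (c i) * ‖v i‖ₑ ^ 2 := by
  have h1 : ‖∑ i ∈ s, c i • v i‖ ≤ ∑ i ∈ s, c i * ‖v i‖ := by
    refine (norm_sum_le _ _).trans (Finset.sum_le_sum fun i hi => ?_)
    rw [norm_smul, Real.norm_of_nonneg (hc i hi)]
  have h2 : (∑ i ∈ s, c i * ‖v i‖) ^ 2 ≤ ∑ i ∈ s, c i * ‖v i‖ ^ 2 := by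
    simpa using (even_two.convexOn_pow (𝕜 := ℝ)).map_sum_le (t := s) (w := c)
      (p := fun i => ‖v i‖) hc hc1 (fun _ _ => Set.mem_univ _)
  have h3 := (pow_le_pow_left₀ (norm_nonneg _) h1 2).trans h2
  simp_rw [← ofReal_norm, ← ENNReal.ofReal_pow (norm_nonneg _)]
  refine (ENNReal.ofReal_le_ofReal h3).trans_eq ?_
  rw [ENNReal.ofReal_sum_of_nonneg fun i hi => mul_nonneg (hc i hi) (sq_nonneg _)]
  exact Finset.sum_congr rfl fun i hi => ENNReal.ofReal_mul (hc i hi)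

lemma sum_ofReal_mul_le (s : Finset ι) {c : ι → ℝ} (hc : ∀ i ∈ s, 0 ≤ c i)
    (hc1 : ∑ i ∈ s, c i = 1) {b : ι → ℝ≥0∞} {B : ℝ≥0∞} (hb : ∀ i ∈ s, b i ≤ B) :
    ∑ i ∈ s, ENNReal.ofReal (c i) * b i ≤ B := by
  calc ∑ i ∈ s, ENNReal.ofReal (c i) * b i ≤ ∑ i ∈ s, ENNReal.ofReal (c i) * B :=
        Finset.sum_le_sum fun i hi => mul_le_mul_right (hb i hi) _
    _ = B := by
        rw [← Finset.sum_mul, ← ENNReal.ofReal_sum_of_nonneg hc, hc1]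
        simp

lemma sub_transAvg_eq {F : Type*} [NormedAddCommGroup F] [NormedSpace ℝ F] (s : Finset ι)
    {c : ι → ℝ} (hc1 : ∑ i ∈ s, c i = 1) (a : ι → Euc d) (u : Euc d → F) (x : Euc d) :
    transAvg s c a u x - u x = ∑ i ∈ s, c i • (u (x + a i) - u x) := by
  simp_rw [smul_sub, Finset.sum_sub_distrib, ← Finset.sum_smul, hc1, one_smul, transAvg]

lemma enorm_add_sq_le {F : Type*} [NormedAddCommGroup F] (a b : F) :
    ‖a + b‖ₑ ^ 2 ≤ 2 * ‖a‖ₑ ^ 2 + 2 * ‖b‖ₑ ^ 2 := by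
  simp_rw [← ofReal_norm, ← ENNReal.ofReal_pow (norm_nonneg _)]
  rw [← ENNReal.ofReal_ofNat, ← ENNReal.ofReal_mul zero_le_two,
    ← ENNReal.ofReal_mul zero_le_two, ← ENNReal.ofReal_add (by positivity) (by positivity)]
  refine ENNReal.ofReal_le_ofReal ?_
  have := pow_le_pow_left₀ (norm_nonneg _) (norm_add_le a b) 2
  nlinarith [sq_nonneg (‖a‖ - ‖b‖)]

/-- Constant in the sublinearity estimate. -/
def sublinConst (d : ℕ) : ℝ≥0∞ :=
  8 * ENNReal.ofReal (d + 1 + 1) ^ d + 2 * (poincareConst d * ENNReal.ofReal (3 * d + 1) ^ d)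

lemma sublinConst_ne_top (d : ℕ) : sublinConst d ≠ ∞ := by
  have := poincareConst_ne_top d
  unfold sublinConst
  finiteness

variable {s : Finset ι} {c : ι → ℝ} {a : ι → Euc d}

/-- Averaging translates by at most `K` moves `u` by at most `K` times its gradient in quadratic
mean. The bound does not grow with `R`, so it is negligible after division by `R²`. -/
lemma HasWeakGradient.setLaverage_sub_transAvg_sq_le (hd : 1 ≤ d) {u : Euc d → ℝ}
    {g : Euc d → Euc d} (hu : HasWeakGradient u g) (hum : Measurable u) (hg : Measurable g)
    (hc : ∀ i ∈ s, 0 ≤ c i) (hc1 : ∑ i ∈ s, c i = 1) {K : ℝ} (ha : ∀ i ∈ s, ‖a i‖ ≤ K) {R : ℝ}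
    (hR : 1 ≤ R) (hK : K ≤ R) :
    ⨍⁻ x, ‖transAvg s c a u x - u x‖ₑ ^ 2 ∂(volume.restrict (cube 0 R)) ≤
      ENNReal.ofReal K ^ 2 * (ENNReal.ofReal (d + 1 + 1) ^ d * ballMax (fun x => ‖g x‖ₑ ^ 2)) := by
  have hR0 : 0 < R := by linarith
  rw [setLaverage_eq_volume_inv_mul]
  have h1 : ∀ i ∈ s, ∫⁻ x in cube 0 R, ‖u (x + a i) - u x‖ₑ ^ 2 ≤
      ENNReal.ofReal K ^ 2 * ∫⁻ x in Metric.ball 0 ((d + 1) * R), ‖g x‖ₑ ^ 2 := by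
    intro i hi
    refine (lintegral_mono_set (cube_subset_ball hd hR0)).trans ?_
    refine (hu.setLIntegral_sub_sq_le hg (a i) _).trans ?_
    gcongr
    · rw [← ofReal_norm]
      exact ENNReal.ofReal_le_ofReal (ha i hi)
    · linarith [ha i hi]
  have h2 : ∫⁻ x in cube 0 R, ‖transAvg s c a u x - u x‖ₑ ^ 2 ≤
      ENNReal.ofReal K ^ 2 * ∫⁻ x in Metric.ball 0 ((d + 1) * R), ‖g x‖ₑ ^ 2 := by
    calc ∫⁻ x in cube 0 R, ‖transAvg s c a u x - u x‖ₑ ^ 2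
        ≤ ∫⁻ x in cube 0 R, ∑ i ∈ s, ENNReal.ofReal (c i) * ‖u (x + a i) - u x‖ₑ ^ 2 := by
          refine lintegral_mono fun x => ?_
          rw [sub_transAvg_eq s hc1]
          exact enorm_sum_smul_sq_le s hc hc1 _
      _ = ∑ i ∈ s, ENNReal.ofReal (c i) * ∫⁻ x in cube 0 R, ‖u (x + a i) - u x‖ₑ ^ 2 := by
          rw [lintegral_finsetSum _ (by fun_prop)]
          exact Finset.sum_congr rfl fun i _ => lintegral_const_mul _ (by fun_prop)
      _ ≤ _ := sum_ofReal_mul_le s hc hc1 h1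
  calc _ ≤ (volume (cube (0 : Euc d) R))⁻¹ *
        (ENNReal.ofReal K ^ 2 * ∫⁻ x in Metric.ball 0 ((d + 1) * R), ‖g x‖ₑ ^ 2) := by gcongr
    _ = ENNReal.ofReal K ^ 2 * ((volume (cube (0 : Euc d) R))⁻¹ *
        ∫⁻ x in Metric.ball 0 ((d + 1) * R), ‖g x‖ₑ ^ 2) := by ring
    _ ≤ _ := mul_le_mul' le_rfl
        (volume_cube_inv_mul_setLIntegral_ball_le (a := d + 1) _ hR (by positivity))

/-- The deterministic core of sublinearity: the factor `R²` multiplies only the averaged gradient,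
which ergodicity makes small, while the full gradient carries the fixed factor `K²`. -/
theorem HasWeakGradient.setLaverage_sub_average_sq_le_ballMax (hd : 1 ≤ d) {u : Euc d → ℝ}
    {g : Euc d → Euc d} (hu : HasWeakGradient u g) (hum : Measurable u) (hg : Measurable g)
    (hc : ∀ i ∈ s, 0 ≤ c i) (hc1 : ∑ i ∈ s, c i = 1) {K : ℝ} (ha : ∀ i ∈ s, ‖a i‖ ≤ K) {R : ℝ}
    (hR : 1 ≤ R) (hK : K ≤ R) :
    ⨍⁻ x, ‖u x - ⨍ z in cube 0 R, u z‖ₑ ^ 2 ∂(volume.restrict (cube 0 R)) ≤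
      sublinConst d * (ENNReal.ofReal K ^ 2 * ballMax (fun x => ‖g x‖ₑ ^ 2) +
        ENNReal.ofReal R ^ 2 * ballMax (fun x => ‖transAvg s c a g x‖ₑ ^ 2)) := by
  have hR0 : 0 < R := by linarith
  set Q := cube (0 : Euc d) R with hQ
  have := isFiniteMeasure_restrict_cube (d := d) R
  have := neZero_restrict_cube (d := d) hR0
  set v := transAvg s c a u with hv
  have hvm : Measurable v := hum.transAvg s c a
  have hvg : HasWeakGradient v (transAvg s c a g) := hu.transAvg s c a
  have hint : ∀ {w : Euc d → ℝ}, L2Loc w → Integrable w (volume.restrict Q) := fun hw =>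
    (hw.locallyIntegrable.integrableOn_isCompact (isCompact_closedBall 0 (d * R))).mono_set
      ((cube_subset_ball hd hR0).trans Metric.ball_subset_closedBall)
  set A := ⨍⁻ x, ‖v x - u x‖ₑ ^ 2 ∂(volume.restrict Q) with hA
  set B := ⨍⁻ x, ‖v x - ⨍ z in Q, v z‖ₑ ^ 2 ∂(volume.restrict Q) with hB
  have hAle : A ≤ ENNReal.ofReal K ^ 2 *
      (ENNReal.ofReal (d + 1 + 1) ^ d * ballMax (fun x => ‖g x‖ₑ ^ 2)) :=
    hu.setLaverage_sub_transAvg_sq_le hd hum hg hc hc1 ha hR hK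
  have hBle : B ≤ poincareConst d * ENNReal.ofReal R ^ 2 *
      (ENNReal.ofReal (3 * d + 1) ^ d * ballMax (fun x => ‖transAvg s c a g x‖ₑ ^ 2)) := by
    refine (hvg.setLaverage_sub_average_sq_le hd hvm (hg.transAvg s c a) hR0).trans ?_
    exact mul_le_mul' le_rfl
      (volume_cube_inv_mul_setLIntegral_ball_le (a := 3 * d) _ hR (by positivity))
  -- Split `u - ⨍ u` into `-(v - u) + ⨍ (v - u)` and `v - ⨍ v`, and use `|a + b|² ≤ 2|a|² + 2|b|²`
  -- twice. Averaging over `Q` then gives `4A + 4A + 2B`.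
  have hpt : ∀ x, ‖u x - ⨍ z in Q, u z‖ₑ ^ 2 ≤
      4 * ‖v x - u x‖ₑ ^ 2 + 4 * A + 2 * ‖v x - ⨍ z in Q, v z‖ₑ ^ 2 := by
    intro x
    have e1 : ⨍ z in Q, (v z - u z) = (⨍ z in Q, v z) - ⨍ z in Q, u z := by
      rw [average_eq, average_eq, average_eq, integral_sub (hint hvg.l2Loc) (hint hu.l2Loc),
        smul_sub]
    have e2 : u x - ⨍ z in Q, u z =
        (-(v x - u x) + ⨍ z in Q, (v z - u z)) + (v x - ⨍ z in Q, v z) := by rw [e1]; ring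
    rw [e2]
    refine (enorm_add_sq_le _ _).trans ?_
    gcongr
    calc 2 * ‖-(v x - u x) + ⨍ z in Q, (v z - u z)‖ₑ ^ 2
        ≤ 2 * (2 * ‖v x - u x‖ₑ ^ 2 + 2 * A) := by
          gcongr
          refine (enorm_add_sq_le _ _).trans ?_
          rw [enorm_neg]
          gcongr
          exact enorm_average_sq_le _ _
      _ = _ := by ring
  have hfin : ⨍⁻ x, ‖u x - ⨍ z in Q, u z‖ₑ ^ 2 ∂(volume.restrict Q) ≤ 8 * A + 2 * B := by
    calc _ ≤ ⨍⁻ x, (4 * ‖v x - u x‖ₑ ^ 2 + 4 * A + 2 * ‖v x - ⨍ z in Q, v z‖ₑ ^ 2)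
          ∂(volume.restrict Q) := lintegral_mono hpt
      _ = 4 * A + 4 * A + 2 * B := by
          have hP : (((volume.restrict Q) Set.univ)⁻¹ • volume.restrict Q) Set.univ = 1 :=
            measure_univ
          unfold laverage at hA hB ⊢
          rw [lintegral_add_right _ (by fun_prop), lintegral_add_right _ (by fun_prop),
            lintegral_const_mul _ (by fun_prop), lintegral_const_mul 2 (by fun_prop),
            lintegral_const, hP, mul_one, ← hA, ← hB]
      _ = _ := by ring
  refine hfin.trans ?_
  calc 8 * A + 2 * B ≤ 8 * (ENNReal.ofReal K ^ 2 *
      (ENNReal.ofReal (d + 1 + 1) ^ d * ballMax (fun x => ‖g x‖ₑ ^ 2))) +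
      2 * (poincareConst d * ENNReal.ofReal R ^ 2 *
      (ENNReal.ofReal (3 * d + 1) ^ d * ballMax (fun x => ‖transAvg s c a g x‖ₑ ^ 2))) := by gcongr
    _ = (8 * ENNReal.ofReal (d + 1 + 1) ^ d) *
          (ENNReal.ofReal K ^ 2 * ballMax (fun x => ‖g x‖ₑ ^ 2)) +
        (2 * (poincareConst d * ENNReal.ofReal (3 * d + 1) ^ d)) *
          (ENNReal.ofReal R ^ 2 * ballMax (fun x => ‖transAvg s c a g x‖ₑ ^ 2)) := by ring
    _ ≤ _ := by
        rw [mul_add]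
        gcongr
        · exact le_self_add
        · exact le_add_self

end Translates
end
noncomputable section

/-! ### The dual norm of a field on a cube -/

section Dual

variable {d : ℕ} {ι : Type*} {s : Finset ι} {c : ι → ℝ} {a : ι → Euc d}

lemma eLpNorm_two_eq {α F : Type*} [MeasurableSpace α] [NormedAddCommGroup F] (f : α → F)
    (μ : Measure α) : eLpNorm f 2 μ = (∫⁻ x, ‖f x‖ₑ ^ 2 ∂μ) ^ (1 / 2 : ℝ) := by
  rw [eLpNorm_eq_lintegral_rpow_enorm_toReal two_ne_zero ENNReal.ofNat_ne_top]
  simp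

lemma eLpNorm_two_sq {α F : Type*} [MeasurableSpace α] [NormedAddCommGroup F] (f : α → F)
    (μ : Measure α) : eLpNorm f 2 μ ^ 2 = ∫⁻ x, ‖f x‖ₑ ^ 2 ∂μ := by
  rw [eLpNorm_two_eq, ← ENNReal.rpow_natCast, ← ENNReal.rpow_mul]
  norm_num

lemma enorm_integral_mul_le {α : Type*} [MeasurableSpace α] {μ : Measure α} {f g : α → ℝ}
    (hf : AEStronglyMeasurable f μ) (hg : AEStronglyMeasurable g μ) :
    ‖∫ x, f x * g x ∂μ‖ₑ ≤ eLpNorm f 2 μ * eLpNorm g 2 μ := by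
  refine (enorm_integral_le_lintegral_enorm _).trans ?_
  simp_rw [enorm_mul]
  have := ENNReal.lintegral_mul_le_Lp_mul_Lq μ Real.HolderConjugate.two_two hf.enorm hg.enorm
  simpa [eLpNorm_two_eq] using this

lemma eLpNorm_two_mono_set {F : Type*} [NormedAddCommGroup F] (f : Euc d → F) {S T : Set (Euc d)}
    (h : S ⊆ T) : eLpNorm f 2 (volume.restrict S) ≤ eLpNorm f 2 (volume.restrict T) :=
  eLpNorm_mono_measure _ (Measure.restrict_mono h le_rfl)

lemma IsTestFunction.eq_zero {U : Set (Euc d)} {ψ : Euc d → ℝ} (hψ : IsTestFunction U ψ) {x : Euc d}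
    (hx : x ∉ U) : ψ x = 0 := by
  by_contra h
  exact hx (hψ.2.2 (subset_tsupport _ h))

lemma IsTestFunction.gradient_eq_zero {U : Set (Euc d)} {ψ : Euc d → ℝ} (hψ : IsTestFunction U ψ)
    {x : Euc d} (hx : x ∉ U) : gradient ψ x = 0 := by
  have : x ∉ tsupport (fderiv ℝ ψ) := fun h => hx (hψ.2.2 (tsupport_fderiv_subset ℝ h))
  simp [gradient, image_eq_zero_of_notMem_tsupport this]

/-- The gradient vanishes off `U`, so the enlarged ball in the increment estimate costs nothing. -/
lemma IsTestFunction.eLpNorm_sub_le {U : Set (Euc d)} (hU : MeasurableSet U) {ψ : Euc d → ℝ}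
    (hψ : IsTestFunction U ψ) (h : Euc d) (R : ℝ) :
    eLpNorm (fun x => ψ (x + h) - ψ x) 2 (volume.restrict (Metric.ball 0 R)) ≤
      ‖h‖ₑ * eLpNorm (gradient ψ) 2 (volume.restrict U) := by
  rw [← ENNReal.pow_le_pow_left_iff two_ne_zero, mul_pow, eLpNorm_two_sq,
    eLpNorm_two_sq]
  have h1 := (HasWeakGradient.of_contDiff hψ.contDiff_one).setLIntegral_sub_sq_le
    hψ.continuous_gradient.measurable h R
  refine h1.trans (mul_le_mul' le_rfl ?_)
  calc _ ≤ ∫⁻ x, ‖gradient ψ x‖ₑ ^ 2 := setLIntegral_le_lintegral _ _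
    _ = _ := by
      rw [← lintegral_indicator hU]
      refine lintegral_congr fun x => ?_
      by_cases hx : x ∈ U
      · simp [hx]
      · simp [hx, hψ.gradient_eq_zero hx]

/-- Friedrichs' inequality: a shift by the full side length `R` along one axis leaves the cube, so
on the cube `ψ(x)` is, up to sign, the increment `ψ(x + h) - ψ(x)`. -/
lemma IsTestFunction.eLpNorm_cube_le (hd : 1 ≤ d) {R : ℝ} (hR : 0 < R) {ψ : Euc d → ℝ}
    (hψ : IsTestFunction (cube 0 R) ψ) :
    eLpNorm ψ 2 (volume.restrict (cube 0 R)) ≤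
      ENNReal.ofReal R * eLpNorm (gradient ψ) 2 (volume.restrict (cube 0 R)) := by
  set h : Euc d := EuclideanSpace.single ⟨0, hd⟩ R with hh
  have hn : ‖h‖ₑ = ENNReal.ofReal R := by
    rw [← ofReal_norm, hh, PiLp.norm_single, Real.norm_of_nonneg hR.le]
  have h1 : eLpNorm ψ 2 (volume.restrict (cube 0 R)) =
      eLpNorm (fun x => ψ (x + h) - ψ x) 2 (volume.restrict (cube 0 R)) := by
    refine eLpNorm_congr_norm_ae ((ae_restrict_iff' (measurableSet_cube _ _)).2
      (ae_of_all _ fun x hx => ?_))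
    have : x + h ∉ cube 0 R := by
      intro hxh
      have e1 := hx ⟨0, hd⟩
      have e2 := hxh ⟨0, hd⟩
      simp only [hh, PiLp.add_apply, PiLp.zero_apply, sub_zero, abs_lt,
        PiLp.single_apply, if_true] at e1 e2
      linarith
    simp [hψ.eq_zero this]
  rw [h1, ← hn]
  exact (eLpNorm_two_mono_set _ (cube_subset_ball hd hR)).trans
    (hψ.eLpNorm_sub_le (measurableSet_cube _ _) h _)

/-- The dual of the estimate for `u`: replacing `f` by its averaged translates changes the pairing
by increments of `ψ`, which cost `K ‖∇ψ‖`; against the average, Friedrichs costs `R ‖∇ψ‖`. -/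
lemma IsTestFunction.enorm_setIntegral_mul_le (hd : 1 ≤ d) {f : Euc d → ℝ} (hf : Measurable f)
    (hf2 : L2Loc f) (hc : ∀ i ∈ s, 0 ≤ c i) (hc1 : ∑ i ∈ s, c i = 1) {K : ℝ}
    (ha : ∀ i ∈ s, ‖a i‖ ≤ K) {R : ℝ} (hR : 0 < R) (hK : K ≤ R) {ψ : Euc d → ℝ}
    (hψ : IsTestFunction (cube 0 R) ψ) :
    ‖∫ x in cube 0 R, f x * ψ x‖ₑ ≤
      (ENNReal.ofReal K * eLpNorm f 2 (volume.restrict (Metric.ball 0 ((d + 1) * R))) +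
        ENNReal.ofReal R * eLpNorm (transAvg s c a f) 2 (volume.restrict (cube 0 R))) *
        eLpNorm (gradient ψ) 2 (volume.restrict (cube 0 R)) := by
  set Q := cube (0 : Euc d) R with hQ
  set N := eLpNorm (gradient ψ) 2 (volume.restrict Q) with hN
  have hcont := hψ.continuous
  have hfull : ∀ w : Euc d → ℝ, ∫ x in Q, w x * ψ x = ∫ x, w x * ψ x := fun w =>
    setIntegral_eq_integral_of_forall_compl_eq_zero fun x hx => by simp [hψ.eq_zero hx]
  have hT : IsTestFunction Set.univ ψ := hψ.mono (Set.subset_univ _)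
  have hi : ∀ i, Integrable fun x => f (x + a i) * ψ x := fun i =>
    (hf2.comp_add_right (a i)).integrable_mul hψ.continuous hψ.2.1
  have hi0 : Integrable fun x => f x * ψ x := hf2.integrable_mul hψ.continuous hψ.2.1
  have hi2 : ∀ i, Integrable fun x => f x * ψ (x - a i) := fun i => by
    have := hT.comp_add_right (-(a i))
    simpa [sub_eq_add_neg] using hf2.integrable_mul this.continuous this.2.1
  have hterm : ∀ i ∈ s, ‖(∫ x, f (x + a i) * ψ x) - ∫ x, f x * ψ x‖ₑ ≤
      ENNReal.ofReal K * eLpNorm f 2 (volume.restrict (Metric.ball 0 ((d + 1) * R))) * N := by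
    intro i his
    have e1 : ∫ x, f (x + a i) * ψ x = ∫ x, f x * ψ (x - a i) := by
      rw [← integral_add_right_eq_self (fun x => f x * ψ (x - a i)) (a i)]
      simp
    -- Both `ψ` and its translate are supported in the ball of radius `(d + 1) * R`, as `‖a i‖ ≤ K ≤
    -- R`.
    have e2 : ∫ x, f x * (ψ (x + -a i) - ψ x) =
        ∫ x in Metric.ball 0 ((d + 1) * R), f x * (ψ (x + -a i) - ψ x) := by
      refine (setIntegral_eq_integral_of_forall_compl_eq_zero fun x hx => ?_).symm
      rw [mem_ball_zero_iff, not_lt] at hx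
      have hKi := ha i his
      have n1 : x ∉ Q := fun h => by
        have := cube_subset_ball hd hR h
        rw [mem_ball_zero_iff] at this
        nlinarith
      have n2 : x + -a i ∉ Q := fun h => by
        have := cube_subset_ball hd hR h
        rw [mem_ball_zero_iff] at this
        have h3 := norm_sub_norm_le x (a i)
        rw [sub_eq_add_neg x] at h3
        nlinarith
      rw [hψ.eq_zero n1, hψ.eq_zero n2]; simp
    rw [e1, ← integral_sub (hi2 i) hi0]
    simp_rw [← mul_sub, sub_eq_add_neg _ (a i)]
    rw [e2]
    refine (enorm_integral_mul_le hf.aestronglyMeasurable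
      (Continuous.aestronglyMeasurable (by fun_prop))).trans ?_
    have := hψ.eLpNorm_sub_le (measurableSet_cube _ _) (-a i) ((d + 1) * R)
    rw [mul_comm (ENNReal.ofReal K), mul_assoc]
    gcongr
    refine this.trans ?_
    gcongr
    rw [← ofReal_norm, norm_neg]
    exact ENNReal.ofReal_le_ofReal (ha i his)
  -- This uses that the weights sum to one.
  have hdec : ∫ x in Q, f x * ψ x = (∫ x in Q, transAvg s c a f x * ψ x) -
      ∑ i ∈ s, c i • ((∫ x, f (x + a i) * ψ x) - ∫ x, f x * ψ x) := by
    rw [hfull, hfull]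
    simp_rw [transAvg, Finset.sum_mul, smul_eq_mul, mul_assoc]
    rw [integral_finsetSum _ fun i _ => (hi i).const_mul _]
    simp_rw [integral_const_mul, mul_sub, Finset.sum_sub_distrib, ← Finset.sum_mul, hc1]
    ring
  rw [hdec, add_mul, add_comm]
  refine (enorm_sub_le).trans (add_le_add ?_ ?_)
  · refine (enorm_integral_mul_le (hf.transAvg s c a).aestronglyMeasurable
      hcont.aestronglyMeasurable).trans ?_
    rw [mul_comm (ENNReal.ofReal R), mul_assoc]
    gcongr
    exact hψ.eLpNorm_cube_le hd hR
  · refine (enorm_sum_le _ _).trans ?_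
    refine le_trans (Finset.sum_le_sum fun i his => ?_)
      (sum_ofReal_mul_le s hc hc1 (b := fun i => ‖(∫ x, f (x + a i) * ψ x) - ∫ x, f x * ψ x‖ₑ) hterm)
    rw [enorm_smul, ← ofReal_norm, Real.norm_of_nonneg (hc i his)]

lemma eLpNorm_le_of_average_le {R : ℝ} {g : Euc d → Euc d}
    (hg : MemLp g 2 (volume.restrict (cube 0 R))) (hR : 0 < R)
    (h : ⨍ x in cube 0 R, ‖g x‖ ^ 2 ≤ 1) :
    eLpNorm g 2 (volume.restrict (cube 0 R)) ≤ volume (cube (0 : Euc d) R) ^ (1 / 2 : ℝ) := by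
  have := isFiniteMeasure_restrict_cube (d := d) R
  have := neZero_restrict_cube (d := d) hR
  have hv : volume (cube (0 : Euc d) R) ≠ ∞ := by rw [volume_cube]; finiteness
  have hv0 : volume (cube (0 : Euc d) R) ≠ 0 := by rw [volume_cube]; simp [hR]
  rw [eLpNorm_two_eq]
  refine ENNReal.rpow_le_rpow ?_ (by norm_num)
  have hi : Integrable (fun x => ‖g x‖ ^ 2) (volume.restrict (cube 0 R)) :=
    hg.integrable_norm_pow two_ne_zero
  have e1 : ∫⁻ x in cube 0 R, ‖g x‖ₑ ^ 2 = ENNReal.ofReal (∫ x in cube 0 R, ‖g x‖ ^ 2) := by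
    rw [ofReal_integral_eq_lintegral_ofReal hi (ae_of_all _ fun x => sq_nonneg _)]
    refine lintegral_congr fun x => ?_
    rw [← ofReal_norm, ENNReal.ofReal_pow (norm_nonneg _)]
  rw [e1, ← ENNReal.ofReal_toReal hv]
  refine ENNReal.ofReal_le_ofReal ?_
  rw [setAverage_eq, smul_eq_mul, Measure.real, inv_mul_le_iff₀ (ENNReal.toReal_pos hv0 hv), mul_one] at h
  exact h

/-- Constant in the averaging estimate. -/
def averagingConst (d : ℕ) : ℝ≥0∞ := (ENNReal.ofReal (d + 1 + 1) ^ d) ^ (1 / 2 : ℝ)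

lemma averagingConst_ne_top (d : ℕ) : averagingConst d ≠ ∞ := by
  unfold averagingConst
  finiteness

theorem hMinusOneNorm_le_ballMax (hd : 1 ≤ d) {f : Euc d → ℝ} (hf : Measurable f)
    (hf2 : L2Loc f) (hc : ∀ i ∈ s, 0 ≤ c i) (hc1 : ∑ i ∈ s, c i = 1) {K : ℝ}
    (ha : ∀ i ∈ s, ‖a i‖ ≤ K) {R : ℝ} (hR : 1 ≤ R) (hK : K ≤ R) :
    hMinusOneNorm (cube 0 R) f ≤ averagingConst d *
      (ENNReal.ofReal K * ballMax (fun x => ‖f x‖ₑ ^ 2) ^ (1 / 2 : ℝ) +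
        ENNReal.ofReal R * ballMax (fun x => ‖transAvg s c a f x‖ₑ ^ 2) ^ (1 / 2 : ℝ)) := by
  have hR0 : 0 < R := by linarith
  set Q := cube (0 : Euc d) R with hQ
  set V := volume Q with hV
  have hVt : V ≠ ∞ := by rw [hV, hQ, volume_cube]; finiteness
  have hV0 : V ≠ 0 := by rw [hV, hQ, volume_cube]; simp [hR0]
  have hd1 : (1 : ℝ) ≤ d + 1 := by simp
  have hsub : Q ⊆ Metric.ball 0 ((d + 1) * R) :=
    (cube_subset_ball hd hR0).trans (Metric.ball_subset_ball (by nlinarith))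
  set B1 := eLpNorm f 2 (volume.restrict (Metric.ball 0 ((d + 1) * R))) with hB1
  set B2 := eLpNorm (transAvg s c a f) 2 (volume.restrict Q) with hB2
  have hfin : ∀ {w : Euc d → ℝ}, L2Loc w → ∀ r,
      eLpNorm w 2 (volume.restrict (Metric.ball 0 r)) ≠ ∞ := fun {w} hw r =>
    ((eLpNorm_two_mono_set _ Metric.ball_subset_closedBall).trans_lt
      (hw _ (isCompact_closedBall 0 r)).2).ne
  have hB1t : B1 ≠ ∞ := hfin hf2 _
  have hf2' : L2Loc (transAvg s c a f) := by
    intro S hS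
    exact memLp_finsetSum _ fun i _ => ((hf2.comp_add_right (a i)).const_smul (c i)) S hS
  have hB2t : B2 ≠ ∞ :=
    ((eLpNorm_two_mono_set _ hsub).trans_lt (hfin hf2' _).lt_top).ne
  -- The constraint on the average of `|∇v|²` gives `‖∇v‖ ≤ V^(1/2)`. One half power of `V⁻¹`
  -- cancels it, and the other turns the `L²` norm of `f` into a quadratic mean.
  have hhalf : ∀ b : ℝ≥0∞, V⁻¹ * (b * V ^ (1 / 2 : ℝ)) = b * V⁻¹ ^ (1 / 2 : ℝ) := by
    intro b
    have : V⁻¹ = V⁻¹ ^ (1 / 2 : ℝ) * V⁻¹ ^ (1 / 2 : ℝ) := by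
      rw [← ENNReal.rpow_add_of_nonneg _ _ (by norm_num) (by norm_num)]
      norm_num
    have h2 : V⁻¹ ^ (1 / 2 : ℝ) * V ^ (1 / 2 : ℝ) = 1 := by
      rw [← ENNReal.mul_rpow_of_nonneg _ _ (by norm_num), ENNReal.inv_mul_cancel hV0 hVt]
      simp
    calc V⁻¹ * (b * V ^ (1 / 2 : ℝ))
        = (V⁻¹ ^ (1 / 2 : ℝ) * V⁻¹ ^ (1 / 2 : ℝ)) * (b * V ^ (1 / 2 : ℝ)) := by rw [← this]
      _ = b * V⁻¹ ^ (1 / 2 : ℝ) * (V⁻¹ ^ (1 / 2 : ℝ) * V ^ (1 / 2 : ℝ)) := by ring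
      _ = _ := by rw [h2, mul_one]
  have hmax : ∀ w : Euc d → ℝ,
      eLpNorm w 2 (volume.restrict (Metric.ball 0 ((d + 1) * R))) * V⁻¹ ^ (1 / 2 : ℝ) ≤
        averagingConst d * ballMax (fun x => ‖w x‖ₑ ^ 2) ^ (1 / 2 : ℝ) := by
    intro w
    rw [eLpNorm_two_eq, averagingConst, ← ENNReal.mul_rpow_of_nonneg _ _ (by norm_num),
      ← ENNReal.mul_rpow_of_nonneg _ _ (by norm_num), mul_comm (∫⁻ _ in _, _)]
    refine ENNReal.rpow_le_rpow ?_ (by norm_num)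
    exact volume_cube_inv_mul_setLIntegral_ball_le (a := d + 1) _ hR (by positivity)
  refine iSup_le fun v => iSup_le fun g => iSup_le fun hvg => iSup_le fun hg1 => ?_
  obtain ⟨hv, hg, ψ, hψ, hψv, hψg⟩ := hvg
  have hmain : ‖∫ x in Q, f x * v x‖ₑ ≤
      (ENNReal.ofReal K * B1 + ENNReal.ofReal R * B2) * V ^ (1 / 2 : ℝ) := by
    set T := ENNReal.ofReal K * B1 + ENNReal.ofReal R * B2 with hT
    have hTt : T ≠ ∞ := by finiteness
    have hfQ : MemLp f 2 (volume.restrict Q) :=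
      (hf2 _ (isCompact_closedBall 0 ((d + 1) * R))).mono_measure
        (Measure.restrict_mono (hsub.trans Metric.ball_subset_closedBall) le_rfl)
    -- The estimate is known for test functions; the errors of approximating `v` and its gradient
    -- are carried along and vanish as `n → ∞`.
    have hbound : ∀ n, ‖∫ x in Q, f x * v x‖ₑ ≤
        T * (V ^ (1 / 2 : ℝ) + eLpNorm (fun x => gradient (ψ n) x - g x) 2 (volume.restrict Q)) +
        eLpNorm f 2 (volume.restrict Q) *
          eLpNorm (fun x => ψ n x - v x) 2 (volume.restrict Q) := by
      intro n
      have hψm : AEStronglyMeasurable (ψ n) (volume.restrict Q) :=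
        (hψ n).continuous.aestronglyMeasurable
      have hψL : MemLp (ψ n) 2 (volume.restrict Q) :=
        (((hψ n).continuous.memLp_of_hasCompactSupport (hψ n).2.1).restrict Q)
      have i1 : Integrable (fun x => f x * ψ n x) (volume.restrict Q) := hfQ.integrable_mul hψL
      have i2 : Integrable (fun x => f x * v x) (volume.restrict Q) := hfQ.integrable_mul hv
      have e1 : ∫ x in Q, f x * v x = (∫ x in Q, f x * ψ n x) -
          ∫ x in Q, f x * (ψ n x - v x) := by
        simp_rw [mul_sub]
        rw [integral_sub i1 i2]; ring
      rw [e1]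
      refine enorm_sub_le.trans (add_le_add ?_ ?_)
      · refine ((hψ n).enorm_setIntegral_mul_le hd hf hf2 hc hc1 ha hR0 hK).trans ?_
        gcongr
        have e2 : gradient (ψ n) = fun x => g x + (gradient (ψ n) x - g x) := by
          ext1 x; abel
        calc _ = eLpNorm (g + fun x => (gradient (ψ n) x - g x)) 2 (volume.restrict Q) := by
              conv_lhs => rw [e2]
              rfl
          _ ≤ _ := eLpNorm_add_le hg.1 ((hψ n).continuous_gradient.aestronglyMeasurable.sub hg.1)
              one_le_two
          _ ≤ _ := by
              gcongr
              exact eLpNorm_le_of_average_le hg hR0 hg1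
      · exact enorm_integral_mul_le hfQ.1 (hψm.sub hv.1)
    have hlim : Tendsto (fun n => T * (V ^ (1 / 2 : ℝ) +
          eLpNorm (fun x => gradient (ψ n) x - g x) 2 (volume.restrict Q)) +
        eLpNorm f 2 (volume.restrict Q) *
          eLpNorm (fun x => ψ n x - v x) 2 (volume.restrict Q)) atTop
        (𝓝 (T * (V ^ (1 / 2 : ℝ) + 0) + eLpNorm f 2 (volume.restrict Q) * 0)) :=
      (ENNReal.Tendsto.const_mul (tendsto_const_nhds.add hψg) (Or.inr hTt)).add
        (ENNReal.Tendsto.const_mul hψv (Or.inr hfQ.2.ne))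
    have := ge_of_tendsto' hlim hbound
    simpa using this
  calc ENNReal.ofReal (⨍ x in Q, f x * v x) ≤ ‖⨍ x in Q, f x * v x‖ₑ :=
        Real.ofReal_le_enorm _
    _ = V⁻¹ * ‖∫ x in Q, f x * v x‖ₑ := by
        rw [setAverage_eq, enorm_smul, Measure.real, ← ENNReal.toReal_inv, Real.enorm_eq_ofReal
          ENNReal.toReal_nonneg, ENNReal.ofReal_toReal (ENNReal.inv_ne_top.2 hV0)]
    _ ≤ V⁻¹ * ((ENNReal.ofReal K * B1 + ENNReal.ofReal R * B2) * V ^ (1 / 2 : ℝ)) := by gcongr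
    _ = ENNReal.ofReal K * (B1 * V⁻¹ ^ (1 / 2 : ℝ)) +
        ENNReal.ofReal R * (B2 * V⁻¹ ^ (1 / 2 : ℝ)) := by rw [hhalf]; ring
    _ ≤ ENNReal.ofReal K * (averagingConst d * ballMax (fun x => ‖f x‖ₑ ^ 2) ^ (1 / 2 : ℝ)) +
        ENNReal.ofReal R * (averagingConst d *
          ballMax (fun x => ‖transAvg s c a f x‖ₑ ^ 2) ^ (1 / 2 : ℝ)) := by
        exact add_le_add (mul_le_mul' le_rfl (hmax f)) (mul_le_mul' le_rfl
          ((mul_le_mul_left (eLpNorm_two_mono_set _ hsub) _).trans (hmax _)))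
    _ = _ := by ring

end Dual
end
noncomputable section

/-! ### The maximal inequality -/

section Vitali

variable {d : ℕ}

/-- The Hardy–Littlewood argument: among the balls on which `F` has large mean, Vitali selects
disjoint ones whose fivefold enlargements cover `A`. The truncation `n < N` bounds the radii, as
Vitali requires, and keeps all balls inside the ball of radius `2 * N`. -/
lemma volume_le_of_forall_exists_lt_setLIntegral_ball {F : Euc d → ℝ≥0∞} {t : ℝ≥0∞} (ht : t ≠ 0)
    (ht' : t ≠ ∞) {N : ℕ} {A : Set (Euc d)} (hA : A ⊆ Metric.ball 0 N)
    (h : ∀ x ∈ A, ∃ n : ℕ, n < N ∧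
      t * ((n : ℝ≥0∞) + 1) ^ d < ∫⁻ y in Metric.ball x (n + 1), F y) :
    volume A ≤ (5 ^ d * volume (Metric.ball (0 : Euc d) 1)) * t⁻¹ *
      ∫⁻ y in Metric.ball 0 (2 * N), F y := by
  choose! n hnN hn using h
  obtain ⟨u, huA, hdisj, hcov⟩ :=
    Vitali.exists_disjoint_subfamily_covering_enlargement_closedBall A id
      (fun x => (n x : ℝ) + 1) N (fun x hx => by exact_mod_cast hnN x hx) 5 (by norm_num)
  have hu : u.Countable := by
    refine hdisj.countable_of_nonempty_interior fun b _ => ?_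
    exact ⟨b, Metric.ball_subset_interior_closedBall (Metric.mem_ball_self (by positivity))⟩
  have hAc : A ⊆ ⋃ b ∈ u, Metric.closedBall b (5 * (n b + 1)) := by
    intro x hx
    obtain ⟨b, hb, hxb⟩ := hcov x hx
    exact Set.mem_biUnion hb (hxb (Metric.mem_closedBall_self (by positivity)))
  have hdisj' : u.PairwiseDisjoint fun b => Metric.ball b ((n b : ℝ) + 1) :=
    hdisj.mono fun b => Metric.ball_subset_closedBall
  have hvol : ∀ b ∈ u, volume (Metric.closedBall b (5 * ((n b : ℝ) + 1))) ≤
      (5 ^ d * volume (Metric.ball (0 : Euc d) 1)) * t⁻¹ *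
        ∫⁻ y in Metric.ball b (n b + 1), F y := by
    intro b hb
    rw [Measure.addHaar_closedBall _ _ (by positivity), finrank_euclideanSpace_fin, mul_pow,
      ENNReal.ofReal_mul (by positivity), ENNReal.ofReal_pow (by positivity),
      ENNReal.ofReal_pow (by positivity), ENNReal.ofReal_ofNat,
      ENNReal.ofReal_add (by positivity) zero_le_one, ENNReal.ofReal_natCast, ENNReal.ofReal_one]
    have h1 : ((n b : ℝ≥0∞) + 1) ^ d ≤ t⁻¹ * ∫⁻ y in Metric.ball b (n b + 1), F y := by
      rw [mul_comm, ← div_eq_mul_inv, ENNReal.le_div_iff_mul_le (Or.inl ht) (Or.inl ht'), mul_comm]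
      exact (hn b (huA hb)).le
    calc (5 : ℝ≥0∞) ^ d * ((n b : ℝ≥0∞) + 1) ^ d * volume (Metric.ball (0 : Euc d) 1)
        ≤ 5 ^ d * (t⁻¹ * ∫⁻ y in Metric.ball b (n b + 1), F y) *
          volume (Metric.ball (0 : Euc d) 1) := by gcongr
      _ = _ := by ring
  calc volume A ≤ ∑' b : u, volume (Metric.closedBall (b : Euc d) (5 * ((n b : ℝ) + 1))) :=
        (measure_mono hAc).trans (measure_biUnion_le _ hu _)
    _ ≤ ∑' b : u, (5 ^ d * volume (Metric.ball (0 : Euc d) 1)) * t⁻¹ *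
        ∫⁻ y in Metric.ball (b : Euc d) (n b + 1), F y :=
        ENNReal.tsum_le_tsum fun b => hvol b b.2
    _ = (5 ^ d * volume (Metric.ball (0 : Euc d) 1)) * t⁻¹ *
        ∫⁻ y in ⋃ b ∈ u, Metric.ball b ((n b : ℝ) + 1), F y := by
        rw [ENNReal.tsum_mul_left,
          lintegral_biUnion hu (fun b _ => Metric.isOpen_ball.measurableSet) hdisj']
    _ ≤ _ := by
        refine mul_le_mul' le_rfl (lintegral_mono_set (Set.iUnion₂_subset fun b hb => ?_))
        refine Metric.ball_subset_ball' ?_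
        have h1 := hA (huA hb)
        have h2 : (n b : ℝ) + 1 ≤ N := by exact_mod_cast hnN b (huA hb)
        rw [Metric.mem_ball] at h1
        linarith

end Vitali

/-! ### Stationarity along orbits and transference to the probability space -/

namespace Medium

variable {d : ℕ} {Ω : Type*} [MeasurableSpace Ω] {P : Measure Ω}

section Basic

variable (M : Medium d P)

lemma measurable_τ (x : Euc d) : Measurable (M.τ x) :=
  M.τ_measurable.comp measurable_prodMk_right

lemma measurePreserving_τ (x : Euc d) : MeasurePreserving (M.τ x) P P :=
  ⟨M.measurable_τ x, Measure.ext fun S hS => by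
    rw [Measure.map_apply (M.measurable_τ x) hS, M.stationary S hS x]⟩

lemma measurable_comp_τ {β : Type*} [MeasurableSpace β] {f : Ω → β} (hf : Measurable f) :
    Measurable fun p : Ω × Euc d => f (M.τ p.2 p.1) :=
  hf.comp M.τ_measurable

lemma measurable_orbit {β : Type*} [MeasurableSpace β] {f : Ω → β} (hf : Measurable f) (ω : Ω) :
    Measurable fun x : Euc d => f (M.τ x ω) :=
  (M.measurable_comp_τ hf).comp measurable_prodMk_left

variable [IsProbabilityMeasure P]

/-- Tonelli, after which stationarity gives every `y` the same expectation. This identity is the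
source of all bounds along orbits. -/
lemma lintegral_lintegral_τ {Y : Type*} [MeasurableSpace Y] (ν : Measure Y) [SFinite ν]
    {z : Y → Euc d} (hz : Measurable z) {k : Y → ℝ≥0∞} (hk : Measurable k)
    {f : Ω → ℝ≥0∞} (hf : Measurable f) :
    ∫⁻ ω, ∫⁻ y, k y * f (M.τ (z y) ω) ∂ν ∂P = (∫⁻ y, k y ∂ν) * ∫⁻ ω, f ω ∂P := by
  have hm : Measurable fun p : Ω × Y => f (M.τ (z p.2) p.1) :=
    (M.measurable_comp_τ hf).comp (measurable_fst.prodMk (hz.comp measurable_snd))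
  rw [lintegral_lintegral_swap ((hk.comp measurable_snd).mul hm).aemeasurable,
    ← lintegral_mul_const _ hk]
  refine lintegral_congr fun y => ?_
  have hfy : Measurable fun ω => f (M.τ (z y) ω) := hf.comp (M.measurable_τ _)
  rw [lintegral_const_mul _ hfy,
    (M.measurePreserving_τ _).lintegral_comp hf]

lemma lintegral_setLIntegral_τ (S : Set (Euc d)) {f : Ω → ℝ≥0∞} (hf : Measurable f) :
    ∫⁻ ω, (∫⁻ x in S, f (M.τ x ω)) ∂P = volume S * ∫⁻ ω, f ω ∂P := by
  simpa using M.lintegral_lintegral_τ (volume.restrict S) measurable_id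
    (measurable_const (a := (1 : ℝ≥0∞))) hf

/-- The previous identity applied to the indicator of a measurable null set containing the
exceptional set. -/
lemma ae_ae_τ {Y : Type*} [MeasurableSpace Y] (ν : Measure Y) [SFinite ν]
    {z : Y → Euc d} (hz : Measurable z) {p : Ω → Prop} (hp : ∀ᵐ ω ∂P, p ω) :
    ∀ᵐ ω ∂P, ∀ᵐ y ∂ν, p (M.τ (z y) ω) := by
  obtain ⟨N, hN, hNm, hN0⟩ := exists_measurable_superset_of_null (ae_iff.1 hp)
  have h1 := M.lintegral_lintegral_τ ν hz measurable_const (k := fun _ => 1)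
    (f := N.indicator 1) (measurable_one.indicator hNm)
  rw [lintegral_indicator_one hNm, hN0, mul_zero] at h1
  have hm : Measurable fun p : Ω × Y => N.indicator (1 : Ω → ℝ≥0∞) (M.τ (z p.2) p.1) :=
    (M.measurable_comp_τ (measurable_one.indicator hNm)).comp
      (measurable_fst.prodMk (hz.comp measurable_snd))
  rw [lintegral_eq_zero_iff (by
    simp only [one_mul]; exact hm.lintegral_prod_right')] at h1
  filter_upwards [h1] with ω hω
  simp only [one_mul, Pi.zero_apply] at hω
  have hmω : Measurable fun y => N.indicator (1 : Ω → ℝ≥0∞) (M.τ (z y) ω) :=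
    hm.comp measurable_prodMk_left
  rw [lintegral_eq_zero_iff hmω] at hω
  filter_upwards [hω] with y hy
  by_contra h
  have : M.τ (z y) ω ∈ N := hN h
  simp [this] at hy

lemma ae_ae_orbit {p : Ω → Prop} (hp : ∀ᵐ ω ∂P, p ω) : ∀ᵐ ω ∂P, ∀ᵐ x, p (M.τ x ω) :=
  M.ae_ae_τ volume measurable_id hp

/-- The integral of `|G(τ_x ω)|²` over a ball has expectation `|B| E|G|²`, hence is almost surely
finite, for countably many balls at once. -/
lemma ae_l2Loc {F : Type*} [NormedAddCommGroup F] [MeasurableSpace F] [BorelSpace F]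
    [SecondCountableTopology F] {G : Ω → F} (hG : Measurable G) (hG2 : MemLp G 2 P) :
    ∀ᵐ ω ∂P, L2Loc fun x => G (M.τ x ω) := by
  have h : ∀ᵐ ω ∂P, ∀ n : ℕ, ∫⁻ x in Metric.closedBall 0 n, ‖G (M.τ x ω)‖ₑ ^ 2 < ∞ := by
    refine ae_all_iff.2 fun n => ?_
    refine ae_lt_top ?_ ?_
    · exact (M.measurable_comp_τ (f := fun ω => ‖G ω‖ₑ ^ 2) (by fun_prop)).lintegral_prod_right'
    · rw [M.lintegral_setLIntegral_τ _ (f := fun ω => ‖G ω‖ₑ ^ 2) (by fun_prop), ← eLpNorm_two_sq]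
      exact ENNReal.mul_ne_top measure_closedBall_lt_top.ne (ENNReal.pow_ne_top hG2.2.ne)
  filter_upwards [h] with ω hω
  refine L2Loc.of_ball fun n => ⟨(M.measurable_orbit hG ω).aestronglyMeasurable, ?_⟩
  rw [eLpNorm_two_eq]
  exact ENNReal.rpow_lt_top_of_nonneg (by norm_num) (hω n).ne

/-- Wiener's weak type maximal inequality, by transference of the Hardy–Littlewood inequality. -/
theorem measure_lt_ballMax_le {f : Ω → ℝ≥0∞} (hf : Measurable f) {t : ℝ≥0∞} (ht : t ≠ 0)
    (ht' : t ≠ ∞) :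
    P {ω | t < ballMax fun x => f (M.τ x ω)} ≤
      (10 ^ d * volume (Metric.ball (0 : Euc d) 1)) * t⁻¹ * ∫⁻ ω, f ω ∂P := by
  set b := volume (Metric.ball (0 : Euc d) 1) with hb
  set I : ℕ → Ω → ℝ≥0∞ := fun n ω => ∫⁻ x in Metric.ball 0 (n + 1), f (M.τ x ω) with hI
  have hIm : ∀ n, Measurable (I n) := fun n => (M.measurable_comp_τ hf).lintegral_prod_right'
  -- The level set truncated to radii at most `N`; a bound uniform in `N` suffices by monotone
  -- convergence.
  set E : ℕ → Set Ω := fun N => ⋃ n, ⋃ (_ : n < N), {ω | t * ((n : ℝ≥0∞) + 1) ^ d < I n ω} with hE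
  have hEm : ∀ N, MeasurableSet (E N) := fun N =>
    MeasurableSet.iUnion fun n => MeasurableSet.iUnion fun _ =>
      measurableSet_lt measurable_const (hIm n)
  have hmono : Monotone E := fun N N' hN => Set.iUnion_mono fun n =>
    Set.iUnion_mono' fun hn => ⟨hn.trans_le hN, le_rfl⟩
  have hsub : {ω | t < ballMax fun x => f (M.τ x ω)} ⊆ ⋃ N, E N := by
    intro ω hω
    obtain ⟨n, hn⟩ := lt_iSup_iff.1 (show t < ballMax fun x => f (M.τ x ω) from hω)
    refine Set.mem_iUnion.2 ⟨n + 1, Set.mem_iUnion₂.2 ⟨n, Nat.lt_succ_self n, ?_⟩⟩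
    rw [mul_comm, ← div_eq_mul_inv, ENNReal.lt_div_iff_mul_lt (Or.inl (by positivity))
      (Or.inl (by finiteness))] at hn
    exact hn
  have horb : ∀ n x ω, I n (M.τ x ω) = ∫⁻ y in Metric.ball x (n + 1), f (M.τ y ω) := by
    intro n x ω
    have hmp := measurePreserving_add_right (volume : Measure (Euc d)) x
    rw [← hmp.setLIntegral_comp_preimage Metric.isOpen_ball.measurableSet (M.measurable_orbit hf ω)]
    simp only [hI, M.τ_add]
    congr 2
    ext y
    simp [dist_eq_norm]
  have hEN : ∀ N, 0 < N → P (E N) ≤ (10 ^ d * b) * t⁻¹ * ∫⁻ ω, f ω ∂P := by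
    intro N hN
    have hNr : (0 : ℝ) < N := by exact_mod_cast hN
    have h1 := M.lintegral_setLIntegral_τ (Metric.ball 0 N)
      (f := (E N).indicator 1) (measurable_one.indicator (hEm N))
    rw [lintegral_indicator_one (hEm N)] at h1
    have h2 : ∀ ω, ∫⁻ x in Metric.ball 0 N, (E N).indicator 1 (M.τ x ω) ≤
        (5 ^ d * b) * t⁻¹ * ∫⁻ y in Metric.ball 0 (2 * N), f (M.τ y ω) := by
      intro ω
      have hms : MeasurableSet {x | M.τ x ω ∈ E N} := (M.measurable_orbit measurable_id ω) (hEm N)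
      have : ∫⁻ x in Metric.ball 0 N, (E N).indicator 1 (M.τ x ω) =
          volume ({x | M.τ x ω ∈ E N} ∩ Metric.ball 0 N) := by
        rw [← Measure.restrict_apply hms, ← lintegral_indicator_one hms]
        rfl
      rw [this]
      refine volume_le_of_forall_exists_lt_setLIntegral_ball ht ht' Set.inter_subset_right ?_
      rintro x ⟨hx, -⟩
      obtain ⟨n, hn, hx⟩ := Set.mem_iUnion₂.1 hx
      exact ⟨n, hn, by rw [← horb]; exact hx⟩
    -- The left side is the expected volume of the `x` in the ball of radius `N` with `τ_x ω ∈ E N`.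
    -- The covering estimate on each orbit brings in the ball of radius `2 * N`, so `5^d` becomes
    -- `10^d` and the volume of the ball cancels.
    have h3 : volume (Metric.ball (0 : Euc d) N) * P (E N) ≤
        volume (Metric.ball (0 : Euc d) N) * ((10 ^ d * b) * t⁻¹ * ∫⁻ ω, f ω ∂P) := by
      rw [← h1]
      refine (lintegral_mono h2).trans_eq ?_
      rw [lintegral_const_mul _ (M.measurable_comp_τ hf).lintegral_prod_right',
        M.lintegral_setLIntegral_τ _ hf, volume_ball_eq _ (by positivity),
        volume_ball_eq _ hNr, ENNReal.ofReal_mul zero_le_two, mul_pow, ENNReal.ofReal_ofNat,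
        show (10 : ℝ≥0∞) = 5 * 2 by norm_num, mul_pow]
      ring
    exact (ENNReal.mul_le_mul_iff_right (Metric.measure_ball_pos _ _ hNr).ne'
      measure_ball_lt_top.ne).1 h3
  calc P {ω | t < ballMax fun x => f (M.τ x ω)} ≤ P (⋃ N, E N) := measure_mono hsub
    _ = ⨆ N, P (E N) := hmono.measure_iUnion
    _ ≤ _ := iSup_le fun N =>
      (measure_mono (hmono (Nat.le_succ N))).trans (hEN (N + 1) (Nat.succ_pos N))

end Basic

end Medium
end
noncomputable section

set_option linter.unusedSectionVars false

/-! ### The mean ergodic theorem -/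

namespace Medium

variable {d : ℕ} {Ω : Type*} [MeasurableSpace Ω] {P : Measure Ω} [IsProbabilityMeasure P]
  (M : Medium d P)

/-- Ergodicity of the medium is assumed for strictly invariant sets only. The set `S` of `ω` with
`τ_x ω ∈ E` for almost every `x` is strictly invariant, since Lebesgue measure is translation
invariant, and it agrees with `E` up to a null set by Fubini. -/
lemma measure_eq_zero_or_one_of_invariant {E : Set Ω} (hE : MeasurableSet E)
    (h : ∀ x, ∀ᵐ ω ∂P, M.τ x ω ∈ E ↔ ω ∈ E) : P E = 0 ∨ P E = 1 := by
  set S : Set Ω := {ω | ∀ᵐ x : Euc d, M.τ x ω ∈ E} with hS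
  have hm : MeasurableSet {p : Ω × Euc d | M.τ p.2 p.1 ∉ E} := M.τ_measurable hE.compl
  have hSm : MeasurableSet S := (measurable_measure_prodMk_left hm) (measurableSet_singleton 0)
  have hSinv : ∀ y, M.τ y ⁻¹' S = S := by
    intro y
    ext ω
    simp only [hS, Set.mem_preimage, Set.mem_ofPred_eq, ← M.τ_add]
    have hmp := measurePreserving_add_right (volume : Measure (Euc d)) y
    constructor
    · intro h
      have := (measurePreserving_add_right (volume : Measure (Euc d)) (-y)).quasiMeasurePreserving.ae h
      simpa using this
    · intro h
      exact hmp.quasiMeasurePreserving.ae h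
  have hSE : S =ᵐ[P] E := by
    have h1 : ∀ᵐ ω ∂P, ∀ᵐ x : Euc d, M.τ x ω ∈ E ↔ ω ∈ E := by
      have hmeas : MeasurableSet {p : Ω × Euc d | M.τ p.2 p.1 ∈ E ↔ p.1 ∈ E} := by
        have e1 : MeasurableSet {p : Ω × Euc d | M.τ p.2 p.1 ∈ E} := M.τ_measurable hE
        have e2 : MeasurableSet {p : Ω × Euc d | p.1 ∈ E} := measurable_fst hE
        exact e1.iff e2
      refine (Measure.ae_ae_comm hmeas).2 (ae_of_all _ h)
    filter_upwards [h1] with ω hω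
    refine propext ?_
    change (∀ᵐ x : Euc d, M.τ x ω ∈ E) ↔ ω ∈ E
    constructor
    · intro hx
      obtain ⟨x, hx1, hx2⟩ := (hω.and hx).exists
      exact hx1.1 hx2
    · intro hx
      filter_upwards [hω] with x hx1 using hx1.2 hx
  rw [← measure_congr hSE]
  exact M.ergodic S hSm hSinv

lemma ae_eq_const_of_invariant {F : Type*} [TopologicalSpace F] [SecondCountableTopology F]
    [T1Space F] [MeasurableSpace F] [OpensMeasurableSpace F] [Nonempty F] {g : Ω → F}
    (hg : Measurable g) (h : ∀ x, (fun ω => g (M.τ x ω)) =ᵐ[P] g) :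
    ∃ c, g =ᵐ[P] fun _ => c := by
  refine exists_eventuallyEq_const_of_forall_separating MeasurableSet fun U hU => ?_
  rcases M.measure_eq_zero_or_one_of_invariant (hg hU) fun x => by
    filter_upwards [h x] with ω hω
    simp [Set.mem_preimage, hω] with h0 | h1
  · right
    exact measure_eq_zero_iff_ae_notMem.1 h0
  · left
    exact (mem_ae_iff_prob_eq_one (hg hU)).2 h1

variable {F : Type*} [NormedAddCommGroup F] [InnerProductSpace ℝ F]

lemma integral_comp_τ {f : Ω → F} (hf : AEStronglyMeasurable f P) (x : Euc d) :
    ∫ ω, f (M.τ x ω) ∂P = ∫ ω, f ω ∂P := by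
  have hmp := M.measurePreserving_τ x
  rw [← hmp.map_eq] at hf
  have := integral_map hmp.measurable.aemeasurable hf
  rw [hmp.map_eq] at this
  exact this.symm

lemma inner_Lp_const [CompleteSpace F] (e : F) (y : Lp F 2 P) :
    inner ℝ (Lp.const 2 P e) y = inner ℝ e (∫ ω, y ω ∂P) := by
  rw [L2.inner_def, ← integral_inner ((Lp.memLp y).integrable one_le_two)]
  refine integral_congr_ae ?_
  filter_upwards [Lp.coeFn_const (p := 2) (μ := P) e] with ω h1
  rw [h1]; rfl

/-- The Koopman operator of the shift `τ_x` on `L²(Ω)`. -/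
def koopman (x : Euc d) : Lp F 2 P →ₗᵢ[ℝ] Lp F 2 P :=
  Lp.compMeasurePreservingₗᵢ ℝ (M.τ x) (M.measurePreserving_τ x)

lemma coeFn_koopman (x : Euc d) (f : Lp F 2 P) :
    M.koopman x f =ᵐ[P] fun ω => f (M.τ x ω) :=
  Lp.coeFn_compMeasurePreserving f (M.measurePreserving_τ x)

lemma koopman_toLp (x : Euc d) {f : Ω → F} (hf : MemLp f 2 P) :
    M.koopman x (hf.toLp f) =
      (hf.comp_measurePreserving (M.measurePreserving_τ x)).toLp _ :=
  Lp.toLp_compMeasurePreserving hf (M.measurePreserving_τ x)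

lemma koopman_koopman (x y : Euc d) (f : Lp F 2 P) :
    M.koopman x (M.koopman y f) = M.koopman (y + x) f := by
  refine Lp.ext ?_
  have h1 := M.coeFn_koopman x (M.koopman y f)
  have h2 := (M.measurePreserving_τ x).quasiMeasurePreserving.ae (M.coeFn_koopman y f)
  filter_upwards [h1, h2, M.coeFn_koopman (y + x) f] with ω e1 e2 e3
  rw [e1, e2, e3, M.τ_add]

variable [CompleteSpace F] [SecondCountableTopology F] [MeasurableSpace F] [BorelSpace F]

lemma eq_zero_of_koopman_invariant {g : Lp F 2 P} (hg : ∀ x, M.koopman x g = g)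
    (h0 : ∫ ω, g ω ∂P = 0) : g = 0 := by
  have hm : Measurable (g : Ω → F) := (Lp.stronglyMeasurable g).measurable
  obtain ⟨c, hc⟩ := M.ae_eq_const_of_invariant hm fun x => by
    have := M.coeFn_koopman x g
    rw [hg x] at this
    exact this.symm
  rw [integral_congr_ae hc] at h0
  have hc0 : c = 0 := by simpa using h0
  refine Lp.ext ?_
  filter_upwards [hc, Lp.coeFn_zero F 2 P] with ω h1 h2
  rw [h1, h2, hc0]; rfl

/-- The element `g` of least norm in the closed convex hull of the orbit is invariant, hence
constant by ergodicity. The mean is zero on the whole hull, so `g = 0`. -/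
lemma zero_mem_closure_convexHull_koopman (f : Lp F 2 P) (h0 : ∫ ω, f ω ∂P = 0) :
    (0 : Lp F 2 P) ∈ closure (convexHull ℝ (Set.range fun x => M.koopman x f)) := by
  set O : Set (Lp F 2 P) := Set.range fun x => M.koopman x f with hO
  set K := closure (convexHull ℝ O) with hK
  have hKc : Convex ℝ K := (convex_convexHull ℝ O).closure
  have hne : K.Nonempty := ⟨_, subset_closure (subset_convexHull ℝ O ⟨0, rfl⟩)⟩
  obtain ⟨g, hgK, hg⟩ := exists_norm_eq_iInf_of_complete_convex hne isClosed_closure.isComplete hKc 0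
  have hmin := (norm_eq_iInf_iff_real_inner_le_zero hKc hgK).1 hg
  have hinv : ∀ x, M.koopman x g = g := by
    intro x
    have hmem : M.koopman x g ∈ K := by
      have h1 : Set.MapsTo (M.koopman x (F := F)) (convexHull ℝ O) (convexHull ℝ O) := by
        intro y hy
        have h2 : (M.koopman x (F := F)).toLinearMap '' convexHull ℝ O ⊆ convexHull ℝ O := by
          rw [LinearMap.image_convexHull]
          refine convexHull_mono ?_
          rintro _ ⟨_, ⟨y, rfl⟩, rfl⟩
          exact ⟨y + x, (M.koopman_koopman x y f).symm⟩
        exact h2 ⟨y, hy, rfl⟩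
      exact h1.closure (M.koopman x (F := F)).continuous hgK
    have h3 := hmin _ hmem
    rw [zero_sub, inner_neg_left, inner_sub_right, neg_nonpos, sub_nonneg] at h3
    -- Minimality gives `⟨g, U g⟩ ≥ ‖g‖²`; as `U` is an isometry, expanding the square forces `U g =
    -- g`.
    have h4 : ‖M.koopman x g - g‖ ^ 2 ≤ 0 := by
      rw [norm_sub_sq_real, (M.koopman x).norm_map, real_inner_comm]
      rw [real_inner_self_eq_norm_sq] at h3
      linarith
    exact sub_eq_zero.1 (norm_eq_zero.1 (pow_eq_zero_iff two_ne_zero |>.1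
      (le_antisymm h4 (sq_nonneg _))))
  have hmean : ∀ y ∈ K, ∀ e : F, inner ℝ (Lp.const 2 P e) y = 0 := by
    intro y hy e
    have hcl : IsClosed {y : Lp F 2 P | inner ℝ (Lp.const 2 P e) y = 0} :=
      isClosed_eq (by fun_prop) continuous_const
    have hconv : Convex ℝ {y : Lp F 2 P | inner ℝ (Lp.const 2 P e) y = 0} := by
      intro a ha b hb s t _ _ _
      simp only [Set.mem_ofPred_eq] at ha hb ⊢
      rw [inner_add_right, inner_smul_right, inner_smul_right, ha, hb]; simp
    refine closure_minimal (convexHull_min ?_ hconv) hcl hy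
    rintro _ ⟨x, rfl⟩
    rw [Set.mem_ofPred_eq, inner_Lp_const, integral_congr_ae (M.coeFn_koopman x f),
      M.integral_comp_τ (Lp.aestronglyMeasurable f), h0, inner_zero_right]
  have hg0 : ∫ ω, g ω ∂P = 0 := by
    have := hmean g hgK (∫ ω, g ω ∂P)
    rwa [inner_Lp_const, inner_self_eq_zero] at this
  have := M.eq_zero_of_koopman_invariant hinv hg0
  rwa [this] at hgK

/-- Some finite convex combination of the translates of a centred function is small in `L²`. -/
theorem exists_convex_combination_small {f : Ω → F} (hf2 : MemLp f 2 P)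
    (h0 : ∫ ω, f ω ∂P = 0) {η : ℝ≥0∞} (hη : 0 < η) :
    ∃ (ι : Type) (s : Finset ι) (c : ι → ℝ) (a : ι → Euc d), (∀ i ∈ s, 0 ≤ c i) ∧
      ∑ i ∈ s, c i = 1 ∧ ∫⁻ ω, ‖∑ i ∈ s, c i • f (M.τ (a i) ω)‖ₑ ^ 2 ∂P < η := by
  have h1 := M.zero_mem_closure_convexHull_koopman (hf2.toLp f)
    (by rwa [integral_congr_ae hf2.coeFn_toLp])
  obtain ⟨ρ, hρ0, hρ⟩ : ∃ ρ : ℝ≥0∞, 0 < ρ ∧ ρ ^ 2 ≤ η := by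
    refine ⟨η ^ (1 / 2 : ℝ), by positivity, ?_⟩
    rw [← ENNReal.rpow_natCast, ← ENNReal.rpow_mul]
    norm_num
  obtain ⟨y, hy, hyρ⟩ := EMetric.mem_closure_iff.1 h1 ρ hρ0
  rw [convexHull_eq] at hy
  obtain ⟨ι, s, c, z, hc, hc1, hz, rfl⟩ := hy
  choose! a ha using hz
  refine ⟨ι, s, c, a, hc, hc1, ?_⟩
  rw [Finset.centerMass_eq_of_sum_1 _ _ hc1, edist_comm, edist_zero_right, Lp.enorm_def] at hyρ
  have h2 : ∀ i ∈ s, ∀ᵐ ω ∂P, z i ω = f (M.τ (a i) ω) := by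
    intro i hi
    have e1 := M.coeFn_koopman (a i) (hf2.toLp f)
    have e2 := (M.measurePreserving_τ (a i)).quasiMeasurePreserving.ae hf2.coeFn_toLp
    rw [show M.koopman (a i) (hf2.toLp f) = z i from ha i hi] at e1
    filter_upwards [e1, e2] with ω h3 h4
    rw [h3, h4]
  have h3 : (∑ i ∈ s, c i • z i : Lp F 2 P) =ᵐ[P] fun ω => ∑ i ∈ s, c i • f (M.τ (a i) ω) := by
    have e1 : ∀ᵐ ω ∂P, ∀ i ∈ s, (c i • z i : Lp F 2 P) ω = c i • f (M.τ (a i) ω) := by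
      refine (ae_ball_iff s.countable_toSet).2 fun i hi => ?_
      filter_upwards [h2 i hi, Lp.coeFn_smul (c i) (z i)] with ω h4 h5
      rw [h5, Pi.smul_apply, h4]
    filter_upwards [e1, Lp.coeFn_finsetSum s fun i => c i • z i] with ω h4 h5
    rw [h5, Finset.sum_apply]
    exact Finset.sum_congr rfl fun i hi => h4 i hi
  rw [← eLpNorm_two_sq, ← eLpNorm_congr_ae h3]
  exact (ENNReal.pow_lt_pow_left_iff two_ne_zero |>.2 hyρ).trans_le hρ

end Medium
end
noncomputable section
set_option linter.unusedSectionVars false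

/-! ### Tails of the sublinearity and averaging quantities -/

namespace Medium

variable {d : ℕ} {Ω : Type*} [MeasurableSpace Ω] {P : Measure Ω} [IsProbabilityMeasure P]
  (M : Medium d P)

lemma transAvg_orbit {ι F : Type*} [AddCommMonoid F] [SMul ℝ F] (s : Finset ι) (c : ι → ℝ)
    (a : ι → Euc d) (f : Ω → F) (x : Euc d) (ω : Ω) :
    transAvg s c a (fun y => f (M.τ y ω)) x = ∑ i ∈ s, c i • f (M.τ (a i) (M.τ x ω)) := by
  simp_rw [transAvg, ← M.τ_add, add_comm]

variable {F : Type*} [NormedAddCommGroup F] [InnerProductSpace ℝ F] [CompleteSpace F]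
  [SecondCountableTopology F] [MeasurableSpace F] [BorelSpace F]

/-- The common mechanism for `Sub` and `Osc`. The radius is chosen before `X`, from `f` and the
constants alone; this is what later makes the scale independent of the choice of correctors. The
event need not be measurable, as only monotonicity and subadditivity of `P` are used on it. -/
theorem exists_tail_bound {f : Ω → F} (hf : Measurable f) (hf2 : MemLp f 2 P)
    (h0 : ∫ ω, f ω ∂P = 0) {C ν ε : ℝ≥0∞} (hC : C ≠ ∞) (hν : ν ≠ 0) (hν' : ν ≠ ∞) (hε : ε ≠ 0) :
    ∃ r₀ : ℝ, 0 < r₀ ∧ ∀ X : ℝ → Ω → ℝ≥0∞,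
      (∀ (ι : Type) (s : Finset ι) (c : ι → ℝ) (a : ι → Euc d) (K : ℝ), (∀ i ∈ s, 0 ≤ c i) →
        ∑ i ∈ s, c i = 1 → (∀ i ∈ s, ‖a i‖ ≤ K) → ∀ᵐ ω ∂P, ∀ R, 1 ≤ R → K ≤ R →
          X R ω ≤ C * (ENNReal.ofReal (K / R) ^ 2 * ballMax (fun x => ‖f (M.τ x ω)‖ₑ ^ 2) +
            ballMax (fun x => ‖transAvg s c a (fun y => f (M.τ y ω)) x‖ₑ ^ 2))) →
      ∀ r, r₀ ≤ r → P {ω | ∃ R, r ≤ R ∧ ν < X R ω} ≤ ε := by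
  set W : ℝ≥0∞ := 10 ^ d * volume (Metric.ball (0 : Euc d) 1) with hW
  have hWt : W ≠ ∞ := ENNReal.mul_ne_top (by finiteness) measure_ball_lt_top.ne
  have hfE : ∫⁻ ω, ‖f ω‖ₑ ^ 2 ∂P ≠ ∞ := by
    rw [← eLpNorm_two_sq]; exact ENNReal.pow_ne_top hf2.2.ne
  -- If both summands are at most `t`, then `C * (t + t) ≤ ν`; the `+ 1` avoids division by zero
  -- when `C = 0`.
  set t : ℝ≥0∞ := ν / (2 * (C + 1)) with ht
  have hC2 : 2 * (C + 1) ≠ ∞ := by finiteness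
  have hC2' : 2 * (C + 1) ≠ 0 := by positivity
  have ht0 : t ≠ 0 := (ENNReal.div_pos hν hC2).ne'
  have htt : t ≠ ∞ := ENNReal.div_ne_top hν' hC2'
  have htC : C * (t + t) ≤ ν := by
    calc C * (t + t) ≤ (C + 1) * (t + t) := by gcongr; exact le_self_add
      _ = t * (2 * (C + 1)) := by ring
      _ = ν := ENNReal.div_mul_cancel hC2' hC2
  have hε2 : ε / 2 ≠ 0 := by simpa using hε
  -- `η` is the `L²` smallness which makes the maximal inequality at level `t` give at most `ε / 2`
  -- for the averaged field.
  obtain ⟨η, hη0, hη⟩ := ENNReal.exists_nnreal_pos_mul_lt (a := W * t⁻¹)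
    (ENNReal.mul_ne_top hWt (ENNReal.inv_ne_top.2 ht0)) hε2
  obtain ⟨ι, s, c, a, hc, hc1, hsmall⟩ :=
    M.exists_convex_combination_small hf2 h0 (η := η) (by exact_mod_cast hη0)
  -- `ρ` is a bound for `(K / R)²` under which the unaveraged field need only stay below `t / ρ`, a
  -- level high enough to be exceeded with probability at most `ε / 2`.
  obtain ⟨ρ, hρ0, hρ⟩ := ENNReal.exists_nnreal_pos_mul_lt
    (a := W * t⁻¹ * ∫⁻ ω, ‖f ω‖ₑ ^ 2 ∂P)
    (ENNReal.mul_ne_top (ENNReal.mul_ne_top hWt (ENNReal.inv_ne_top.2 ht0)) hfE) hε2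
  set K : ℝ := ∑ i ∈ s, ‖a i‖ with hK
  have hK0 : 0 ≤ K := Finset.sum_nonneg fun i _ => norm_nonneg _
  have haK : ∀ i ∈ s, ‖a i‖ ≤ K := fun i hi =>
    Finset.single_le_sum (f := fun i => ‖a i‖) (fun i _ => norm_nonneg _) hi
  refine ⟨max 1 (max K (K / ρ)), by positivity, fun X hX r hr => ?_⟩
  have hr1 : 1 ≤ r := (le_max_left _ _).trans hr
  have hrK : K ≤ r := ((le_max_left _ _).trans (le_max_right _ _)).trans hr
  have hrρ : K / ρ ≤ r := ((le_max_right _ _).trans (le_max_right _ _)).trans hr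
  set N := {ω | ¬ ∀ R, 1 ≤ R → K ≤ R →
          X R ω ≤ C * (ENNReal.ofReal (K / R) ^ 2 * ballMax (fun x => ‖f (M.τ x ω)‖ₑ ^ 2) +
            ballMax (fun x => ‖transAvg s c a (fun y => f (M.τ y ω)) x‖ₑ ^ 2))} with hN
  have hN0 : P N = 0 := ae_iff.1 (hX ι s c a K hc hc1 haK)
  have hρE : (ρ : ℝ≥0∞) ≠ 0 := by exact_mod_cast hρ0.ne'
  set E1 := {ω | t / ρ < ballMax fun x => ‖f (M.τ x ω)‖ₑ ^ 2} with hE1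
  set E2 := {ω | t < ballMax fun x => ‖∑ i ∈ s, c i • f (M.τ (a i) (M.τ x ω))‖ₑ ^ 2} with hE2
  have hsub : {ω | ∃ R, r ≤ R ∧ ν < X R ω} ⊆ N ∪ (E1 ∪ E2) := by
    rintro ω ⟨R, hR, hνX⟩
    by_contra h
    simp only [Set.mem_union, not_or, hN, hE1, hE2, Set.mem_ofPred_eq, not_not, not_lt] at h
    obtain ⟨h1, h2, h3⟩ := h
    have h4 := h1 R (hr1.trans hR) (hrK.trans hR)
    -- Since `R ≥ K` and `R ≥ K / ρ`, one has `(K / R)² ≤ K / R ≤ ρ`.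
    have h5 : ENNReal.ofReal (K / R) ^ 2 ≤ ρ := by
      have hR0 : 0 < R := by linarith
      have hρR : (0 : ℝ) < ρ := hρ0
      have e1 : K / R ≤ 1 := (div_le_one hR0).2 (hrK.trans hR)
      have e2 : K / R ≤ ρ := by
        rw [div_le_iff₀ hR0]
        have := (div_le_iff₀ hρR).1 (hrρ.trans hR)
        linarith
      have e3 : 0 ≤ K / R := by positivity
      rw [← ENNReal.ofReal_pow e3, ← ENNReal.ofReal_coe_nnreal]
      exact ENNReal.ofReal_le_ofReal (by nlinarith)
    refine absurd hνX (not_lt.2 (h4.trans (le_trans ?_ htC)))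
    simp_rw [M.transAvg_orbit]
    refine mul_le_mul' le_rfl (add_le_add ?_ h3)
    calc _ ≤ (ρ : ℝ≥0∞) * (t / ρ) := mul_le_mul' h5 h2
      _ = t := ENNReal.mul_div_cancel hρE ENNReal.coe_ne_top
  have b1 : P E1 ≤ ε / 2 := by
    refine (M.measure_lt_ballMax_le (f := fun ω => ‖f ω‖ₑ ^ 2) (by fun_prop)
      (ENNReal.div_pos ht0 ENNReal.coe_ne_top).ne' (ENNReal.div_ne_top htt hρE)).trans ?_
    refine le_trans (le_of_eq ?_) hρ.le
    rw [ENNReal.inv_div (Or.inl ENNReal.coe_ne_top) (Or.inl hρE), div_eq_mul_inv]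
    ring
  have b2 : P E2 ≤ ε / 2 := by
    have hfm : Measurable fun ω => ‖∑ i ∈ s, c i • f (M.τ (a i) ω)‖ₑ ^ 2 := by
      have : ∀ i, Measurable fun ω => f (M.τ (a i) ω) := fun i => hf.comp (M.measurable_τ _)
      exact (Finset.measurable_fun_sum s fun i _ => (this i).const_smul (c i)).enorm.pow_const 2
    refine (M.measure_lt_ballMax_le hfm ht0 htt).trans ?_
    refine le_trans ?_ hη.le
    rw [mul_comm (η : ℝ≥0∞)]
    exact mul_le_mul' le_rfl hsmall.le
  calc P {ω | ∃ R, r ≤ R ∧ ν < X R ω} ≤ P N + (P E1 + P E2) :=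
        (measure_mono hsub).trans ((measure_union_le _ _).trans
          (add_le_add le_rfl (measure_union_le _ _)))
    _ ≤ 0 + (ε / 2 + ε / 2) := by gcongr; exact hN0.le
    _ = ε := by rw [zero_add, ENNReal.add_halves]

lemma inv_sq_mul_ofReal_sq {R K : ℝ} (hR : 0 < R) :
    (ENNReal.ofReal R)⁻¹ ^ 2 * ENNReal.ofReal K ^ 2 = ENNReal.ofReal (K / R) ^ 2 := by
  rw [← mul_pow, ENNReal.ofReal_div_of_pos hR, div_eq_mul_inv, mul_comm]

lemma inv_mul_ofReal_self {R : ℝ} (hR : 0 < R) :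
    (ENNReal.ofReal R)⁻¹ * ENNReal.ofReal R = 1 :=
  ENNReal.inv_mul_cancel (by simpa using hR) ENNReal.ofReal_ne_top

/-- The normalized oscillation `R⁻² ⨍_{Q_R} |u - ⨍ u|²`. -/
def excess (u : Euc d → ℝ) (R : ℝ) : ℝ≥0∞ :=
  (ENNReal.ofReal R)⁻¹ ^ 2 *
    ⨍⁻ x, ‖u x - ⨍ z in cube 0 R, u z‖ₑ ^ 2 ∂(volume.restrict (cube 0 R))

theorem exists_excess_tail_bound (hd : 1 ≤ d) {G : Ω → Euc d} (hG : Measurable G)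
    (hG2 : MemLp G 2 P) (h0 : ∫ ω, G ω ∂P = 0) {ν ε : ℝ≥0∞} (hν : ν ≠ 0) (hν' : ν ≠ ∞)
    (hε : ε ≠ 0) :
    ∃ r₀ : ℝ, 0 < r₀ ∧ ∀ u : Ω → Euc d → ℝ, M.HasStationaryGradient u G →
      ∀ r, r₀ ≤ r → P {ω | ∃ R, r ≤ R ∧ ν < excess (u ω) R} ≤ ε := by
  obtain ⟨r₀, hr₀, h⟩ := M.exists_tail_bound hG hG2 h0 (sublinConst_ne_top d) hν hν' hε
  refine ⟨r₀, hr₀, fun u hu => h (fun R ω => excess (u ω) R) ?_⟩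
  intro ι s c a K hc hc1 ha
  filter_upwards [hu.weak_grad] with ω hω R hR hKR
  have hR0 : 0 < R := by linarith
  have h1 := hω.setLaverage_sub_average_sq_le_ballMax hd
    (hu.measurable_field.comp measurable_prodMk_left) (M.measurable_orbit hG ω) hc hc1 ha hR hKR
  refine (mul_le_mul' (le_refl ((ENNReal.ofReal R)⁻¹ ^ 2)) h1).trans_eq ?_
  rw [mul_left_comm, mul_add, ← mul_assoc _ (ENNReal.ofReal K ^ 2), inv_sq_mul_ofReal_sq hR0,
    ← mul_assoc _ (ENNReal.ofReal R ^ 2), ← mul_pow, inv_mul_ofReal_self hR0, one_pow, one_mul]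

theorem exists_osc_tail_bound (hd : 1 ≤ d) {ν ε : ℝ≥0∞} (hν : ν ≠ 0) (hν' : ν ≠ ∞) (hε : ε ≠ 0) :
    ∃ r₀ : ℝ, 0 < r₀ ∧ ∀ r, r₀ ≤ r → P {ω | ν < M.Osc 0 r ω} ≤ ε := by
  set f : Ω → ℝ := fun ω => M.Θ ω - M.θbar with hf
  have hfm : Measurable f := M.Θ_measurable.sub_const _
  have hΘ : MemLp M.Θ 2 P := by
    refine MemLp.of_bound M.Θ_measurable.aestronglyMeasurable M.θHi ?_
    filter_upwards [M.Θ_bounds] with ω hω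
    rw [Real.norm_of_nonneg (M.θLo_pos.le.trans hω.1)]
    exact hω.2
  have hf2 : MemLp f 2 P := hΘ.sub (memLp_const _)
  have h0 : ∫ ω, f ω ∂P = 0 := by
    rw [hf, integral_sub (hΘ.integrable one_le_two) (integrable_const _)]
    simp [θbar]
  -- The tail bound is applied to the square of `R⁻¹ ‖·‖_{H⁻¹}`: hence the threshold `ν ^ 2`, and
  -- the factor `2` from `(x + y)² ≤ 2 (x² + y²)`.
  have hC : 2 * averagingConst d ^ 2 ≠ ∞ := by
    have := averagingConst_ne_top d
    finiteness
  obtain ⟨r₀, hr₀, h⟩ := M.exists_tail_bound hfm hf2 h0 hC (ν := ν ^ 2) (by positivity)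
    (by finiteness) hε
  refine ⟨r₀, hr₀, fun r hr => ?_⟩
  have h1 := h (fun R ω => ((ENNReal.ofReal R)⁻¹ *
    hMinusOneNorm (cube 0 R) (fun y => f (M.τ y ω))) ^ 2) ?_ r hr
  · refine (measure_mono ?_).trans h1
    intro ω hω
    obtain ⟨R, hR⟩ := lt_iSup_iff.1 (show ν < M.Osc 0 r ω from hω)
    obtain ⟨hrR, hR⟩ := lt_iSup_iff.1 hR
    exact ⟨R, hrR, (ENNReal.pow_lt_pow_left_iff two_ne_zero).2 hR⟩
  · intro ι s c a K hc hc1 ha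
    filter_upwards [M.ae_l2Loc hfm hf2] with ω hω R hR hKR
    have hR0 : 0 < R := by linarith
    have h2 := hMinusOneNorm_le_ballMax hd (M.measurable_orbit hfm ω) hω hc hc1 ha hR hKR
    set B1 := ballMax fun x => ‖f (M.τ x ω)‖ₑ ^ 2
    set B2 := ballMax fun x => ‖transAvg s c a (fun y => f (M.τ y ω)) x‖ₑ ^ 2
    have hsq : ∀ b : ℝ≥0∞, (b ^ (1 / 2 : ℝ)) ^ 2 = b := fun b => by
      rw [← ENNReal.rpow_natCast, ← ENNReal.rpow_mul]; norm_num
    have hadd : ∀ x y : ℝ≥0∞, (x + y) ^ 2 ≤ 2 * (x ^ 2 + y ^ 2) := fun x y => by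
      have := ENNReal.rpow_add_le_mul_rpow_add_rpow x y (p := 2) one_le_two
      norm_num at this
      exact this
    calc ((ENNReal.ofReal R)⁻¹ * hMinusOneNorm (cube 0 R) (fun y => f (M.τ y ω))) ^ 2
        ≤ ((ENNReal.ofReal R)⁻¹ * (averagingConst d * (ENNReal.ofReal K * B1 ^ (1 / 2 : ℝ) +
            ENNReal.ofReal R * B2 ^ (1 / 2 : ℝ)))) ^ 2 := by gcongr
      _ = ((ENNReal.ofReal R)⁻¹ ^ 2 * averagingConst d ^ 2) * (ENNReal.ofReal K * B1 ^ (1 / 2 : ℝ) +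
            ENNReal.ofReal R * B2 ^ (1 / 2 : ℝ)) ^ 2 := by ring
      _ ≤ ((ENNReal.ofReal R)⁻¹ ^ 2 * averagingConst d ^ 2) *
          (2 * ((ENNReal.ofReal K * B1 ^ (1 / 2 : ℝ)) ^ 2 +
            (ENNReal.ofReal R * B2 ^ (1 / 2 : ℝ)) ^ 2)) := mul_le_mul' le_rfl (hadd _ _)
      _ = 2 * averagingConst d ^ 2 * (((ENNReal.ofReal R)⁻¹ ^ 2 * ENNReal.ofReal K ^ 2) * B1 +
            ((ENNReal.ofReal R)⁻¹ * ENNReal.ofReal R) ^ 2 * B2) := by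
          rw [mul_pow, mul_pow, hsq, hsq]; ring
      _ = _ := by rw [inv_sq_mul_ofReal_sq hR0, inv_mul_ofReal_self hR0, one_pow, one_mul]

/-- Pigeonhole over the `d + d ^ 3` components of `(φ, σ)`: their excesses sum to the square of the
quantity inside the supremum, so one of them exceeds its equal share of `ν ^ 2`. -/
lemma lt_subGrowth_imp (hd : 1 ≤ d) {φ : Fin d → Ω → Euc d → ℝ}
    {σ : Fin d → Fin d → Fin d → Ω → Euc d → ℝ} {ω : Ω} (hφ : ∀ i, Measurable (φ i ω))
    (hσ : ∀ i j k, Measurable (σ i j k ω)) {ν : ℝ≥0∞} {r : ℝ} (h : ν < SubGrowth φ σ 0 r ω) :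
    ∃ R, r ≤ R ∧ ((∃ i, ν ^ 2 / (d + d ^ 3 : ℕ) < excess (φ i ω) R) ∨
      ∃ i j k, ν ^ 2 / (d + d ^ 3 : ℕ) < excess (σ i j k ω) R) := by
  obtain ⟨R, hR⟩ := lt_iSup_iff.1 h
  obtain ⟨hrR, hR⟩ := lt_iSup_iff.1 hR
  refine ⟨R, hrR, ?_⟩
  by_contra! hcon
  obtain ⟨h1, h2⟩ := hcon
  have hn : ((d + d ^ 3 : ℕ) : ℝ≥0∞) ≠ 0 := by
    have : 0 < d + d ^ 3 := by positivity
    exact_mod_cast this.ne'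
  have hofReal : ∀ t : ℝ, ENNReal.ofReal (t ^ 2) = ‖t‖ₑ ^ 2 := fun t => by
    rw [← ofReal_norm, ← ENNReal.ofReal_pow (norm_nonneg _), Real.norm_eq_abs, sq_abs]
  have key : (ENNReal.ofReal R)⁻¹ ^ 2 * (⨍⁻ y, ENNReal.ofReal
      ((∑ i, (φ i ω y - ⨍ z in cube 0 R, φ i ω z) ^ 2) +
        ∑ i, ∑ j, ∑ k, (σ i j k ω y - ⨍ z in cube 0 R, σ i j k ω z) ^ 2)
      ∂(volume.restrict (cube 0 R))) =
      (∑ i, excess (φ i ω) R) + ∑ i, ∑ j, ∑ k, excess (σ i j k ω) R := by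
    have e1 : ∀ y, ENNReal.ofReal ((∑ i, (φ i ω y - ⨍ z in cube 0 R, φ i ω z) ^ 2) +
        ∑ i, ∑ j, ∑ k, (σ i j k ω y - ⨍ z in cube 0 R, σ i j k ω z) ^ 2) =
        (∑ i, ‖φ i ω y - ⨍ z in cube 0 R, φ i ω z‖ₑ ^ 2) +
        ∑ i, ∑ j, ∑ k, ‖σ i j k ω y - ⨍ z in cube 0 R, σ i j k ω z‖ₑ ^ 2 := by
      intro y
      rw [ENNReal.ofReal_add (by positivity) (by positivity),
        ENNReal.ofReal_sum_of_nonneg fun i _ => by positivity,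
        ENNReal.ofReal_sum_of_nonneg fun i _ => by positivity]
      congr 1
      · simp_rw [hofReal]
      · refine Finset.sum_congr rfl fun i _ => ?_
        rw [ENNReal.ofReal_sum_of_nonneg fun i _ => by positivity]
        refine Finset.sum_congr rfl fun j _ => ?_
        rw [ENNReal.ofReal_sum_of_nonneg fun i _ => by positivity]
        simp_rw [hofReal]
    simp_rw [e1, excess, laverage]
    rw [lintegral_add_left (by fun_prop), lintegral_finsetSum _ (by fun_prop),
      lintegral_finsetSum _ (by fun_prop), mul_add, Finset.mul_sum, Finset.mul_sum]
    congr 1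
    refine Finset.sum_congr rfl fun i _ => ?_
    rw [lintegral_finsetSum _ (by fun_prop), Finset.mul_sum]
    refine Finset.sum_congr rfl fun j _ => ?_
    rw [lintegral_finsetSum _ (by fun_prop), Finset.mul_sum]
  have hlt := (ENNReal.pow_lt_pow_left_iff two_ne_zero).2 hR
  rw [mul_pow, ← ENNReal.rpow_natCast (_ ^ (1 / 2 : ℝ)), ← ENNReal.rpow_mul] at hlt
  norm_num only [Nat.cast_ofNat, ENNReal.rpow_one] at hlt
  rw [key] at hlt
  refine absurd hlt (not_lt.2 ?_)
  calc (∑ i, excess (φ i ω) R) + ∑ i, ∑ j, ∑ k, excess (σ i j k ω) R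
      ≤ (∑ _i : Fin d, ν ^ 2 / (d + d ^ 3 : ℕ)) +
        ∑ _i : Fin d, ∑ _j : Fin d, ∑ _k : Fin d, ν ^ 2 / (d + d ^ 3 : ℕ) := by
        gcongr with i _ i _ j _ k _
        · exact h1 i
        · exact h2 i j k
    _ = ((d + d ^ 3 : ℕ) : ℝ≥0∞) * (ν ^ 2 / (d + d ^ 3 : ℕ)) := by
        simp only [Finset.sum_const, Finset.card_univ, Fintype.card_fin, nsmul_eq_mul]
        push_cast
        ring
    _ = ν ^ 2 := ENNReal.mul_div_cancel hn (ENNReal.natCast_ne_top _)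

theorem exists_subGrowth_tail_bound (hd : 1 ≤ d) {G : Fin d → Ω → Euc d}
    {H : Fin d → Fin d → Fin d → Ω → Euc d} (hG : ∀ i, Measurable (G i))
    (hG2 : ∀ i, MemLp (G i) 2 P) (hG0 : ∀ i, ∫ ω, G i ω ∂P = 0)
    (hH : ∀ i j k, Measurable (H i j k)) (hH2 : ∀ i j k, MemLp (H i j k) 2 P)
    (hH0 : ∀ i j k, ∫ ω, H i j k ω ∂P = 0)
    {ν ε : ℝ≥0∞} (hν : ν ≠ 0) (hν' : ν ≠ ∞) (hε : ε ≠ 0) :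
    ∃ r₀ : ℝ, 0 < r₀ ∧ ∀ (φ : Fin d → Ω → Euc d → ℝ) (σ : Fin d → Fin d → Fin d → Ω → Euc d → ℝ),
      (∀ i, M.HasStationaryGradient (φ i) (G i)) →
      (∀ i j k, M.HasStationaryGradient (σ i j k) (H i j k)) →
      ∀ r, r₀ ≤ r → P {ω | ν < SubGrowth φ σ 0 r ω} ≤ ε := by
  have hn : ((d + d ^ 3 : ℕ) : ℝ≥0∞) ≠ 0 := by
    have : 0 < d + d ^ 3 := by positivity
    exact_mod_cast this.ne'
  have hn' : ((d + d ^ 3 : ℕ) : ℝ≥0∞) ≠ ∞ := ENNReal.natCast_ne_top _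
  have hν2 : ν ^ 2 / (d + d ^ 3 : ℕ) ≠ 0 := (ENNReal.div_pos (by positivity) hn').ne'
  have hν2' : ν ^ 2 / (d + d ^ 3 : ℕ) ≠ ∞ := ENNReal.div_ne_top (by finiteness) hn
  have hε2 : ε / (d + d ^ 3 : ℕ) ≠ 0 := (ENNReal.div_pos hε hn').ne'
  choose r₁ hr₁ h₁ using fun i => M.exists_excess_tail_bound hd (hG i) (hG2 i) (hG0 i) hν2 hν2' hε2
  choose r₂ hr₂ h₂ using fun i j k =>
    M.exists_excess_tail_bound hd (hH i j k) (hH2 i j k) (hH0 i j k) hν2 hν2' hε2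
  have s2 : ∀ i j, 0 ≤ ∑ k, r₂ i j k := fun i j => Finset.sum_nonneg fun k _ => (hr₂ i j k).le
  have s3 : ∀ i, 0 ≤ ∑ j, ∑ k, r₂ i j k := fun i => Finset.sum_nonneg fun j _ => s2 i j
  have p1 : 0 ≤ ∑ i, r₁ i := Finset.sum_nonneg fun i _ => (hr₁ i).le
  have p2 : 0 ≤ ∑ i, ∑ j, ∑ k, r₂ i j k := Finset.sum_nonneg fun i _ => s3 i
  refine ⟨1 + ((∑ i, r₁ i) + ∑ i, ∑ j, ∑ k, r₂ i j k), ?_, fun φ σ hφ hσ r hr => ?_⟩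
  · linarith
  have hle₁ : ∀ i, r₁ i ≤ r := fun i => by
    have := Finset.single_le_sum (f := r₁) (fun i _ => (hr₁ i).le) (Finset.mem_univ i)
    linarith
  have hle₂ : ∀ i j k, r₂ i j k ≤ r := fun i j k => by
    have e1 : _ ≤ ∑ i, ∑ j, ∑ k, r₂ i j k :=
      Finset.single_le_sum (fun i _ => s3 i) (Finset.mem_univ i)
    have e2 : _ ≤ ∑ j, ∑ k, r₂ i j k :=
      Finset.single_le_sum (fun j _ => s2 i j) (Finset.mem_univ j)
    have e3 : _ ≤ ∑ k, r₂ i j k :=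
      Finset.single_le_sum (fun k _ => (hr₂ i j k).le) (Finset.mem_univ k)
    linarith
  have hsub : {ω | ν < SubGrowth φ σ 0 r ω} ⊆
      (⋃ i, {ω | ∃ R, r ≤ R ∧ ν ^ 2 / (d + d ^ 3 : ℕ) < excess (φ i ω) R}) ∪
      ⋃ i, ⋃ j, ⋃ k, {ω | ∃ R, r ≤ R ∧ ν ^ 2 / (d + d ^ 3 : ℕ) < excess (σ i j k ω) R} := by
    intro ω hω
    obtain ⟨R, hR, hex⟩ := lt_subGrowth_imp hd
      (fun i => (hφ i).measurable_field.comp measurable_prodMk_left)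
      (fun i j k => (hσ i j k).measurable_field.comp measurable_prodMk_left) hω
    rcases hex with ⟨i, hi⟩ | ⟨i, j, k, hi⟩
    · exact Or.inl (Set.mem_iUnion.2 ⟨i, R, hR, hi⟩)
    · refine Or.inr ?_
      simp only [Set.mem_iUnion]
      exact ⟨i, j, k, R, hR, hi⟩
  calc P {ω | ν < SubGrowth φ σ 0 r ω}
      ≤ (∑ i, P {ω | ∃ R, r ≤ R ∧ ν ^ 2 / (d + d ^ 3 : ℕ) < excess (φ i ω) R}) +
        ∑ i, ∑ j, ∑ k, P {ω | ∃ R, r ≤ R ∧ ν ^ 2 / (d + d ^ 3 : ℕ) < excess (σ i j k ω) R} := by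
        refine (measure_mono hsub).trans ((measure_union_le _ _).trans (add_le_add ?_ ?_))
        · exact measure_iUnion_fintype_le _ _
        · refine (measure_iUnion_fintype_le _ _).trans (Finset.sum_le_sum fun i _ => ?_)
          refine (measure_iUnion_fintype_le _ _).trans (Finset.sum_le_sum fun j _ => ?_)
          exact measure_iUnion_fintype_le _ _
    _ ≤ (∑ _i : Fin d, ε / (d + d ^ 3 : ℕ)) +
        ∑ _i : Fin d, ∑ _j : Fin d, ∑ _k : Fin d, ε / (d + d ^ 3 : ℕ) := by
        gcongr with i _ i _ j _ k _
        · exact h₁ i (φ i) (hφ i) r (hle₁ i)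
        · exact h₂ i j k (σ i j k) (hσ i j k) r (hle₂ i j k)
    _ = ((d + d ^ 3 : ℕ) : ℝ≥0∞) * (ε / (d + d ^ 3 : ℕ)) := by
        simp only [Finset.sum_const, Finset.card_univ, Fintype.card_fin, nsmul_eq_mul]
        push_cast
        ring
    _ = ε := ENNReal.mul_div_cancel hn hn'

end Medium
end
noncomputable section
set_option linter.unusedSectionVars false

/-! ### Integral operators along orbits -/

section WeightedJensen

/-- Cauchy–Schwarz with the weight split as `κ^(1/2) * κ^(1/2)`. -/
lemma lintegral_mul_sq_le {Y : Type*} [MeasurableSpace Y] (ν : Measure Y) {κ f : Y → ℝ≥0∞}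
    (hκ : AEMeasurable κ ν) (hf : AEMeasurable f ν) :
    (∫⁻ y, κ y * f y ∂ν) ^ 2 ≤ (∫⁻ y, κ y ∂ν) * ∫⁻ y, κ y * f y ^ 2 ∂ν := by
  have h1 := ENNReal.lintegral_mul_le_Lp_mul_Lq ν Real.HolderConjugate.two_two
    (f := fun y => κ y ^ (1 / 2 : ℝ)) (g := fun y => κ y ^ (1 / 2 : ℝ) * f y)
    (hκ.pow_const _) ((hκ.pow_const _).mul hf)
  have e1 : ∀ t : ℝ≥0∞, t ^ (1 / 2 : ℝ) * t ^ (1 / 2 : ℝ) = t := fun t => by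
    rw [← ENNReal.rpow_add_of_nonneg _ _ (by norm_num) (by norm_num)]; norm_num
  have e2 : ∀ t : ℝ≥0∞, (t ^ (1 / 2 : ℝ)) ^ 2 = t := fun t => by
    rw [← ENNReal.rpow_natCast, ← ENNReal.rpow_mul]; norm_num
  have h2 := pow_le_pow_left' h1 2
  simp only [Pi.mul_apply, ENNReal.rpow_ofNat, mul_pow, e2, ← mul_assoc, e1] at h2
  exact h2

end WeightedJensen

namespace Medium

variable {d : ℕ} {Ω : Type*} [MeasurableSpace Ω] {P : Measure Ω} [IsProbabilityMeasure P]
  (M : Medium d P)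

section Operators

variable {Y : Type*} [MeasurableSpace Y] (ν : Measure Y) [SFinite ν] {z : Y → Euc d}
  {F F' : Type*} [NormedAddCommGroup F] [MeasurableSpace F] [BorelSpace F]
  [SecondCountableTopology F] [NormedAddCommGroup F'] [NormedSpace ℝ F'] [MeasurableSpace F']
  [BorelSpace F'] [SecondCountableTopology F']

lemma τ_neg_τ (x : Euc d) (ω : Ω) : M.τ (-x) (M.τ x ω) = ω := by
  rw [← M.τ_add, neg_add_cancel, M.τ_zero]

/-- Young's inequality along orbits: integrating shifts against an integrable weight is bounded on
`L²(Ω)` with norm at most the mass of the weight. -/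
lemma lintegral_orbit_sq_le (hz : Measurable z) {κ : Y → ℝ≥0∞} (hκ : Measurable κ) {f : Ω → F}
    (hf : Measurable f) :
    ∫⁻ ω, (∫⁻ y, κ y * ‖f (M.τ (z y) ω)‖ₑ ∂ν) ^ 2 ∂P ≤ (∫⁻ y, κ y ∂ν) ^ 2 * ∫⁻ ω, ‖f ω‖ₑ ^ 2 ∂P := by
  have hm : ∀ ω, Measurable fun y => ‖f (M.τ (z y) ω)‖ₑ := fun ω =>
    ((M.measurable_orbit hf ω).comp hz).enorm
  have hm2 : Measurable fun p : Ω × Y => κ p.2 * ‖f (M.τ (z p.2) p.1)‖ₑ ^ 2 :=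
    (hκ.comp measurable_snd).mul ((((M.measurable_comp_τ hf).comp
      (measurable_fst.prodMk (hz.comp measurable_snd))).enorm).pow_const 2)
  calc _ ≤ ∫⁻ ω, (∫⁻ y, κ y ∂ν) * ∫⁻ y, κ y * ‖f (M.τ (z y) ω)‖ₑ ^ 2 ∂ν ∂P :=
        lintegral_mono fun ω => lintegral_mul_sq_le ν hκ.aemeasurable (hm ω).aemeasurable
    _ = _ := by
        rw [lintegral_const_mul _ hm2.lintegral_prod_right',
          M.lintegral_lintegral_τ ν hz hκ (f := fun ω => ‖f ω‖ₑ ^ 2) (by fun_prop)]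
        ring

lemma memLp_orbit_integral (hz : Measurable z) {κ : Y → ℝ≥0∞} (hκ : Measurable κ)
    (hκ1 : ∫⁻ y, κ y ∂ν ≠ ∞) {f : Ω → F} (hf : Measurable f) (hf2 : MemLp f 2 P)
    {h : Ω × Y → F'} (hh : Measurable h) (hle : ∀ ω y, ‖h (ω, y)‖ₑ ≤ κ y * ‖f (M.τ (z y) ω)‖ₑ) :
    MemLp (fun ω => ∫ y, h (ω, y) ∂ν) 2 P := by
  refine ⟨hh.stronglyMeasurable.integral_prod_right'.aestronglyMeasurable, ?_⟩
  refine ((ENNReal.pow_lt_top_iff (n := 2)).1 ?_).resolve_right two_ne_zero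
  rw [eLpNorm_two_sq]
  refine lt_of_le_of_lt ?_ (ENNReal.mul_lt_top (ENNReal.pow_lt_top hκ1.lt_top (n := 2))
    (ENNReal.pow_lt_top hf2.2 (n := 2)))
  rw [eLpNorm_two_sq]
  refine le_trans (lintegral_mono fun ω => ?_) (M.lintegral_orbit_sq_le ν hz hκ hf)
  refine pow_le_pow_left' ((enorm_integral_le_lintegral_enorm _).trans ?_) 2
  exact lintegral_mono fun y => hle ω y

lemma ae_integrable_orbit (hz : Measurable z) {κ : Y → ℝ≥0∞} (hκ : Measurable κ)
    (hκ1 : ∫⁻ y, κ y ∂ν ≠ ∞) {f : Ω → F} (hf : Measurable f) (hf2 : MemLp f 2 P)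
    {h : Ω × Y → F'} (hh : Measurable h) (hle : ∀ ω y, ‖h (ω, y)‖ₑ ≤ κ y * ‖f (M.τ (z y) ω)‖ₑ) :
    ∀ᵐ ω ∂P, Integrable (fun y => h (ω, y)) ν := by
  have hm2 : Measurable fun p : Ω × Y => κ p.2 * ‖f (M.τ (z p.2) p.1)‖ₑ :=
    (hκ.comp measurable_snd).mul (((M.measurable_comp_τ hf).comp
      (measurable_fst.prodMk (hz.comp measurable_snd))).enorm)
  have h1 : ∀ᵐ ω ∂P, ∫⁻ y, κ y * ‖f (M.τ (z y) ω)‖ₑ ∂ν < ∞ := by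
    refine ae_lt_top hm2.lintegral_prod_right' ?_
    rw [M.lintegral_lintegral_τ ν hz hκ (f := fun ω => ‖f ω‖ₑ) (by fun_prop)]
    exact ENNReal.mul_ne_top hκ1 (hf2.integrable one_le_two).2.ne
  filter_upwards [h1] with ω hω
  exact ⟨(hh.comp measurable_prodMk_left).aestronglyMeasurable,
    (lintegral_mono fun y => hle ω y).trans_lt hω⟩

variable (z) in
/-- The functional `G ↦ ∫ ⟨G(τ_{z(y)} ω), k(y)⟩ dν(y)`. -/
def orbitPairing (k : Y → Euc d) (G : Ω → Euc d) (ω : Ω) : ℝ :=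
  ∫ y, inner ℝ (G (M.τ (z y) ω)) (k y) ∂ν

variable (z) in
/-- The adjoint of `orbitPairing`. -/
def orbitSpread (k : Y → Euc d) (Z : Ω → ℝ) (ω : Ω) : Euc d :=
  ∫ y, Z (M.τ (-z y) ω) • k y ∂ν

variable {k : Y → Euc d} (hz : Measurable z) (hk : Measurable k) (hk1 : Integrable k ν)

include hz hk in
lemma measurable_orbitPairing_kernel {G : Ω → Euc d} (hG : Measurable G) :
    Measurable fun p : Ω × Y => inner ℝ (G (M.τ (z p.2) p.1)) (k p.2) :=
  ((M.measurable_comp_τ hG).comp (measurable_fst.prodMk (hz.comp measurable_snd))).inner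
    (hk.comp measurable_snd)

include hz hk in
lemma measurable_orbitSpread_kernel {Z : Ω → ℝ} (hZ : Measurable Z) :
    Measurable fun p : Ω × Y => Z (M.τ (-z p.2) p.1) • k p.2 :=
  ((M.measurable_comp_τ hZ).comp (measurable_fst.prodMk (hz.comp measurable_snd).neg)).smul
    (hk.comp measurable_snd)

include hz hk in
lemma measurable_orbitPairing {G : Ω → Euc d} (hG : Measurable G) :
    Measurable (M.orbitPairing ν z k G) :=
  (M.measurable_orbitPairing_kernel hz hk hG).stronglyMeasurable.integral_prod_right'.measurable

include hz hk in
lemma measurable_orbitSpread {Z : Ω → ℝ} (hZ : Measurable Z) :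
    Measurable (M.orbitSpread ν z k Z) :=
  (M.measurable_orbitSpread_kernel hz hk hZ).stronglyMeasurable.integral_prod_right'.measurable

lemma enorm_inner_le_mul (a b : Euc d) : ‖(inner ℝ a b : ℝ)‖ₑ ≤ ‖b‖ₑ * ‖a‖ₑ := by
  rw [← ofReal_norm, ← ofReal_norm, ← ofReal_norm, ← ENNReal.ofReal_mul (norm_nonneg _)]
  exact ENNReal.ofReal_le_ofReal ((norm_inner_le_norm _ _).trans_eq (mul_comm _ _))

lemma enorm_mul_inner_le (t : ℝ) (v w : Euc d) :
    ‖t * inner ℝ v w‖ₑ ≤ ‖w‖ₑ * ‖t‖ₑ ^ 2 + ‖w‖ₑ * ‖v‖ₑ ^ 2 := by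
  have hsq : ∀ a b : ℝ≥0∞, a * b ≤ a ^ 2 + b ^ 2 := fun a b => by
    rcases le_total a b with h | h
    · exact (mul_le_mul' h le_rfl).trans (by rw [sq b]; exact le_add_self)
    · exact (mul_le_mul' le_rfl h).trans (by rw [sq a]; exact le_self_add)
  rw [enorm_mul, ← mul_add]
  calc _ ≤ ‖t‖ₑ * (‖w‖ₑ * ‖v‖ₑ) := mul_le_mul' le_rfl (enorm_inner_le_mul _ _)
    _ = ‖w‖ₑ * (‖t‖ₑ * ‖v‖ₑ) := by ring
    _ ≤ _ := mul_le_mul' le_rfl (hsq _ _)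

/-- Dominating the product by squares separates the two shifts, so stationarity can be applied to
each. This licenses the uses of Fubini below. -/
lemma integrable_orbit_mul_inner {z₁ z₂ : Y → Euc d} (hz₁ : Measurable z₁) (hz₂ : Measurable z₂)
    (hk : Measurable k) (hk1 : Integrable k ν)
    {Z : Ω → ℝ} (hZ : Measurable Z) (hZ2 : MemLp Z 2 P)
    {G : Ω → Euc d} (hG : Measurable G) (hG2 : MemLp G 2 P) :
    Integrable (fun p : Ω × Y => Z (M.τ (z₁ p.2) p.1) * inner ℝ (G (M.τ (z₂ p.2) p.1)) (k p.2))
      (P.prod ν) := by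
  have hZf : ∫⁻ ω, ‖Z ω‖ₑ ^ 2 ∂P < ∞ := by
    rw [← eLpNorm_two_sq]; exact ENNReal.pow_lt_top hZ2.2
  have hGf : ∫⁻ ω, ‖G ω‖ₑ ^ 2 ∂P < ∞ := by
    rw [← eLpNorm_two_sq]; exact ENNReal.pow_lt_top hG2.2
  have hZm : Measurable fun p : Ω × Y => Z (M.τ (z₁ p.2) p.1) :=
    (M.measurable_comp_τ hZ).comp (measurable_fst.prodMk (hz₁.comp measurable_snd))
  have hGm : Measurable fun p : Ω × Y => G (M.τ (z₂ p.2) p.1) :=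
    (M.measurable_comp_τ hG).comp (measurable_fst.prodMk (hz₂.comp measurable_snd))
  have hkm : Measurable fun p : Ω × Y => k p.2 := hk.comp measurable_snd
  have hA : Measurable fun p : Ω × Y => ‖k p.2‖ₑ * ‖Z (M.τ (z₁ p.2) p.1)‖ₑ ^ 2 :=
    hkm.enorm.mul (hZm.enorm.pow_const 2)
  have hB : Measurable fun p : Ω × Y => ‖k p.2‖ₑ * ‖G (M.τ (z₂ p.2) p.1)‖ₑ ^ 2 :=
    hkm.enorm.mul (hGm.enorm.pow_const 2)
  have eA : ∫⁻ p, ‖k p.2‖ₑ * ‖Z (M.τ (z₁ p.2) p.1)‖ₑ ^ 2 ∂(P.prod ν) < ∞ := by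
    rw [lintegral_prod _ hA.aemeasurable,
      M.lintegral_lintegral_τ ν hz₁ hk.enorm (f := fun ω => ‖Z ω‖ₑ ^ 2) (hZ.enorm.pow_const 2)]
    exact ENNReal.mul_lt_top hk1.2 hZf
  have eB : ∫⁻ p, ‖k p.2‖ₑ * ‖G (M.τ (z₂ p.2) p.1)‖ₑ ^ 2 ∂(P.prod ν) < ∞ := by
    rw [lintegral_prod _ hB.aemeasurable,
      M.lintegral_lintegral_τ ν hz₂ hk.enorm (f := fun ω => ‖G ω‖ₑ ^ 2) (hG.enorm.pow_const 2)]
    exact ENNReal.mul_lt_top hk1.2 hGf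
  refine ⟨(hZm.mul (hGm.inner hkm)).aestronglyMeasurable, ?_⟩
  rw [hasFiniteIntegral_iff_enorm]
  refine (lintegral_mono fun p => enorm_mul_inner_le _ _ _).trans_lt ?_
  rw [lintegral_add_left hA]
  exact ENNReal.add_lt_top.2 ⟨eA, eB⟩

include hz hk hk1

lemma memLp_orbitPairing {G : Ω → Euc d} (hG : Measurable G) (hG2 : MemLp G 2 P) :
    MemLp (M.orbitPairing ν z k G) 2 P :=
  M.memLp_orbit_integral ν hz hk.enorm hk1.2.ne hG hG2
    (M.measurable_orbitPairing_kernel hz hk hG) fun _ _ => enorm_inner_le_mul _ _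

lemma ae_integrable_orbitPairing {G : Ω → Euc d} (hG : Measurable G) (hG2 : MemLp G 2 P) :
    ∀ᵐ ω ∂P, Integrable (fun y => inner ℝ (G (M.τ (z y) ω)) (k y)) ν :=
  M.ae_integrable_orbit ν hz hk.enorm hk1.2.ne hG hG2
    (M.measurable_orbitPairing_kernel hz hk hG) fun _ _ => enorm_inner_le_mul _ _

lemma memLp_orbitSpread {Z : Ω → ℝ} (hZ : Measurable Z) (hZ2 : MemLp Z 2 P) :
    MemLp (M.orbitSpread ν z k Z) 2 P :=
  M.memLp_orbit_integral ν hz.neg hk.enorm hk1.2.ne hZ hZ2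
    (M.measurable_orbitSpread_kernel hz hk hZ) fun _ _ => by rw [enorm_smul, mul_comm]; rfl

lemma ae_integrable_orbitSpread {Z : Ω → ℝ} (hZ : Measurable Z) (hZ2 : MemLp Z 2 P) :
    ∀ᵐ ω ∂P, Integrable (fun y => Z (M.τ (-z y) ω) • k y) ν :=
  M.ae_integrable_orbit ν hz.neg hk.enorm hk1.2.ne hZ hZ2
    (M.measurable_orbitSpread_kernel hz hk hZ) fun _ _ => by rw [enorm_smul, mul_comm]; rfl

/-- Fubini and stationarity: `orbitSpread` is the adjoint of `orbitPairing`. -/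
theorem integral_mul_orbitPairing {Z : Ω → ℝ} (hZ : Measurable Z) (hZ2 : MemLp Z 2 P)
    {G : Ω → Euc d} (hG : Measurable G) (hG2 : MemLp G 2 P) :
    ∫ ω, Z ω * M.orbitPairing ν z k G ω ∂P = ∫ ω, inner ℝ (G ω) (M.orbitSpread ν z k Z ω) ∂P := by
  have i1 := M.integrable_orbit_mul_inner ν (measurable_const (a := (0 : Euc d))) hz hk hk1 hZ hZ2
    hG hG2
  have i2 := M.integrable_orbit_mul_inner ν hz.neg (measurable_const (a := (0 : Euc d))) hk hk1
    hZ hZ2 hG hG2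
  simp only [M.τ_zero] at i1 i2
  calc ∫ ω, Z ω * M.orbitPairing ν z k G ω ∂P
      = ∫ ω, ∫ y, Z ω * inner ℝ (G (M.τ (z y) ω)) (k y) ∂ν ∂P := by
        simp_rw [integral_const_mul, orbitPairing]
    _ = ∫ y, ∫ ω, Z ω * inner ℝ (G (M.τ (z y) ω)) (k y) ∂P ∂ν := integral_integral_swap i1
    _ = ∫ y, ∫ ω, Z (M.τ (-z y) ω) * inner ℝ (G ω) (k y) ∂P ∂ν := by
        refine integral_congr_ae (ae_of_all _ fun y => ?_)
        have hm : Measurable fun ω => Z (M.τ (-z y) ω) * inner ℝ (G ω) (k y) :=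
          (hZ.comp (M.measurable_τ _)).mul (hG.inner measurable_const)
        have := M.integral_comp_τ hm.aestronglyMeasurable (z y)
        simp only [M.τ_neg_τ] at this
        exact this
    _ = ∫ ω, ∫ y, Z (M.τ (-z y) ω) * inner ℝ (G ω) (k y) ∂ν ∂P :=
        (integral_integral_swap i2).symm
    _ = _ := by
        refine integral_congr_ae ?_
        filter_upwards [M.ae_integrable_orbitSpread ν hz hk hk1 hZ hZ2] with ω hω
        rw [orbitSpread, ← integral_inner hω]
        simp_rw [inner_smul_right]

end Operators

end Medium
end
noncomputable section
set_option linter.unusedSectionVars false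

/-! ### A countable family of test functions -/

section CountableTests

variable {d : ℕ}

/-- The restriction of a test function and its gradient to a ball. -/
def IsTestFunction.jet (m : ℕ) {ψ : Euc d → ℝ} (h : IsTestFunction Set.univ ψ) :
    C(Metric.closedBall (0 : Euc d) m, ℝ × Euc d) :=
  ⟨fun x => (ψ x, gradient ψ x), (h.continuous.comp continuous_subtype_val).prodMk
    (h.continuous_gradient.comp continuous_subtype_val)⟩

/-- The pairs `(ψ, ∇ψ)` live in the separable metric space of continuous maps on a compact ball, and
every subset of it has a countable dense subset. Choosing this inside the set of jets keeps the
approximants smooth and supported in the same ball. -/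
lemma exists_countable_dense_tests (d m : ℕ) :
    ∃ T : Set (Euc d → ℝ), T.Countable ∧
      (∀ χ ∈ T, IsTestFunction Set.univ χ ∧ tsupport χ ⊆ Metric.closedBall 0 m) ∧
      ∀ ψ : Euc d → ℝ, IsTestFunction Set.univ ψ → tsupport ψ ⊆ Metric.closedBall 0 m →
        ∀ ε > 0, ∃ χ ∈ T, ∀ x, ‖ψ x - χ x‖ ≤ ε ∧ ‖gradient ψ x - gradient χ x‖ ≤ ε := by
  have : CompactSpace (Metric.closedBall (0 : Euc d) m) :=
    isCompact_iff_compactSpace.1 (isCompact_closedBall _ _)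
  let S : Set C(Metric.closedBall (0 : Euc d) m, ℝ × Euc d) :=
    {f | ∃ (ψ : Euc d → ℝ) (h : IsTestFunction Set.univ ψ),
      tsupport ψ ⊆ Metric.closedBall 0 m ∧ h.jet m = f}
  obtain ⟨t, htS, htc, hSt⟩ :=
    (TopologicalSpace.IsSeparable.of_separableSpace S).exists_countable_dense_subset
  choose! Ψ h1 h2 h3 using fun f (hf : f ∈ t) => htS hf
  refine ⟨Ψ '' t, htc.image _, ?_, ?_⟩
  · rintro _ ⟨f, hf, rfl⟩
    exact ⟨h1 f hf, h2 f hf⟩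
  · intro ψ hψ hs ε hε
    obtain ⟨f, hf, hd⟩ := Metric.mem_closure_iff.1 (hSt ⟨ψ, hψ, hs, rfl⟩) ε hε
    refine ⟨Ψ f, ⟨f, hf, rfl⟩, fun x => ?_⟩
    by_cases hx : x ∈ Metric.closedBall (0 : Euc d) m
    · have h4 := (ContinuousMap.dist_apply_le_dist (f := hψ.jet m) (g := f) ⟨x, hx⟩).trans hd.le
      have h5 : f ⟨x, hx⟩ = (Ψ f x, gradient (Ψ f) x) := by
        conv_lhs => rw [← h3 f hf]
        rfl
      rw [h5, Prod.dist_eq, max_le_iff, dist_eq_norm, dist_eq_norm] at h4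
      exact h4
    · have e1 : ∀ χ : Euc d → ℝ, tsupport χ ⊆ Metric.closedBall 0 m →
          χ x = 0 ∧ gradient χ x = 0 := fun χ hχ => by
        have hx' : x ∉ tsupport χ := fun h => hx (hχ h)
        refine ⟨image_eq_zero_of_notMem_tsupport hx', ?_⟩
        have : x ∉ Function.support (fderiv ℝ χ) := fun h => hx' (support_fderiv_subset ℝ h)
        rw [gradient, Function.notMem_support.1 this, map_zero]
      rw [(e1 _ hs).1, (e1 _ hs).2, (e1 _ (h2 f hf)).1, (e1 _ (h2 f hf)).2]
      simpa using hε.le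

/-- Countably many test functions suffice to test a first order distributional identity. -/
theorem exists_determining_tests (d : ℕ) :
    ∃ D : Set (Euc d → ℝ), D.Countable ∧ (∀ χ ∈ D, IsTestFunction Set.univ χ) ∧
      ∀ (p : Euc d → ℝ) (q : Euc d → Euc d), LocallyIntegrable p → LocallyIntegrable q →
        (∀ χ ∈ D, ∫ x, (p x * χ x + inner ℝ (q x) (gradient χ x)) = 0) →
        ∀ ψ, IsTestFunction Set.univ ψ → ∫ x, (p x * ψ x + inner ℝ (q x) (gradient ψ x)) = 0 := by
  choose T hT1 hT2 hT3 using exists_countable_dense_tests d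
  refine ⟨⋃ m, T m, Set.countable_iUnion hT1, fun χ hχ => ?_, ?_⟩
  · obtain ⟨m, hm⟩ := Set.mem_iUnion.1 hχ
    exact (hT2 m χ hm).1
  intro p q hp hq h0 ψ hψ
  obtain ⟨r, hr⟩ := hψ.2.1.isCompact.isBounded.subset_closedBall 0
  obtain ⟨m, hm⟩ := exists_nat_ge r
  replace hr := hr.trans (Metric.closedBall_subset_closedBall hm)
  set K := Metric.closedBall (0 : Euc d) m
  have hK : IsCompact K := isCompact_closedBall _ _
  have hint : ∀ χ : Euc d → ℝ, IsTestFunction Set.univ χ →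
      Integrable fun x => p x * χ x + inner ℝ (q x) (gradient χ x) := fun χ hχ => by
    have i1 := hp.integrable_smul_left_of_hasCompactSupport hχ.continuous hχ.2.1
    have i2 : Integrable fun x => inner ℝ (q x) (gradient χ x) := by
      simp only [inner_eq_sum]
      refine integrable_finsetSum _ fun j _ => ?_
      have hqj : LocallyIntegrable fun x => q x j := fun x => by
        obtain ⟨s, hs, h⟩ := hq x
        exact ⟨s, hs, (EuclideanSpace.proj (𝕜 := ℝ) j).integrable_comp h⟩
      have := hqj.integrable_smul_left_of_hasCompactSupport (hχ.continuous_gradient_apply j)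
        (hχ.hasCompactSupport_gradient_apply j)
      simpa [mul_comm] using this
    exact (by simpa [mul_comm] using i1 : Integrable fun x => p x * χ x).add i2
  have hpK : IntegrableOn (fun x => ‖p x‖ + ‖q x‖) K :=
    ((hp.integrableOn_isCompact hK).norm).add ((hq.integrableOn_isCompact hK).norm)
  set C := ∫ x in K, (‖p x‖ + ‖q x‖)
  have hC : 0 ≤ C := integral_nonneg fun x => by positivity
  -- `C¹` approximation with common compact support costs at most `ε` times the local `L¹` norm of
  -- `p` and `q`.
  have key : ∀ ε > 0, ‖∫ x, (p x * ψ x + inner ℝ (q x) (gradient ψ x))‖ ≤ ε * C := by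
    intro ε hε
    obtain ⟨χ, hχ, hd⟩ := hT3 m ψ hψ hr ε hε
    have hχT := (hT2 m χ hχ).1
    have h1 := h0 χ (Set.mem_iUnion.2 ⟨m, hχ⟩)
    rw [← sub_zero (∫ x, (p x * ψ x + inner ℝ (q x) (gradient ψ x))), ← h1,
      ← integral_sub (hint ψ hψ) (hint χ hχT)]
    have e1 : ∀ x, x ∉ K → (p x * ψ x + inner ℝ (q x) (gradient ψ x)) -
        (p x * χ x + inner ℝ (q x) (gradient χ x)) = 0 := fun x hx => by
      have e1 : ∀ χ : Euc d → ℝ, tsupport χ ⊆ K → χ x = 0 ∧ gradient χ x = 0 := fun χ hχ => by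
        have hx' : x ∉ tsupport χ := fun h => hx (hχ h)
        refine ⟨image_eq_zero_of_notMem_tsupport hx', ?_⟩
        have : x ∉ Function.support (fderiv ℝ χ) := fun h => hx' (support_fderiv_subset ℝ h)
        rw [gradient, Function.notMem_support.1 this, map_zero]
      rw [(e1 ψ hr).1, (e1 ψ hr).2, (e1 _ (hT2 m χ hχ).2).1, (e1 _ (hT2 m χ hχ).2).2]
      simp
    rw [← setIntegral_eq_integral_of_forall_compl_eq_zero e1, ← integral_const_mul]
    refine norm_integral_le_of_norm_le (hpK.const_mul ε) (ae_of_all _ fun x => ?_)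
    have : (p x * ψ x + inner ℝ (q x) (gradient ψ x)) - (p x * χ x + inner ℝ (q x) (gradient χ x))
        = p x * (ψ x - χ x) + inner ℝ (q x) (gradient ψ x - gradient χ x) := by
      rw [inner_sub_right]; ring
    rw [this]
    calc _ ≤ ‖p x‖ * ‖ψ x - χ x‖ + ‖q x‖ * ‖gradient ψ x - gradient χ x‖ :=
          (norm_add_le _ _).trans (add_le_add (norm_mul _ _).le (norm_inner_le_norm _ _))
      _ ≤ ‖p x‖ * ε + ‖q x‖ * ε := by
          gcongr
          exacts [(hd x).1, (hd x).2]
      _ = ε * (‖p x‖ + ‖q x‖) := by ring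
  by_contra hne
  have hpos := norm_pos_iff.2 hne
  set N := ‖∫ x, (p x * ψ x + inner ℝ (q x) (gradient ψ x))‖
  have := key (N / (2 * (C + 1))) (by positivity)
  have h2 : N / (2 * (C + 1)) * C ≤ N / 2 := by
    rw [div_mul_eq_mul_div, div_le_div_iff₀ (by positivity) (by norm_num)]
    nlinarith
  linarith

end CountableTests

/-! ### Stationary potential fields and their orthogonal complement -/

namespace Medium

variable {d : ℕ} {Ω : Type*} [MeasurableSpace Ω] {P : Measure Ω} [IsProbabilityMeasure P]
  (M : Medium d P)

/-- The space of stationary potential fields: the closure in `L²(Ω)` of the span of the gradients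
of mollified stationary fields. -/
def potential : Submodule ℝ (Lp (Euc d) 2 P) :=
  (Submodule.span ℝ {F : Lp (Euc d) 2 P | ∃ (Z : Ω → ℝ) (ψ : Euc d → ℝ), Measurable Z ∧
    MemLp Z 2 P ∧ IsTestFunction Set.univ ψ ∧
    F =ᵐ[P] M.orbitSpread volume id (gradient ψ) Z}).topologicalClosure

lemma mem_orthogonal_potential {K : Lp (Euc d) 2 P}
    (h : ∀ (Z : Ω → ℝ) (ψ : Euc d → ℝ), Measurable Z → MemLp Z 2 P → IsTestFunction Set.univ ψ →
      ∫ ω, inner ℝ (K ω) (M.orbitSpread volume id (gradient ψ) Z ω) ∂P = 0) :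
    K ∈ M.potentialᗮ := by
  rw [potential, Submodule.orthogonal_closure, Submodule.mem_orthogonal']
  intro u hu
  induction hu using Submodule.span_induction with
  | mem F hF =>
    obtain ⟨Z, ψ, hZ, hZ2, hψ, hF⟩ := hF
    rw [L2.inner_def, ← h Z ψ hZ hZ2 hψ]
    refine integral_congr_ae ?_
    filter_upwards [hF] with ω hω
    rw [hω]
  | zero => simp
  | add x y _ _ hx hy => rw [inner_add_right, hx, hy, add_zero]
  | smul c x _ hx => rw [inner_smul_right, hx, mul_zero]

lemma integrable_gradient {ψ : Euc d → ℝ} (hψ : IsTestFunction Set.univ ψ) :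
    Integrable (gradient ψ) :=
  hψ.continuous_gradient.integrable_of_hasCompactSupport hψ.hasCompactSupport_gradient

lemma toLp_orbitSpread_mem_potential {Z : Ω → ℝ} {ψ : Euc d → ℝ} (hZ : Measurable Z)
    (hZ2 : MemLp Z 2 P) (hψ : IsTestFunction Set.univ ψ) :
    (M.memLp_orbitSpread volume measurable_id hψ.continuous_gradient.measurable
      (integrable_gradient hψ) hZ hZ2).toLp _ ∈ M.potential :=
  Submodule.le_topologicalClosure _ (Submodule.subset_span
    ⟨Z, ψ, hZ, hZ2, hψ, MemLp.coeFn_toLp _⟩)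

/-- A stationary field is orthogonal to all potential fields iff it is almost surely
divergence-free. -/
theorem toLp_mem_orthogonal_potential_iff {q : Ω → Euc d} (hq : Measurable q) (hq2 : MemLp q 2 P) :
    hq2.toLp q ∈ M.potentialᗮ ↔ ∀ᵐ ω ∂P, ∀ ψ : Euc d → ℝ, IsTestFunction Set.univ ψ →
      ∫ x, inner ℝ (q (M.τ x ω)) (gradient ψ x) = 0 := by
  constructor
  · intro h
    -- Each test function has its own null set, so the quantifier over tests can enter the almost
    -- sure statement only through a countable family.
    obtain ⟨D, hDc, hD, hdet⟩ := exists_determining_tests d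
    have h1 : ∀ᵐ ω ∂P, ∀ χ ∈ D, ∫ x, inner ℝ (q (M.τ x ω)) (gradient χ x) = 0 := by
      refine (ae_ball_iff hDc).2 fun χ hχ => ?_
      have hχ' := hD χ hχ
      have hk := hχ'.continuous_gradient.measurable
      have hk1 := integrable_gradient hχ'
      -- The pairing itself serves as the stationary function to be mollified: the adjoint identity
      -- gives `E[Z²] = ⟨q, orbitSpread Z⟩ = 0`.
      set Z := M.orbitPairing volume id (gradient χ) q
      have hZ : Measurable Z := M.measurable_orbitPairing volume measurable_id hk hq
      have hZ2 : MemLp Z 2 P := M.memLp_orbitPairing volume measurable_id hk hk1 hq hq2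
      have e1 := M.integral_mul_orbitPairing volume measurable_id hk hk1 hZ hZ2 hq hq2
      have e2 := (Submodule.mem_orthogonal' _ _).1 h _ (M.toLp_orbitSpread_mem_potential hZ hZ2 hχ')
      rw [L2.inner_def] at e2
      have e3 : ∫ ω, Z ω * Z ω ∂P = 0 := by
        rw [e1, ← e2]
        refine integral_congr_ae ?_
        filter_upwards [hq2.coeFn_toLp, (M.memLp_orbitSpread volume measurable_id hk hk1 hZ
          hZ2).coeFn_toLp] with ω h1 h2
        rw [h1, h2]
      have e4 := (integral_eq_zero_iff_of_nonneg (fun ω => mul_self_nonneg (Z ω))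
        (hZ2.integrable_mul hZ2)).1 e3
      filter_upwards [e4] with ω hω
      exact mul_self_eq_zero.1 hω
    filter_upwards [h1, M.ae_l2Loc hq hq2] with ω h1 h2 ψ hψ
    have := hdet (fun _ => 0) _ (locallyIntegrable_const 0) h2.locallyIntegrable
      (fun χ hχ => by simpa using h1 χ hχ) ψ hψ
    simpa using this
  · intro h
    refine M.mem_orthogonal_potential fun Z ψ hZ hZ2 hψ => ?_
    have e1 := M.integral_mul_orbitPairing volume measurable_id
      hψ.continuous_gradient.measurable (integrable_gradient hψ) hZ hZ2 hq hq2
    have e2 : ∫ ω, Z ω * M.orbitPairing volume id (gradient ψ) q ω ∂P = 0 := by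
      refine integral_eq_zero_of_ae ?_
      filter_upwards [h] with ω hω
      exact mul_eq_zero_of_right _ (hω ψ hψ)
    rw [← e2, e1]
    refine integral_congr_ae ?_
    filter_upwards [hq2.coeFn_toLp] with ω h1
    rw [h1]

/-- Potential fields have mean zero. -/
lemma integral_eq_zero_of_mem_potential {G : Lp (Euc d) 2 P} (hG : G ∈ M.potential) :
    ∫ ω, G ω ∂P = 0 := by
  refine ext_inner_left ℝ fun e => ?_
  have h : (memLp_const e : MemLp (fun _ : Ω => e) 2 P).toLp _ ∈ M.potentialᗮ := by
    rw [M.toLp_mem_orthogonal_potential_iff measurable_const]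
    refine ae_of_all _ fun ω ψ hψ => ?_
    rw [integral_inner (integrable_gradient hψ)]
    have : ∫ x, gradient ψ x = 0 := by
      ext j
      exact ((EuclideanSpace.proj (𝕜 := ℝ) j).integral_comp_comm
        (integrable_gradient hψ)).symm.trans (hψ.integral_gradient j)
    rw [this, inner_zero_right]
  have h2 := (Submodule.mem_orthogonal' _ _).1 h _ hG
  have h3 := inner_Lp_const (P := P) e G
  rw [inner_zero_right, ← h3]
  exact h2

end Medium
end
noncomputable section
set_option linter.unusedSectionVars false

/-! ### The radial primitive of a potential field -/

lemma integrable_inner_of_memLp {Ω E : Type*} [MeasurableSpace Ω] {P : Measure Ω}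
    [NormedAddCommGroup E] [InnerProductSpace ℝ E] {f g : Ω → E} (hf : MemLp f 2 P)
    (hg : MemLp g 2 P) : Integrable (fun ω => inner ℝ (f ω) (g ω)) P := by
  refine (L2.integrable_inner (𝕜 := ℝ) (hf.toLp f) (hg.toLp g)).congr ?_
  filter_upwards [hf.coeFn_toLp, hg.coeFn_toLp] with ω h1 h2
  rw [h1, h2]

section Mollify

variable {d : ℕ}

/-- The convolution `∫ ζ(x - y) χ(y) dy`. -/
def mollify (χ ζ : Euc d → ℝ) : Euc d → ℝ :=
  convolution χ ζ (ContinuousLinearMap.mul ℝ ℝ) volume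

lemma contDiff_mollify {χ ζ : Euc d → ℝ} (hχ : IsTestFunction Set.univ χ)
    (hζ : LocallyIntegrable ζ) : ContDiff ℝ 1 (mollify χ ζ) :=
  hχ.2.1.contDiff_convolution_left (n := 1) _ hχ.contDiff_one hζ

lemma gradient_mollify {χ ζ : Euc d → ℝ} (hχ : IsTestFunction Set.univ χ)
    (hζ : LocallyIntegrable ζ) (x : Euc d) :
    gradient (mollify χ ζ) x = ∫ y, ζ (x - y) • gradient χ y := by
  have h1 := hχ.2.1.hasFDerivAt_convolution_left (ContinuousLinearMap.mul ℝ ℝ) hχ.contDiff_one hζ x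
  have h2 := (hχ.2.1.fderiv ℝ).convolutionExists_left
    ((ContinuousLinearMap.mul ℝ ℝ).precompL (Euc d)) (hχ.contDiff_one.continuous_fderiv one_ne_zero)
    hζ x
  have h3 : Integrable fun y => ζ (x - y) • gradient χ y := by
    have hl : LocallyIntegrable fun y => ζ (x - y) := by
      intro y
      obtain ⟨s, hs, hi⟩ := hζ (x - y)
      have hmp : MeasurePreserving (fun y : Euc d => x - y) volume volume :=
        volume.measurePreserving_sub_left x
      refine ⟨(fun y => x - y) ⁻¹' s, (by fun_prop : Continuous fun y : Euc d => x - y).continuousAt.preimage_mem_nhds hs, ?_⟩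
      exact (hmp.integrableOn_comp_preimage
        (MeasurableEquiv.subLeft x).measurableEmbedding).2 hi
    exact hl.integrable_smul_right_of_hasCompactSupport hχ.continuous_gradient
      hχ.hasCompactSupport_gradient
  refine ext_inner_right ℝ fun v => ?_
  rw [inner_gradient_left, mollify, h1.fderiv, convolution_def, ContinuousLinearMap.integral_apply h2,
    real_inner_comm, ← integral_inner h3]
  refine integral_congr_ae (ae_of_all _ fun y => ?_)
  simp only [ContinuousLinearMap.precompL_apply, ContinuousLinearMap.mul_apply', inner_smul_right]
  rw [real_inner_comm, inner_gradient_left, mul_comm]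

lemma setIntegral_inner_gradient_smul {S : Euc d → ℝ} (hS : ContDiff ℝ 1 S) (x : Euc d) :
    ∫ s in Set.Ioc (0 : ℝ) 1, inner ℝ (gradient S (s • x)) x = S x - S 0 := by
  rw [← intervalIntegral.integral_of_le zero_le_one]
  have hc : Continuous fun s : ℝ => inner ℝ (gradient S (s • x)) x := by
    have := continuous_gradient hS
    fun_prop
  have := intervalIntegral.integral_eq_sub_of_hasDerivAt (a := 0) (b := 1)
    (f := fun s : ℝ => S (s • x)) (f' := fun s => inner ℝ (gradient S (s • x)) x)
    (fun s _ => ?_) (hc.intervalIntegrable _ _)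
  · simpa using this
  · have h1 := ((hS.differentiable one_ne_zero) (s • x)).hasFDerivAt
    have h2 : HasDerivAt (fun s : ℝ => s • x) x s := by
      simpa using (hasDerivAt_id s).smul_const x
    simpa [inner_gradient_left, Function.comp_def] using h1.comp_hasDerivAt s h2

end Mollify

namespace Medium

variable {d : ℕ} {Ω : Type*} [MeasurableSpace Ω] {P : Measure Ω} [IsProbabilityMeasure P]
  (M : Medium d P)

/-- The line integral of the stationary field `G(τ_x ω)` from `0` to `x`. -/
def radialPrim (G : Ω → Euc d) (ω : Ω) (x : Euc d) : ℝ :=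
  ∫ s in Set.Ioc (0 : ℝ) 1, inner ℝ (G (M.τ (s • x) ω)) x

lemma measurable_radialPrim {G : Ω → Euc d} (hG : Measurable G) :
    Measurable fun p : Ω × Euc d => M.radialPrim G p.1 p.2 := by
  have : Measurable fun p : (Ω × Euc d) × ℝ => inner ℝ (G (M.τ (p.2 • p.1.2) p.1.1)) p.1.2 :=
    ((M.measurable_comp_τ hG).comp ((measurable_fst.comp measurable_fst).prodMk
      (measurable_snd.smul (measurable_snd.comp measurable_fst)))).inner
      (measurable_snd.comp measurable_fst)
  exact this.stronglyMeasurable.integral_prod_right'.measurable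

lemma lintegral_radialPrim_sq_le (G : Ω → Euc d) (ω : Ω) (r : ℝ) :
    ∫⁻ x in Metric.closedBall (0 : Euc d) r, ‖M.radialPrim G ω x‖ₑ ^ 2 ≤
      ENNReal.ofReal r ^ 2 * ∫⁻ x in Metric.closedBall (0 : Euc d) r,
        ∫⁻ s in Set.Ioc (0 : ℝ) 1, ‖G (M.τ (s • x) ω)‖ₑ ^ 2 := by
  have hr : ENNReal.ofReal r ^ 2 ≠ ∞ := ENNReal.pow_ne_top ENNReal.ofReal_ne_top
  rw [← lintegral_const_mul' _ _ hr]
  refine setLIntegral_mono' Metric.isClosed_closedBall.measurableSet fun x hx => ?_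
  refine (enorm_integral_sq_le _ _).trans ?_
  rw [← lintegral_const_mul' _ _ hr]
  refine lintegral_mono fun s => ?_
  rw [← mul_pow]
  refine pow_le_pow_left' ((enorm_inner_le_mul _ _).trans (mul_le_mul' ?_ le_rfl)) 2
  rw [← ofReal_norm]
  exact ENNReal.ofReal_le_ofReal (mem_closedBall_zero_iff.1 hx)

/-- The points `s • x` concentrate near the origin, but stationarity gives each of them the same
second moment, so the expectation is finite without a change of variables. -/
lemma ae_lintegral_radial_sq_lt_top {G : Ω → Euc d} (hG : Measurable G) (hG2 : MemLp G 2 P)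
    (r : ℝ) :
    ∀ᵐ ω ∂P, ∫⁻ x in Metric.closedBall (0 : Euc d) r,
      ∫⁻ s in Set.Ioc (0 : ℝ) 1, ‖G (M.τ (s • x) ω)‖ₑ ^ 2 < ∞ := by
  have hs : Measurable fun p : Euc d × ℝ => p.2 • p.1 := measurable_snd.smul measurable_fst
  have h1 := M.lintegral_lintegral_τ
    ((volume.restrict (Metric.closedBall (0 : Euc d) r)).prod
      (volume.restrict (Set.Ioc (0 : ℝ) 1))) hs
    (measurable_const (a := (1 : ℝ≥0∞))) (f := fun ω => ‖G ω‖ₑ ^ 2) (hG.enorm.pow_const 2)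
  simp only [one_mul] at h1
  have h2 : ∀ᵐ ω ∂P, ∫⁻ p, ‖G (M.τ (p.2 • p.1) ω)‖ₑ ^ 2
      ∂((volume.restrict (Metric.closedBall (0 : Euc d) r)).prod
        (volume.restrict (Set.Ioc (0 : ℝ) 1))) < ∞ := by
    refine ae_lt_top ?_ ?_
    · exact ((((M.measurable_comp_τ hG).comp
        (measurable_fst.prodMk (hs.comp measurable_snd))).enorm).pow_const 2).lintegral_prod_right'
    · rw [h1, ← eLpNorm_two_sq, lintegral_one, ← Set.univ_prod_univ, Measure.prod_prod,
        Measure.restrict_apply_univ, measure_univ, mul_one]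
      exact ENNReal.mul_ne_top measure_closedBall_lt_top.ne (ENNReal.pow_ne_top hG2.2.ne)
  filter_upwards [h2] with ω hω
  have hm : Measurable fun p : Euc d × ℝ => ‖G (M.τ (p.2 • p.1) ω)‖ₑ ^ 2 :=
    (((M.measurable_orbit hG ω).comp hs).enorm).pow_const 2
  rwa [lintegral_prod _ hm.aemeasurable] at hω

lemma ae_l2Loc_radialPrim {G : Ω → Euc d} (hG : Measurable G) (hG2 : MemLp G 2 P) :
    ∀ᵐ ω ∂P, L2Loc (M.radialPrim G ω) := by
  have h : ∀ᵐ ω ∂P, ∀ n : ℕ, ∫⁻ x in Metric.closedBall (0 : Euc d) n,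
      ∫⁻ s in Set.Ioc (0 : ℝ) 1, ‖G (M.τ (s • x) ω)‖ₑ ^ 2 < ∞ :=
    ae_all_iff.2 fun n => M.ae_lintegral_radial_sq_lt_top hG hG2 n
  filter_upwards [h] with ω hω
  have hrm : Measurable (M.radialPrim G ω) :=
    Measurable.of_uncurry_left (M.measurable_radialPrim hG)
  refine L2Loc.of_ball fun n => ⟨hrm.aestronglyMeasurable, ?_⟩
  rw [eLpNorm_two_eq]
  have h2 := (M.lintegral_radialPrim_sq_le G ω n).trans_lt
    (ENNReal.mul_lt_top (ENNReal.pow_lt_top ENNReal.ofReal_lt_top) (hω n))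
  exact ENNReal.rpow_lt_top_of_nonneg one_half_pos.le h2.ne

section Pairing

variable {ψ : Euc d → ℝ} (hψ : IsTestFunction Set.univ ψ) (j : Fin d)

/-- The kernel which tests the radial primitive against `∂_j ψ`. -/
def primKernel (ψ : Euc d → ℝ) (j : Fin d) (p : Euc d × ℝ) : Euc d := gradient ψ p.1 j • p.1

/-- The kernel which tests the field against `ψ e_j`. -/
def fieldKernel (ψ : Euc d → ℝ) (j : Fin d) (x : Euc d) : Euc d :=
  ψ x • EuclideanSpace.single j (1 : ℝ)

include hψ

lemma measurable_primKernel : Measurable (primKernel ψ j) :=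
  ((hψ.continuous_gradient_apply j).measurable.comp measurable_fst).smul measurable_fst

lemma integrable_primKernel :
    Integrable (primKernel ψ j) (volume.prod (volume.restrict (Set.Ioc (0 : ℝ) 1))) := by
  have h : Integrable fun x : Euc d => gradient ψ x j • x :=
    ((hψ.continuous_gradient_apply j).smul continuous_id).integrable_of_hasCompactSupport
      (hψ.hasCompactSupport_gradient_apply j).smul_right
  exact h.comp_fst _

lemma measurable_fieldKernel : Measurable (fieldKernel ψ j) :=
  hψ.continuous.measurable.smul measurable_const

lemma integrable_fieldKernel : Integrable (fieldKernel ψ j) :=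
  (hψ.continuous.integrable_of_hasCompactSupport hψ.2.1).smul_const _

lemma ae_orbitPairing_primKernel {G : Ω → Euc d} (hG : Measurable G) (hG2 : MemLp G 2 P) :
    ∀ᵐ ω ∂P, M.orbitPairing (volume.prod (volume.restrict (Set.Ioc (0 : ℝ) 1)))
      (fun p => p.2 • p.1) (primKernel ψ j) G ω = ∫ x, M.radialPrim G ω x * gradient ψ x j := by
  have hs : Measurable fun p : Euc d × ℝ => p.2 • p.1 := measurable_snd.smul measurable_fst
  filter_upwards [M.ae_integrable_orbitPairing _ hs (measurable_primKernel hψ j)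
    (integrable_primKernel hψ j) hG hG2] with ω hω
  rw [orbitPairing, integral_prod _ hω]
  refine integral_congr_ae (ae_of_all _ fun x => ?_)
  simp only [primKernel, inner_smul_right, radialPrim]
  rw [integral_const_mul, mul_comm]

omit [IsProbabilityMeasure P] hψ in
lemma orbitPairing_fieldKernel (G : Ω → Euc d) (ω : Ω) :
    M.orbitPairing volume id (fieldKernel ψ j) G ω = ∫ x, G (M.τ x ω) j * ψ x := by
  refine integral_congr_ae (ae_of_all _ fun x => ?_)
  simp [fieldKernel, inner_smul_right, EuclideanSpace.inner_single_right, mul_comm]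

omit hψ in
-- For a generator of the potential space the orbit field is the classical gradient of the `C¹`
-- function `S = χ * ζ`, so its radial primitive is `S - S 0`. The constant drops out since `∂_j ψ`
-- has integral zero.
lemma ae_radialPrim_orbitSpread {χ : Euc d → ℝ} (hψ : IsTestFunction Set.univ ψ)
    (hχ : IsTestFunction Set.univ χ) {Z : Ω → ℝ} (hZ : Measurable Z) (hZ2 : MemLp Z 2 P) :
    ∀ᵐ ω ∂P, (∫ x, M.radialPrim (M.orbitSpread volume id (gradient χ) Z) ω x * gradient ψ x j)
      + ∫ x, M.orbitSpread volume id (gradient χ) Z (M.τ x ω) j * ψ x = 0 := by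
  filter_upwards [M.ae_l2Loc hZ hZ2] with ω hω
  set ζ : Euc d → ℝ := fun x => Z (M.τ x ω)
  set S := mollify χ ζ
  have hS : ContDiff ℝ 1 S := contDiff_mollify hχ hω.locallyIntegrable
  have h1 : ∀ x, M.orbitSpread volume id (gradient χ) Z (M.τ x ω) = gradient S x := fun x => by
    rw [gradient_mollify hχ hω.locallyIntegrable]
    refine integral_congr_ae (ae_of_all _ fun y => ?_)
    simp only [id, ζ]
    rw [← M.τ_add, neg_add_eq_sub]
  have h2 : ∀ x, M.radialPrim (M.orbitSpread volume id (gradient χ) Z) ω x = S x - S 0 := fun x => by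
    simp only [radialPrim, h1]
    exact setIntegral_inner_gradient_smul hS x
  have h3 := (HasWeakGradient.of_contDiff hS).2.2 ψ hψ j
  have hi1 : Integrable fun x => S x * gradient ψ x j :=
    (L2Loc.of_continuous hS.continuous).integrable_mul (hψ.continuous_gradient_apply j)
      (hψ.hasCompactSupport_gradient_apply j)
  have hi2 : Integrable fun x => S 0 * gradient ψ x j :=
    (L2Loc.of_continuous continuous_const).integrable_mul (hψ.continuous_gradient_apply j)
      (hψ.hasCompactSupport_gradient_apply j)
  simp only [h1, h2, sub_mul]
  rw [integral_sub hi1 hi2, integral_const_mul, hψ.integral_gradient j, h3]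
  ring

/-- Almost surely, the radial primitive of a potential field is a primitive, as tested against a
given function. -/
lemma ae_integral_radialPrim_of_mem_potential {G : Ω → Euc d} (hG : Measurable G)
    (hG2 : MemLp G 2 P) (hGp : hG2.toLp G ∈ M.potential) :
    ∀ᵐ ω ∂P, (∫ x, M.radialPrim G ω x * gradient ψ x j) + ∫ x, G (M.τ x ω) j * ψ x = 0 := by
  set ν := (volume : Measure (Euc d)).prod (volume.restrict (Set.Ioc (0 : ℝ) 1))
  have hs : Measurable fun p : Euc d × ℝ => p.2 • p.1 := measurable_snd.smul measurable_fst
  have a1 := measurable_primKernel hψ j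
  have a2 := integrable_primKernel hψ j
  have b1 := measurable_fieldKernel hψ j
  have b2 := integrable_fieldKernel hψ j
  -- `L F` is the defect in the tested identity for `F`. With `Z = L G` fixed, `K` is the adjoint of
  -- `L` applied to `Z`. As `L` vanishes on the generators, `K` is orthogonal to all potential
  -- fields, so `E[Z²] = ⟨G, K⟩ = 0`.
  set L : (Ω → Euc d) → Ω → ℝ := fun G ω => M.orbitPairing ν (fun p => p.2 • p.1) (primKernel ψ j) G ω
    + M.orbitPairing volume id (fieldKernel ψ j) G ω with hL
  set Z := L G
  have hZ : Measurable Z := (M.measurable_orbitPairing ν hs a1 hG).add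
    (M.measurable_orbitPairing volume measurable_id b1 hG)
  have hZ2 : MemLp Z 2 P := (M.memLp_orbitPairing ν hs a1 a2 hG hG2).add
    (M.memLp_orbitPairing volume measurable_id b1 b2 hG hG2)
  set K : Ω → Euc d := fun ω => M.orbitSpread ν (fun p => p.2 • p.1) (primKernel ψ j) Z ω
    + M.orbitSpread volume id (fieldKernel ψ j) Z ω with hK
  have hK1 := M.memLp_orbitSpread ν hs a1 a2 hZ hZ2
  have hK1' := M.memLp_orbitSpread volume measurable_id b1 b2 hZ hZ2
  have hK2 : MemLp K 2 P := hK1.add hK1'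
  have adj : ∀ F : Ω → Euc d, Measurable F → MemLp F 2 P →
      ∫ ω, Z ω * L F ω ∂P = ∫ ω, inner ℝ (F ω) (K ω) ∂P := fun F hF hF2 => by
    simp only [hL, hK, mul_add, inner_add_right]
    rw [integral_add, integral_add, M.integral_mul_orbitPairing ν hs a1 a2 hZ hZ2 hF hF2,
      M.integral_mul_orbitPairing volume measurable_id b1 b2 hZ hZ2 hF hF2]
    · exact integrable_inner_of_memLp hF2 hK1
    · exact integrable_inner_of_memLp hF2 hK1'
    · exact hZ2.integrable_mul (M.memLp_orbitPairing ν hs a1 a2 hF hF2)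
    · exact hZ2.integrable_mul (M.memLp_orbitPairing volume measurable_id b1 b2 hF hF2)
  have hKperp : hK2.toLp K ∈ M.potentialᗮ := by
    refine M.mem_orthogonal_potential fun Z' χ hZ' hZ'2 hχ => ?_
    have c1 := hχ.continuous_gradient.measurable
    have c2 := integrable_gradient hχ
    have hF := M.measurable_orbitSpread volume measurable_id c1 hZ'
    have hF2 := M.memLp_orbitSpread volume measurable_id c1 c2 hZ' hZ'2
    have := adj _ hF hF2
    have e0 : ∫ ω, Z ω * L (M.orbitSpread volume id (gradient χ) Z') ω ∂P = 0 := by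
      refine integral_eq_zero_of_ae ?_
      filter_upwards [M.ae_orbitPairing_primKernel hψ j hF hF2,
        M.ae_radialPrim_orbitSpread j hψ hχ hZ' hZ'2] with ω h1 h2
      refine mul_eq_zero_of_right _ ?_
      simp only [hL]
      rw [h1, orbitPairing_fieldKernel, h2]
    rw [← e0, this]
    refine integral_congr_ae ?_
    filter_upwards [hK2.coeFn_toLp] with ω h
    rw [h, real_inner_comm]
  have e1 := (Submodule.mem_orthogonal _ _).1 hKperp _ hGp
  rw [L2.inner_def] at e1
  have e3 : ∫ ω, Z ω * Z ω ∂P = 0 := by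
    rw [adj G hG hG2, ← e1]
    refine integral_congr_ae ?_
    filter_upwards [hG2.coeFn_toLp, hK2.coeFn_toLp] with ω h1 h2
    rw [h1, h2]
  have e4 := (integral_eq_zero_iff_of_nonneg (fun ω => mul_self_nonneg (Z ω))
    (hZ2.integrable_mul hZ2)).1 e3
  filter_upwards [e4, M.ae_orbitPairing_primKernel hψ j hG hG2] with ω h1 h2
  have h3 : Z ω = 0 := mul_self_eq_zero.1 h1
  rw [← h2, ← M.orbitPairing_fieldKernel]
  exact h3

end Pairing

/-- A potential field is the gradient of its radial primitive. -/
theorem hasStationaryGradient_radialPrim {G : Ω → Euc d} (hG : Measurable G)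
    (hG2 : MemLp G 2 P) (hGp : hG2.toLp G ∈ M.potential) :
    M.HasStationaryGradient (M.radialPrim G) G := by
  refine ⟨M.measurable_radialPrim hG, hG, hG2, ?_, ?_⟩
  · rw [← M.integral_eq_zero_of_mem_potential hGp]
    exact integral_congr_ae hG2.coeFn_toLp.symm
  obtain ⟨D, hDc, hD, hdet⟩ := exists_determining_tests d
  have h1 : ∀ᵐ ω ∂P, ∀ j : Fin d, ∀ χ ∈ D,
      (∫ x, M.radialPrim G ω x * gradient χ x j) + ∫ x, G (M.τ x ω) j * χ x = 0 :=
    ae_all_iff.2 fun j => (ae_ball_iff hDc).2 fun χ hχ =>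
      M.ae_integral_radialPrim_of_mem_potential (hD χ hχ) j hG hG2 hGp
  filter_upwards [h1, M.ae_l2Loc hG hG2, M.ae_l2Loc_radialPrim hG hG2] with ω h1 h2 h3
  refine ⟨h3, h2, fun ψ hψ j => ?_⟩
  -- The weak gradient identity in direction `j` has the first order form covered by the determining
  -- tests, with `p = G_j` and `q` the radial primitive times `e_j`.
  have e : ∀ χ, IsTestFunction Set.univ χ → ∫ x, (G (M.τ x ω) j * χ x +
      inner ℝ (M.radialPrim G ω x • EuclideanSpace.single j (1 : ℝ)) (gradient χ x)) =
      (∫ x, M.radialPrim G ω x * gradient χ x j) + ∫ x, G (M.τ x ω) j * χ x := fun χ hχ => by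
    simp only [inner_smul_left, EuclideanSpace.inner_single_left, map_one, one_mul]
    rw [add_comm, ← integral_add]
    · rfl
    · exact (h2.apply j).integrable_mul hχ.continuous hχ.2.1
    · exact h3.integrable_mul (hχ.continuous_gradient_apply j)
        (hχ.hasCompactSupport_gradient_apply j)
  have hq : L2Loc fun x => M.radialPrim G ω x • (EuclideanSpace.single j (1 : ℝ) : Euc d) :=
    fun K hK => by
      have := (ContinuousLinearMap.toSpanSingleton ℝ
        (EuclideanSpace.single j (1 : ℝ) : Euc d)).comp_memLp' (h3 K hK)
      exact this
  have := hdet (fun x => G (M.τ x ω) j) _ (h2.apply j).locallyIntegrable hq.locallyIntegrable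
    (fun χ hχ => by rw [e χ (hD χ hχ)]; exact h1 j χ hχ) ψ hψ
  rw [e ψ hψ] at this
  linarith

end Medium
end
noncomputable section
set_option linter.unusedSectionVars false

/-! ### Continuity of the shifts, and gradients are potential fields -/

section Translate

variable {d : ℕ} {F : Type*} [NormedAddCommGroup F]

lemma tendsto_lintegral_translate_sub {g : Euc d → F} (hg : MemLp g 2 volume) :
    Tendsto (fun h => ∫⁻ x, ‖g (x + h) - g x‖ₑ ^ 2) (𝓝 (0 : Euc d)) (𝓝 0) := by
  let T : Euc d → C(Euc d, Euc d) := fun h => ⟨fun x => x + h, by fun_prop⟩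
  have hT : Continuous T := ContinuousMap.continuous_of_continuous_uncurry _
    (by simp only [Function.uncurry_def, T, ContinuousMap.coe_mk]; fun_prop)
  have hmp : ∀ h, MeasurePreserving (T h) volume volume := fun h =>
    measurePreserving_add_right volume h
  have h1 : Tendsto (fun h => Lp.compMeasurePreserving (T h) (hmp h) (hg.toLp g)) (𝓝 0)
      (𝓝 (Lp.compMeasurePreserving (T 0) (hmp 0) (hg.toLp g))) :=
    tendsto_const_nhds.compMeasurePreservingLp (hT.tendsto 0) hmp (hmp 0) (by norm_num)
  rw [Lp.tendsto_Lp_iff_tendsto_eLpNorm'] at h1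
  have h2 := (ENNReal.continuous_pow 2).tendsto _ |>.comp h1
  simp only [Function.comp_def, eLpNorm_two_sq, ne_eq, OfNat.ofNat_ne_zero, not_false_eq_true,
    zero_pow] at h2
  refine h2.congr fun h => lintegral_congr_ae ?_
  rw [Lp.toLp_compMeasurePreserving hg (hmp h), Lp.toLp_compMeasurePreserving hg (hmp 0)]
  filter_upwards [(hg.comp_measurePreserving (hmp h)).coeFn_toLp,
    (hg.comp_measurePreserving (hmp 0)).coeFn_toLp] with x e1 e2
  rw [Pi.sub_apply, e1, e2]
  simp [T]

end Translate

namespace Medium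

variable {d : ℕ} {Ω : Type*} [MeasurableSpace Ω] {P : Measure Ω} [IsProbabilityMeasure P]
  (M : Medium d P)

section Continuity

variable {F : Type*} [NormedAddCommGroup F] [MeasurableSpace F] [BorelSpace F]
  [SecondCountableTopology F]

/-- Continuity of translations in `L²(ℝ^d)` after cutting off at radius `2`, which is invisible on
the unit ball for shifts of length at most `1`. -/
lemma tendsto_setLIntegral_orbit_sub {g : Euc d → F} (hg : L2Loc g) :
    Tendsto (fun h => ∫⁻ x in Metric.closedBall 0 1, ‖g (x + h) - g x‖ₑ ^ 2) (𝓝 (0 : Euc d))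
      (𝓝 0) := by
  have hB : MeasurableSet (Metric.closedBall (0 : Euc d) 2) :=
    Metric.isClosed_closedBall.measurableSet
  set γ : Euc d → F := (Metric.closedBall (0 : Euc d) 2).indicator g with hγ
  have h1 : Tendsto (fun h => ∫⁻ x, ‖γ (x + h) - γ x‖ₑ ^ 2) (𝓝 (0 : Euc d)) (𝓝 0) :=
    tendsto_lintegral_translate_sub
      ((memLp_indicator_iff_restrict hB).2 (hg _ (isCompact_closedBall _ _)))
  have h2 : ∀ᶠ h in 𝓝 (0 : Euc d), ∫⁻ x in Metric.closedBall 0 1, ‖g (x + h) - g x‖ₑ ^ 2 ≤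
      ∫⁻ x, ‖γ (x + h) - γ x‖ₑ ^ 2 := by
    filter_upwards [Metric.closedBall_mem_nhds (0 : Euc d) one_pos] with h hh
    have h3 : ∫⁻ x in Metric.closedBall 0 1, ‖g (x + h) - g x‖ₑ ^ 2 ≤
        ∫⁻ x in Metric.closedBall 0 1, ‖γ (x + h) - γ x‖ₑ ^ 2 := by
      refine setLIntegral_mono' Metric.isClosed_closedBall.measurableSet fun x hx => ?_
      rw [mem_closedBall_zero_iff] at hx hh
      rw [hγ, Set.indicator_of_mem, Set.indicator_of_mem]
      · rw [mem_closedBall_zero_iff]; linarith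
      · rw [mem_closedBall_zero_iff]; linarith [norm_add_le x h]
    exact h3.trans (setLIntegral_le_lintegral _ _)
  exact tendsto_of_tendsto_of_tendsto_of_le_of_le' tendsto_const_nhds h1
    (Eventually.of_forall fun _ => zero_le) h2

lemma setLIntegral_orbit_sub_le {g : Euc d → F} (hg : Measurable g) {h : Euc d}
    (hh : h ∈ Metric.closedBall (0 : Euc d) 1) :
    ∫⁻ x in Metric.closedBall (0 : Euc d) 1, ‖g (x + h) - g x‖ₑ ^ 2 ≤
      4 * ∫⁻ x in Metric.closedBall (0 : Euc d) 2, ‖g x‖ₑ ^ 2 := by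
  have hsq : ∀ a c : F, ‖a - c‖ₑ ^ 2 ≤ 2 * ‖a‖ₑ ^ 2 + 2 * ‖c‖ₑ ^ 2 := fun a c => by
    have := enorm_add_sq_le a (-c)
    rwa [← sub_eq_add_neg, enorm_neg] at this
  have hg2 : Measurable fun x => ‖g x‖ₑ ^ 2 := hg.enorm.pow_const 2
  rw [mem_closedBall_zero_iff] at hh
  have s1 : ∫⁻ x in Metric.closedBall 0 1, ‖g (x + h)‖ₑ ^ 2 ≤
      ∫⁻ x in Metric.closedBall (0 : Euc d) 2, ‖g x‖ₑ ^ 2 := by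
    have hmp := (measurePreserving_add_right (volume : Measure (Euc d)) h)
    rw [← hmp.setLIntegral_comp_preimage (s := Metric.closedBall 0 2)
      Metric.isClosed_closedBall.measurableSet hg2]
    refine lintegral_mono_set fun x hx => ?_
    rw [mem_closedBall_zero_iff] at hx
    rw [Set.mem_preimage, mem_closedBall_zero_iff]
    linarith [norm_add_le x h]
  have s2 : ∫⁻ x in Metric.closedBall 0 1, ‖g x‖ₑ ^ 2 ≤
      ∫⁻ x in Metric.closedBall (0 : Euc d) 2, ‖g x‖ₑ ^ 2 :=
    lintegral_mono_set (Metric.closedBall_subset_closedBall (by norm_num))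
  have hg' : Measurable fun x => 2 * ‖g (x + h)‖ₑ ^ 2 :=
    (hg2.comp (measurable_id.add_const h)).const_mul 2
  calc _ ≤ ∫⁻ x in Metric.closedBall 0 1, (2 * ‖g (x + h)‖ₑ ^ 2 + 2 * ‖g x‖ₑ ^ 2) :=
        lintegral_mono fun x => hsq _ _
    _ = 2 * (∫⁻ x in Metric.closedBall 0 1, ‖g (x + h)‖ₑ ^ 2) +
        2 * ∫⁻ x in Metric.closedBall 0 1, ‖g x‖ₑ ^ 2 := by
        rw [lintegral_add_left hg', lintegral_const_mul' _ _ (by simp),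
          lintegral_const_mul' _ _ (by simp)]
    _ ≤ 2 * (∫⁻ x in Metric.closedBall (0 : Euc d) 2, ‖g x‖ₑ ^ 2) +
        2 * ∫⁻ x in Metric.closedBall (0 : Euc d) 2, ‖g x‖ₑ ^ 2 := by gcongr
    _ = _ := by rw [← add_mul]; norm_num

lemma tendsto_lintegral_setLIntegral_sub {f : Ω → F} (hf : Measurable f) (hf2 : MemLp f 2 P) :
    Tendsto (fun h => ∫⁻ ω, (∫⁻ x in Metric.closedBall (0 : Euc d) 1,
      ‖f (M.τ (x + h) ω) - f (M.τ x ω)‖ₑ ^ 2) ∂P) (𝓝 0) (𝓝 (∫⁻ _, 0 ∂P)) := by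
  have hfin : ∫⁻ ω, ‖f ω‖ₑ ^ 2 ∂P ≠ ∞ := by
    rw [← eLpNorm_two_sq]; exact ENNReal.pow_ne_top hf2.2.ne
  refine tendsto_lintegral_filter_of_dominated_convergence
    (fun ω => 4 * ∫⁻ x in Metric.closedBall (0 : Euc d) 2, ‖f (M.τ x ω)‖ₑ ^ 2) ?_ ?_ ?_ ?_
  · refine Eventually.of_forall fun h => ?_
    have h1 : Measurable fun p : Ω × Euc d => f (M.τ (p.2 + h) p.1) :=
      (M.measurable_comp_τ hf).comp (measurable_fst.prodMk (measurable_snd.add_const h))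
    have h2 : Measurable fun p : Ω × Euc d => ‖f (M.τ (p.2 + h) p.1) - f (M.τ p.2 p.1)‖ₑ ^ 2 :=
      (h1.sub (M.measurable_comp_τ hf)).enorm.pow_const 2
    exact h2.lintegral_prod_right'
  · filter_upwards [Metric.closedBall_mem_nhds (0 : Euc d) one_pos] with h hh
    exact ae_of_all _ fun ω => setLIntegral_orbit_sub_le (M.measurable_orbit hf ω) hh
  · rw [lintegral_const_mul' _ _ (by simp),
      M.lintegral_setLIntegral_τ _ (f := fun ω => ‖f ω‖ₑ ^ 2) (hf.enorm.pow_const 2)]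
    exact ENNReal.mul_ne_top (by simp) (ENNReal.mul_ne_top measure_closedBall_lt_top.ne hfin)
  · refine (M.ae_l2Loc hf hf2).mono fun ω hω => ?_
    have h1 := tendsto_setLIntegral_orbit_sub (g := fun x => f (M.τ x ω)) hω
    exact h1

/-- No topology on `Ω` is involved: by stationarity the quantity equals its average over base points
in the unit ball, and there continuity of translations on `ℝ^d` applies for almost every orbit. -/
lemma tendsto_lintegral_τ_sub {f : Ω → F} (hf : Measurable f) (hf2 : MemLp f 2 P) :
    Tendsto (fun h => ∫⁻ ω, ‖f (M.τ h ω) - f ω‖ₑ ^ 2 ∂P) (𝓝 (0 : Euc d)) (𝓝 0) := by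
  obtain ⟨b, hb⟩ : ∃ b, b = volume (Metric.closedBall (0 : Euc d) 1) := ⟨_, rfl⟩
  have hb0 : b ≠ 0 := hb ▸ (Metric.measure_closedBall_pos volume _ one_pos).ne'
  have hbt : b ≠ ∞ := hb ▸ measure_closedBall_lt_top.ne
  have e1 : ∀ h, ∫⁻ ω, (∫⁻ x in Metric.closedBall (0 : Euc d) 1,
      ‖f (M.τ (x + h) ω) - f (M.τ x ω)‖ₑ ^ 2) ∂P = b * ∫⁻ ω, ‖f (M.τ h ω) - f ω‖ₑ ^ 2 ∂P :=
    fun h => by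
      have hfτ : Measurable fun ω => ‖f (M.τ h ω) - f ω‖ₑ ^ 2 :=
        ((hf.comp (M.measurable_τ h)).sub hf).enorm.pow_const 2
      rw [hb, ← M.lintegral_setLIntegral_τ _ hfτ]
      simp only [← M.τ_add, add_comm]
  have h2 := M.tendsto_lintegral_setLIntegral_sub hf hf2
  simp only [e1, lintegral_zero] at h2
  have h3 := ENNReal.Tendsto.const_mul (a := b⁻¹) h2 (Or.inr (ENNReal.inv_ne_top.2 hb0))
  rw [mul_zero] at h3
  refine h3.congr fun h => ?_
  rw [← mul_assoc, ENNReal.inv_mul_cancel hb0 hbt, one_mul]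

end Continuity

section Koopman

variable {F : Type*} [NormedAddCommGroup F] [InnerProductSpace ℝ F] [CompleteSpace F]
  [SecondCountableTopology F] [MeasurableSpace F] [BorelSpace F]

theorem continuous_koopman (f : Lp F 2 P) : Continuous fun x => M.koopman x f := by
  have h0 : Tendsto (fun h => ‖M.koopman h f - f‖) (𝓝 0) (𝓝 0) := by
    have hm : Measurable (f : Ω → F) := (Lp.stronglyMeasurable f).measurable
    have h1 := M.tendsto_lintegral_τ_sub hm (Lp.memLp f)
    have h2 := ((ENNReal.continuous_rpow_const (y := 1 / 2)).tendsto 0).comp h1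
    rw [ENNReal.zero_rpow_of_pos one_half_pos] at h2
    have h3 := (ENNReal.tendsto_toReal ENNReal.zero_ne_top).comp h2
    refine h3.congr fun h => ?_
    simp only [Function.comp_apply, Lp.norm_def]
    rw [eLpNorm_two_eq]
    congr 2
    refine lintegral_congr_ae ?_
    filter_upwards [Lp.coeFn_sub (M.koopman h f) f, M.coeFn_koopman h f] with ω e1 e2
    rw [e1, Pi.sub_apply, e2]
  refine continuous_iff_continuousAt.2 fun x => ?_
  rw [ContinuousAt, tendsto_iff_norm_sub_tendsto_zero]
  have h4 : Tendsto (fun y : Euc d => y - x) (𝓝 x) (𝓝 0) := by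
    simpa using (continuous_id.sub continuous_const).tendsto (f := fun y : Euc d => y - x) x
  refine (h0.comp h4).congr fun y => ?_
  -- The group law and the isometry property reduce continuity at `x` to continuity at `0`.
  rw [Function.comp_apply, ← (M.koopman x).norm_map, map_sub, M.koopman_koopman, sub_add_cancel]

end Koopman

instance : CompleteSpace M.potential :=
  (Submodule.isClosed_topologicalClosure _).completeSpace_coe

lemma integrable_orbit_mul_inner_inner {q f : Ω → Euc d} (hq : Measurable q) (hq2 : MemLp q 2 P)
    (hf : Measurable f) (hf2 : MemLp f 2 P) {ψ : Euc d → ℝ} (hψ : Measurable ψ)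
    (hψ1 : Integrable ψ) :
    Integrable (fun p : Ω × Euc d => ψ p.2 * inner ℝ (q p.1) (f (M.τ (-p.2) p.1)))
      (P.prod volume) := by
  have h : ∀ j : Fin d, Integrable (fun p : Ω × Euc d => q (M.τ 0 p.1) j *
      inner ℝ (f (M.τ (-p.2) p.1)) (ψ p.2 • EuclideanSpace.single j (1 : ℝ))) (P.prod volume) :=
    fun j => M.integrable_orbit_mul_inner volume (z₁ := fun _ => 0) (z₂ := fun x => -x)
      (Z := fun ω => q ω j) (k := fun x => ψ x • EuclideanSpace.single j (1 : ℝ))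
      measurable_const measurable_neg (hψ.smul_const _) (hψ1.smul_const _)
      ((EuclideanSpace.proj (𝕜 := ℝ) j).continuous.measurable.comp hq)
      ((EuclideanSpace.proj (𝕜 := ℝ) j).comp_memLp' hq2) hf hf2
  refine (integrable_finsetSum Finset.univ fun j _ => h j).congr (ae_of_all _ fun p => ?_)
  simp only [M.τ_zero, inner_smul_right, EuclideanSpace.inner_single_right, inner_eq_sum,
    Finset.mul_sum]
  refine Finset.sum_congr rfl fun j _ => ?_
  simp
  ring

/-! ### Stationary gradients are potential fields -/

variable {u : Ω → Euc d → ℝ} {G : Ω → Euc d}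

/-- The increments of a random field with stationary gradient are stationary. -/
lemma HasStationaryGradient.ae_sub_eq_radialPrim (hu : M.HasStationaryGradient u G) (h : Euc d) :
    ∀ᵐ ω ∂P, ∀ᵐ y, u ω (y + h) - u ω y = M.radialPrim G (M.τ y ω) h := by
  filter_upwards [hu.weak_grad] with ω hω
  filter_upwards [hω.ae_sub_eq (M.measurable_orbit hu.measurable_grad ω) h] with y hy
  rw [hy, radialPrim]
  simp only [← M.τ_add, add_comm]

/-- The field `u` need not be stationary, but its increment by `h` is, so the increment can be
mollified along orbits. Integrating by parts moves the gradient from `ψ` to the increment, giving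
the mollified increment of `G`. -/
lemma HasStationaryGradient.ae_inner_orbitSpread (hu : M.HasStationaryGradient u G) (h : Euc d)
    {ψ : Euc d → ℝ} (hψ : IsTestFunction Set.univ ψ) :
    ∀ᵐ ω ∂P, ∀ e : Euc d,
      inner ℝ e (M.orbitSpread volume id (gradient ψ) (fun ω => M.radialPrim G ω h) ω) =
        ∫ y, ψ y * inner ℝ e (G (M.τ h (M.τ (-y) ω)) - G (M.τ (-y) ω)) := by
  filter_upwards [hu.ae_sub_eq_radialPrim M h, hu.weak_grad] with ω h1 h2 e
  set v : Euc d → ℝ := fun y => u ω (y + h) - u ω y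
  set g : Euc d → Euc d := fun y => G (M.τ h (M.τ y ω)) - G (M.τ y ω)
  have hv : HasWeakGradient v g := by
    have := (h2.comp_add_right h).add (h2.const_smul (-1))
    have e1 : v = fun y => u ω (y + h) + -1 * u ω y := by ext y; simp only [v]; ring
    have e2 : g = fun y => G (M.τ (y + h) ω) + (-1 : ℝ) • G (M.τ y ω) := by
      ext1 y
      simp only [g]
      rw [← M.τ_add, add_comm y h, neg_one_smul, sub_eq_add_neg]
    rwa [e1, e2]
  have hi := hv.integral_inner hψ.comp_neg e
  have hgr : ∀ x, gradient (fun y => ψ (-y)) x = - gradient ψ (-x) := fun x => by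
    ext j
    have h3 := ((hψ.contDiff_one.differentiable one_ne_zero (-x)).hasFDerivAt.comp x
      (hasFDerivAt_id x).neg).fderiv
    rw [gradient_apply_eq_fderiv, PiLp.neg_apply, gradient_apply_eq_fderiv]
    refine (congrArg (fun L : Euc d →L[ℝ] ℝ => L (EuclideanSpace.single j 1)) h3).trans ?_
    simp
  simp only [hgr, inner_neg_left, mul_neg, integral_neg, neg_inj] at hi
  have e0 : M.orbitSpread volume id (gradient ψ) (fun ω => M.radialPrim G ω h) ω =
      ∫ y, v (-y) • gradient ψ y := by
    refine integral_congr_ae ?_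
    filter_upwards [(Measure.measurePreserving_neg (volume : Measure (Euc d))).quasiMeasurePreserving.ae
      h1] with y hy
    simp only [id]
    rw [← hy]
  have hint : Integrable fun y => v (-y) • gradient ψ y := by
    have := hv.l2Loc.locallyIntegrable.integrable_smul_right_of_hasCompactSupport
      (hψ.continuous_gradient.comp continuous_neg)
      (hψ.hasCompactSupport_gradient.comp_homeomorph (Homeomorph.neg _))
    simpa using this.comp_neg
  rw [e0, ← integral_inner hint]
  calc ∫ y, inner ℝ e (v (-y) • gradient ψ y)
      = ∫ y, v y * inner ℝ (gradient ψ (-y)) e := by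
        rw [← integral_neg_eq_self]
        refine integral_congr_ae (ae_of_all _ fun y => ?_)
        simp only [neg_neg, inner_smul_right, real_inner_comm]
    _ = ∫ y, inner ℝ (g y) e * ψ (-y) := hi
    _ = _ := by
        rw [← integral_neg_eq_self]
        refine integral_congr_ae (ae_of_all _ fun y => ?_)
        simp only [neg_neg, g, real_inner_comm, mul_comm]

/-- The stationary gradient of a random field is a potential field. -/
theorem HasStationaryGradient.toLp_mem_potential (hu : M.HasStationaryGradient u G) :
    hu.memLp.toLp G ∈ M.potential := by
  rw [← Submodule.orthogonal_orthogonal M.potential, Submodule.mem_orthogonal]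
  intro q hq
  have hG := hu.measurable_grad
  have hG2 := hu.memLp
  set G' := hG2.toLp G
  have hqm : Measurable (q : Ω → Euc d) := (Lp.stronglyMeasurable q).measurable
  -- Mollified increments of `G` are potential fields, so `q` annihilates them; strong continuity of
  -- the shifts then removes the mollification.
  have key : ∀ h, inner ℝ q (M.koopman h G' - G') = 0 := by
    intro h
    set f : Ω → Euc d := fun ω => G (M.τ h ω) - G ω
    have hGh : MemLp (fun ω => G (M.τ h ω)) 2 P :=
      hG2.comp_measurePreserving (M.measurePreserving_τ h)
    have hf : Measurable f := (hG.comp (M.measurable_τ h)).sub hG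
    have hf2 : MemLp f 2 P := hGh.sub hG2
    have hfG : hf2.toLp f = M.koopman h G' - G' := by
      rw [koopman_toLp]; rfl
    rw [← hfG]
    set Φ : Euc d → ℝ := fun y => inner ℝ q (M.koopman (-y) (hf2.toLp f))
    have hΦ : Continuous Φ :=
      continuous_const.inner ((M.continuous_koopman _).comp continuous_neg)
    have hΦ0 : ∀ᵐ y, Φ y = 0 := by
      refine ae_eq_zero_of_integral_contDiff_smul_eq_zero hΦ.locallyIntegrable fun ψ hψ1 hψ2 => ?_
      have hψ : IsTestFunction Set.univ ψ := ⟨hψ1, hψ2, Set.subset_univ _⟩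
      set W : Ω → ℝ := fun ω => M.radialPrim G ω h
      have hz : Measurable fun s : ℝ => s • h := measurable_id.smul_const h
      have hW : Measurable W := M.measurable_orbitPairing (volume.restrict (Set.Ioc (0 : ℝ) 1))
        hz measurable_const hG
      have hW2 : MemLp W 2 P := M.memLp_orbitPairing (volume.restrict (Set.Ioc (0 : ℝ) 1))
        hz measurable_const (integrable_const h) hG hG2
      have h1 := (Submodule.mem_orthogonal' _ _).1 hq _ (M.toLp_orbitSpread_mem_potential hW hW2 hψ)
      have hi := M.integrable_orbit_mul_inner_inner hqm (Lp.memLp q) hf hf2 hψ.continuous.measurable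
        (hψ.continuous.integrable_of_hasCompactSupport hψ.2.1)
      calc ∫ y, ψ y • Φ y
          = ∫ y, ∫ ω, ψ y * inner ℝ (q ω) (f (M.τ (-y) ω)) ∂P := by
            refine integral_congr_ae (ae_of_all _ fun y => ?_)
            simp only [Φ, smul_eq_mul, integral_const_mul]
            rw [L2.inner_def]
            congr 1
            refine integral_congr_ae ?_
            filter_upwards [M.coeFn_koopman (-y) (hf2.toLp f),
              (M.measurePreserving_τ (-y)).quasiMeasurePreserving.ae hf2.coeFn_toLp] with ω e1 e2
            rw [e1, e2]
        _ = ∫ ω, (∫ y, ψ y * inner ℝ (q ω) (f (M.τ (-y) ω))) ∂P :=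
            (integral_integral_swap hi).symm
        _ = 0 := by
            rw [← h1, L2.inner_def]
            refine integral_congr_ae ?_
            filter_upwards [hu.ae_inner_orbitSpread M h hψ, MemLp.coeFn_toLp
              (M.memLp_orbitSpread volume measurable_id hψ.continuous_gradient.measurable
              (integrable_gradient hψ) hW hW2)] with ω e1 e2
            rw [e2, e1]
    have hΦ1 : Φ = fun _ => 0 := (hΦ.ae_eq_iff_eq volume continuous_const).1 hΦ0
    have h2 := congr_fun hΦ1 0
    have h3 : M.koopman (-0) (hf2.toLp f) = hf2.toLp f := by
      rw [neg_zero]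
      refine Lp.ext ?_
      filter_upwards [M.coeFn_koopman 0 (hf2.toLp f)] with ω hω
      rw [hω, M.τ_zero]
    simp only [Φ] at h2
    rwa [h3] at h2
  have h0 : ∫ ω, G' ω ∂P = 0 := by
    rw [← hu.mean_zero]
    exact integral_congr_ae hG2.coeFn_toLp
  -- By `key` the functional `⟨q, ·⟩` is constant on the orbit of `G'`, hence on its closed convex
  -- hull. The hull contains `0` because `G` has mean zero, so the constant is `0`.
  have hcl : IsClosed {F : Lp (Euc d) 2 P | inner ℝ q F = inner ℝ q G'} :=
    isClosed_eq (continuous_const.inner continuous_id) continuous_const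
  have hconv : Convex ℝ {F : Lp (Euc d) 2 P | inner ℝ q F = inner ℝ q G'} :=
    convex_hyperplane (f := fun F => inner ℝ q F) ⟨fun _ _ => inner_add_right _ _ _,
      fun _ _ => inner_smul_right _ _ _⟩ _
  have hmem := closure_minimal (convexHull_min (by
    rintro _ ⟨x, rfl⟩
    have := key x
    rw [inner_sub_right, sub_eq_zero] at this
    exact this) hconv) hcl (M.zero_mem_closure_convexHull_koopman G' h0)
  have : inner ℝ q (0 : Lp (Euc d) 2 P) = inner ℝ q G' := hmem
  rw [← this, inner_zero_right]

end Medium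
end
noncomputable section
set_option linter.unusedSectionVars false

/-! ### Existence and uniqueness of the corrector gradients -/

section LaxMilgram

variable {E : Type*} [NormedAddCommGroup E] [InnerProductSpace ℝ E] (V : Submodule ℝ E)
  [CompleteSpace V] (T : E →L[ℝ] E) {c : ℝ} (hc : 0 < c)
  (hT : ∀ v, c * ‖v‖ ^ 2 ≤ inner ℝ (T v) v)

include hc hT

/-- The Lax–Milgram theorem on a closed subspace. -/
lemma exists_add_mem_orthogonal_of_coercive (f : E) : ∃ v ∈ V, T v + f ∈ Vᗮ := by
  let B : V →L[ℝ] V →L[ℝ] ℝ := (innerSL ℝ).bilinearComp (T ∘L V.subtypeL) V.subtypeL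
  have hB : ∀ v w : V, B v w = inner ℝ (T v) (w : E) := fun v w => rfl
  have hco : IsCoercive B := ⟨c, hc, fun v => by
    rw [hB, mul_assoc, ← sq]
    exact hT v⟩
  let L := hco.continuousLinearEquivOfBilin
  let v : V := L.symm (- V.orthogonalProjectionOnto f)
  refine ⟨v, v.2, (Submodule.mem_orthogonal' _ _).2 fun w hw => ?_⟩
  have h1 := hco.continuousLinearEquivOfBilin_apply v ⟨w, hw⟩
  rw [hB] at h1
  have h2 : hco.continuousLinearEquivOfBilin v = - V.orthogonalProjectionOnto f :=
    L.apply_symm_apply _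
  rw [h2, inner_neg_left] at h1
  have h3 := V.inner_orthogonalProjectionOnto_eq_of_mem_right ⟨w, hw⟩ f
  rw [inner_add_left, ← h1, ← h3]
  simp

omit [CompleteSpace V] in
lemma eq_of_sub_mem_orthogonal_of_coercive {v w : E} (hv : v ∈ V) (hw : w ∈ V)
    (h : T v - T w ∈ Vᗮ) : v = w := by
  have h1 := (Submodule.mem_orthogonal' _ _).1 h _ (V.sub_mem hv hw)
  rw [← map_sub] at h1
  have h2 := hT (v - w)
  rw [h1] at h2
  have h3 : ‖v - w‖ ^ 2 ≤ 0 := nonpos_of_mul_nonpos_right h2 hc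
  have h4 : ‖v - w‖ = 0 := pow_eq_zero_iff two_ne_zero |>.1 (le_antisymm h3 (sq_nonneg _))
  exact sub_eq_zero.1 (norm_eq_zero.1 h4)

end LaxMilgram

/-- Both vectors are orthogonal projections of `r`; used for uniqueness of `∇σ`. -/
lemma eq_of_sub_mem_orthogonal {E : Type*} [NormedAddCommGroup E] [InnerProductSpace ℝ E]
    (V : Submodule ℝ E) {v w r : E} (hv : v ∈ V) (hw : w ∈ V) (hvr : v - r ∈ Vᗮ)
    (hwr : w - r ∈ Vᗮ) : v = w := by
  have h1 : v - w ∈ Vᗮ := by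
    have := Vᗮ.sub_mem hvr hwr
    rwa [sub_sub_sub_cancel_right] at this
  exact sub_eq_zero.1 (inner_self_eq_zero.1 ((Submodule.mem_orthogonal _ _).1 h1 _ (V.sub_mem hv hw)))

/-! ### The random matrix as a coercive operator and the corrector equations -/

namespace Medium

variable {d : ℕ} {Ω : Type*} [MeasurableSpace Ω] {P : Measure Ω} (M : Medium d P)

/-- The action of the random matrix on a vector. -/
def applyA (ω : Ω) (v : Euc d) : Euc d := WithLp.toLp 2 (M.A ω *ᵥ fun j => v j)

lemma applyA_add (ω : Ω) (v w : Euc d) : M.applyA ω (v + w) = M.applyA ω v + M.applyA ω w := by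
  ext j
  have := congr_fun (Matrix.mulVec_add (M.A ω) (fun j => v j) fun j => w j) j
  exact this

lemma applyA_smul (ω : Ω) (c : ℝ) (v : Euc d) : M.applyA ω (c • v) = c • M.applyA ω v := by
  ext j
  have := congr_fun (Matrix.mulVec_smul (M.A ω) c fun j => v j) j
  exact this

lemma flux_eq_applyA (i : Fin d) (G : Ω → Euc d) (ω : Ω) :
    M.flux i G ω = M.applyA ω (EuclideanSpace.single i 1 + G ω) := rfl

lemma measurable_applyA {F : Ω → Euc d} (hF : Measurable F) :
    Measurable fun ω => M.applyA ω (F ω) := by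
  refine (WithLp.measurable_toLp 2 (Fin d → ℝ)).comp (measurable_pi_iff.2 fun i => ?_)
  simp only [Matrix.mulVec, dotProduct]
  exact Finset.measurable_sum _ fun j _ => (M.A_measurable i j).mul
    ((EuclideanSpace.proj (𝕜 := ℝ) j).continuous.measurable.comp hF)

lemma ae_le_inner_applyA : ∀ᵐ ω ∂P, ∀ v, M.ellLo * ‖v‖ ^ 2 ≤ inner ℝ (M.applyA ω v) v ∧
    inner ℝ (M.applyA ω v) v ≤ M.ellHi * ‖v‖ ^ 2 := by
  filter_upwards [M.A_elliptic] with ω hω v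
  have h1 : (fun j => v j) ⬝ᵥ (fun j => v j) = ‖v‖ ^ 2 := by
    rw [← real_inner_self_eq_norm_sq, inner_eq_sum]; rfl
  have h2 : (fun j => v j) ⬝ᵥ (M.A ω *ᵥ fun j => v j) = inner ℝ (M.applyA ω v) v := by
    rw [real_inner_comm, inner_eq_sum]; rfl
  have := hω fun j => v j
  rwa [h1, h2] at this

lemma ae_norm_applyA_le : ∀ᵐ ω ∂P, ∀ v, ‖M.applyA ω v‖ ≤ M.ellHi * ‖v‖ := by
  filter_upwards [M.ae_le_inner_applyA, M.A_symm] with ω h1 h2 v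
  have hsymm : ∀ v w, inner ℝ (M.applyA ω v) w = inner ℝ (M.applyA ω w) v := fun v w => by
    have e1 : inner ℝ (M.applyA ω v) w = (fun j => w j) ⬝ᵥ (M.A ω *ᵥ fun j => v j) := by
      rw [real_inner_comm, inner_eq_sum]; rfl
    have e2 : inner ℝ (M.applyA ω w) v = (fun j => v j) ⬝ᵥ (M.A ω *ᵥ fun j => w j) := by
      rw [real_inner_comm, inner_eq_sum]; rfl
    rw [e1, e2, Matrix.dotProduct_mulVec, ← Matrix.mulVec_transpose, h2, dotProduct_comm]
  set w := M.applyA ω v with hw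
  have hL := M.ellHi_pos
  set L := M.ellHi
  -- Polarization: by symmetry, subtracting the quadratic forms of `A` at `L v + w` and `L v - w`,
  -- with `w = A v`, leaves `4 L ‖w‖²`. The first form is at most `L ‖L v + w‖²` and the second is
  -- nonnegative, so `‖w‖ ≤ L ‖v‖`.
  have a1 := (h1 (L • v + w)).2
  have a2 := (h1 (L • v + (-1 : ℝ) • w)).1
  have a3 := mul_nonneg M.ellLo_pos.le (sq_nonneg ‖L • v + (-1 : ℝ) • w‖)
  have hn : ‖L • v + w‖ ^ 2 ≤ 2 * (L ^ 2 * ‖v‖ ^ 2 + ‖w‖ ^ 2) := by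
    have := norm_add_le (L • v) w
    rw [norm_smul, Real.norm_of_nonneg hL.le] at this
    nlinarith [norm_nonneg (L • v + w), sq_nonneg (L * ‖v‖ - ‖w‖)]
  have e3 : inner ℝ (M.applyA ω w) v = ‖w‖ ^ 2 := by
    rw [hsymm, ← hw, real_inner_self_eq_norm_sq]
  have e4 : inner ℝ w v = inner ℝ w v := rfl
  simp only [applyA_add, applyA_smul, ← hw, inner_add_left, inner_add_right, inner_smul_left,
    inner_smul_right, real_inner_self_eq_norm_sq, e3, RCLike.conj_to_real] at a1 a2
  have h5 : 2 * ‖w‖ ^ 2 * L ≤ L * (L ^ 2 * ‖v‖ ^ 2 + ‖w‖ ^ 2) := by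
    nlinarith [mul_le_mul_of_nonneg_left hn hL.le]
  have h6 : ‖w‖ ^ 2 ≤ (L * ‖v‖) ^ 2 := by
    have : 2 * ‖w‖ ^ 2 ≤ L ^ 2 * ‖v‖ ^ 2 + ‖w‖ ^ 2 :=
      le_of_mul_le_mul_left (by linarith) hL
    rw [mul_pow]; linarith
  exact (pow_le_pow_iff_left₀ (norm_nonneg _) (by positivity) two_ne_zero).1 h6

lemma memLp_applyA {F : Ω → Euc d} (hF : Measurable F) (hF2 : MemLp F 2 P) :
    MemLp (fun ω => M.applyA ω (F ω)) 2 P :=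
  hF2.of_le_mul (M.measurable_applyA hF).aestronglyMeasurable
    (M.ae_norm_applyA_le.mono fun ω h => h (F ω))

lemma memLp_applyA_Lp (F : Lp (Euc d) 2 P) : MemLp (fun ω => M.applyA ω (F ω)) 2 P :=
  M.memLp_applyA (Lp.stronglyMeasurable F).measurable (Lp.memLp F)

/-- Multiplication by the random matrix, as an operator on `L²(Ω)`. -/
def mulA : Lp (Euc d) 2 P →L[ℝ] Lp (Euc d) 2 P :=
  LinearMap.mkContinuous
    { toFun := fun F => (M.memLp_applyA_Lp F).toLp _
      map_add' := fun F K => by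
        refine Lp.ext ?_
        filter_upwards [(M.memLp_applyA_Lp (F + K)).coeFn_toLp, (M.memLp_applyA_Lp F).coeFn_toLp,
          (M.memLp_applyA_Lp K).coeFn_toLp, Lp.coeFn_add F K,
          Lp.coeFn_add ((M.memLp_applyA_Lp F).toLp _) ((M.memLp_applyA_Lp K).toLp _)]
          with ω e1 e2 e3 e4 e5
        rw [e1, e5, Pi.add_apply, e2, e3, e4, Pi.add_apply, applyA_add]
      map_smul' := fun c F => by
        refine Lp.ext ?_
        filter_upwards [(M.memLp_applyA_Lp (c • F)).coeFn_toLp, (M.memLp_applyA_Lp F).coeFn_toLp,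
          Lp.coeFn_smul c F, Lp.coeFn_smul c ((M.memLp_applyA_Lp F).toLp _)] with ω e1 e2 e3 e4
        rw [e1, RingHom.id_apply, e4, Pi.smul_apply, e2, e3, Pi.smul_apply, applyA_smul] }
    M.ellHi fun F => by
      refine Lp.norm_le_mul_norm_of_ae_le_mul ?_
      filter_upwards [(M.memLp_applyA_Lp F).coeFn_toLp, M.ae_norm_applyA_le] with ω e1 e2
      exact (congrArg norm e1).trans_le (e2 _)

lemma coeFn_mulA (F : Lp (Euc d) 2 P) : M.mulA F =ᵐ[P] fun ω => M.applyA ω (F ω) :=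
  (M.memLp_applyA_Lp F).coeFn_toLp

lemma mulA_coercive (F : Lp (Euc d) 2 P) : M.ellLo * ‖F‖ ^ 2 ≤ inner ℝ (M.mulA F) F := by
  rw [← real_inner_self_eq_norm_sq, ← real_inner_smul_right, L2.inner_def, L2.inner_def]
  refine integral_mono_ae (L2.integrable_inner _ _) (L2.integrable_inner _ _) ?_
  filter_upwards [M.coeFn_mulA F, M.ae_le_inner_applyA, Lp.coeFn_smul M.ellLo F] with ω e1 e2 e3
  rw [e1, e3, Pi.smul_apply, inner_smul_right, real_inner_self_eq_norm_sq]
  exact (e2 _).1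

variable [IsProbabilityMeasure P]

lemma measurable_flux (i : Fin d) {G : Ω → Euc d} (hG : Measurable G) :
    Measurable (M.flux i G) :=
  M.measurable_applyA (hG.const_add _)

lemma memLp_flux (i : Fin d) {G : Ω → Euc d} (hG : Measurable G) (hG2 : MemLp G 2 P) :
    MemLp (M.flux i G) 2 P := by
  have h0 : MemLp (fun _ : Ω => (EuclideanSpace.single i (1 : ℝ) : Euc d)) 2 P := memLp_const _
  have h : MemLp (fun ω => EuclideanSpace.single i (1 : ℝ) + G ω) 2 P := MemLp.add h0 hG2
  exact M.memLp_applyA (F := fun ω => EuclideanSpace.single i (1 : ℝ) + G ω) (hG.const_add _) h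

lemma toLp_flux (i : Fin d) {G : Ω → Euc d} (hG : Measurable G) (hG2 : MemLp G 2 P) :
    (M.memLp_flux i hG hG2).toLp _ = M.mulA (hG2.toLp G) +
      M.mulA (Lp.const 2 P (EuclideanSpace.single i (1 : ℝ))) := by
  rw [← map_add]
  refine Lp.ext ?_
  filter_upwards [(M.memLp_flux i hG hG2).coeFn_toLp, M.coeFn_mulA (hG2.toLp G +
    Lp.const 2 P (EuclideanSpace.single i (1 : ℝ))), hG2.coeFn_toLp, Lp.coeFn_add (hG2.toLp G)
    (Lp.const 2 P (EuclideanSpace.single i (1 : ℝ))),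
    Lp.coeFn_const (p := 2) (μ := P) (EuclideanSpace.single i (1 : ℝ))] with ω e1 e2 e3 e4 e5
  rw [e1, e2, e4, Pi.add_apply, e3, e5, flux_eq_applyA, add_comm]
  rfl

/-- The vector field `q_j e_k - q_k e_j`. -/
def fluxRot (q : Ω → Euc d) (j k : Fin d) (ω : Ω) : Euc d :=
  q ω j • EuclideanSpace.single k (1 : ℝ) - q ω k • EuclideanSpace.single j (1 : ℝ)

omit [IsProbabilityMeasure P] in
lemma measurable_fluxRot {q : Ω → Euc d} (hq : Measurable q) (j k : Fin d) :
    Measurable (fluxRot q j k) := by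
  have h : ∀ j : Fin d, Measurable fun ω => q ω j := fun j =>
    (EuclideanSpace.proj (𝕜 := ℝ) j).continuous.measurable.comp hq
  exact ((h j).smul_const _).sub ((h k).smul_const _)

omit [IsProbabilityMeasure P] in
lemma memLp_fluxRot {q : Ω → Euc d} (hq : MemLp q 2 P) (j k : Fin d) :
    MemLp (fluxRot q j k) 2 P := by
  have h : ∀ j k : Fin d, MemLp (fun ω => q ω j • (EuclideanSpace.single k (1 : ℝ) : Euc d)) 2 P :=
    fun j k => ((ContinuousLinearMap.toSpanSingleton ℝ (EuclideanSpace.single k (1 : ℝ))).comp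
      (EuclideanSpace.proj (𝕜 := ℝ) j)).comp_memLp' hq
  exact (h j k).sub (h k j)

omit [IsProbabilityMeasure P] in
lemma inner_fluxRot (q : Ω → Euc d) (j k : Fin d) (ω : Ω) (v : Euc d) :
    inner ℝ (fluxRot q j k ω) v = q ω j * v k - q ω k * v j := by
  simp [fluxRot, inner_sub_left, inner_smul_left, EuclideanSpace.inner_single_left]

/-- The weak form of the equation for the flux corrector, in terms of the orthogonal complement of
the potential fields. -/
lemma toLp_sub_fluxRot_mem_orthogonal_iff {H q : Ω → Euc d} (hH : Measurable H)
    (hH2 : MemLp H 2 P) (hq : Measurable q) (hq2 : MemLp q 2 P) (j k : Fin d) :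
    hH2.toLp H - (memLp_fluxRot hq2 j k).toLp _ ∈ M.potentialᗮ ↔
      ∀ᵐ ω ∂P, ∀ ψ : Euc d → ℝ, IsTestFunction Set.univ ψ →
        ∫ x, inner ℝ (H (M.τ x ω)) (gradient ψ x) =
          ∫ x, (q (M.τ x ω) j * gradient ψ x k - q (M.τ x ω) k * gradient ψ x j) := by
  have hR := measurable_fluxRot hq j k
  have hR2 := memLp_fluxRot hq2 j k
  rw [← MemLp.toLp_sub hH2 hR2, M.toLp_mem_orthogonal_potential_iff (hH.sub hR) (hH2.sub hR2)]
  have hint : ∀ {v : Euc d → Euc d}, L2Loc v → ∀ {ψ : Euc d → ℝ}, IsTestFunction Set.univ ψ →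
      Integrable fun x => inner ℝ (v x) (gradient ψ x) := fun {v} hv {ψ} hψ => by
    simp only [inner_eq_sum]
    exact integrable_finsetSum _ fun j _ => (hv.apply j).integrable_mul
      (hψ.continuous_gradient_apply j) (hψ.hasCompactSupport_gradient_apply j)
  have key : ∀ᵐ ω ∂P, ∀ ψ : Euc d → ℝ, IsTestFunction Set.univ ψ →
      ∫ x, inner ℝ ((H - fluxRot q j k) (M.τ x ω)) (gradient ψ x) =
        (∫ x, inner ℝ (H (M.τ x ω)) (gradient ψ x)) -
          ∫ x, (q (M.τ x ω) j * gradient ψ x k - q (M.τ x ω) k * gradient ψ x j) := by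
    filter_upwards [M.ae_l2Loc hH hH2, M.ae_l2Loc hR hR2] with ω h1 h2 ψ hψ
    simp only [Pi.sub_apply, inner_sub_left, ← inner_fluxRot]
    exact integral_sub (hint h1 hψ) (hint h2 hψ)
  constructor
  · intro h
    filter_upwards [h, key] with ω h1 h2 ψ hψ
    have := h1 ψ hψ
    rwa [h2 ψ hψ, sub_eq_zero] at this
  · intro h
    filter_upwards [h, key] with ω h1 h2 ψ hψ
    rw [h2 ψ hψ, h1 ψ hψ, sub_self]

lemma HasStationaryGradient.congr {u : Ω → Euc d → ℝ} {G G' : Ω → Euc d}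
    (hu : M.HasStationaryGradient u G) (hG' : Measurable G') (h : G =ᵐ[P] G') :
    M.HasStationaryGradient u G' := by
  refine ⟨hu.measurable_field, hG', (memLp_congr_ae h).1 hu.memLp, ?_, ?_⟩
  · rw [← integral_congr_ae h, hu.mean_zero]
  · filter_upwards [hu.weak_grad, M.ae_ae_orbit h] with ω h1 h2
    refine ⟨h1.1, fun K hK => (memLp_congr_ae (ae_restrict_of_ae h2)).1 (h1.2.1 K hK),
      fun ψ hψ j => ?_⟩
    rw [h1.2.2 ψ hψ j]
    congr 1
    refine integral_congr_ae ?_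
    filter_upwards [h2] with x hx
    rw [hx]

/-- Corrector gradients exist. -/
theorem exists_corrector_gradient (i : Fin d) : ∃ (G : Ω → Euc d),
    Measurable G ∧ ∃ hG2 : MemLp G 2 P, hG2.toLp G ∈ M.potential ∧
      ∀ᵐ ω ∂P, ∀ ψ : Euc d → ℝ, IsTestFunction Set.univ ψ →
        ∫ x, inner ℝ (M.flux i G (M.τ x ω)) (gradient ψ x) = 0 := by
  obtain ⟨F, hF, hF'⟩ := exists_add_mem_orthogonal_of_coercive M.potential M.mulA M.ellLo_pos
    M.mulA_coercive (M.mulA (Lp.const 2 P (EuclideanSpace.single i (1 : ℝ))))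
  have hm : Measurable (F : Ω → Euc d) := (Lp.stronglyMeasurable F).measurable
  refine ⟨F, hm, Lp.memLp F, by rwa [Lp.toLp_coeFn], ?_⟩
  rw [← M.toLp_mem_orthogonal_potential_iff (M.measurable_flux i hm)
    (M.memLp_flux i hm (Lp.memLp F)), M.toLp_flux i hm (Lp.memLp F), Lp.toLp_coeFn]
  exact hF'

/-- Flux corrector gradients exist. -/
theorem exists_fluxCorrector_gradient {q : Ω → Euc d} (hq : Measurable q) (hq2 : MemLp q 2 P) :
    ∃ H : Fin d → Fin d → Ω → Euc d, (∀ j k, Measurable (H j k)) ∧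
      (∀ j k ω, H j k ω = - H k j ω) ∧ ∀ j k, ∃ hH2 : MemLp (H j k) 2 P,
        hH2.toLp (H j k) ∈ M.potential ∧
        ∀ᵐ ω ∂P, ∀ ψ : Euc d → ℝ, IsTestFunction Set.univ ψ →
          ∫ x, inner ℝ (H j k (M.τ x ω)) (gradient ψ x) =
            ∫ x, (q (M.τ x ω) j * gradient ψ x k - q (M.τ x ω) k * gradient ψ x j) := by
  set R : Fin d → Fin d → Lp (Euc d) 2 P := fun j k => (memLp_fluxRot hq2 j k).toLp _
  -- The weak equation says exactly that `H - R` is orthogonal to the potential fields, so `H` must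
  -- be the projection of `R`.
  set h : Fin d → Fin d → Lp (Euc d) 2 P := fun j k => M.potential.starProjection (R j k)
  have hskew : ∀ j k, h k j = - h j k := fun j k => by
    have : R k j = - R j k := by
      simp only [R]
      rw [← MemLp.toLp_neg]
      refine MemLp.toLp_congr _ _ (ae_of_all _ fun ω => ?_)
      simp [fluxRot]
    simp only [h, this, map_neg]
  have hm : ∀ j k, Measurable (h j k : Ω → Euc d) := fun j k => (Lp.stronglyMeasurable _).measurable
  -- The projections are skew in `(j, k)` only almost surely, whereas `σ` has to be skew at every
  -- `ω` and `x`; antisymmetrizing the representatives repairs this without changing their classes.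
  obtain ⟨H, hH⟩ : ∃ H : Fin d → Fin d → Ω → Euc d,
      ∀ j k, H j k = fun ω => (1 / 2 : ℝ) • (h j k ω - h k j ω) := ⟨_, fun _ _ => rfl⟩
  have hHm : ∀ j k, Measurable (H j k) := fun j k => by
    rw [hH]
    exact ((hm j k).sub (hm k j)).const_smul (1 / 2 : ℝ)
  have hae : ∀ j k, H j k =ᵐ[P] h j k := fun j k => by
    have h1 := Lp.coeFn_neg (h j k)
    rw [← hskew] at h1
    filter_upwards [h1] with ω h1
    rw [hH]
    simp only
    rw [h1, Pi.neg_apply, sub_neg_eq_add, ← two_smul ℝ, smul_smul]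
    norm_num
  refine ⟨H, hHm, fun j k ω => ?_, fun j k => ?_⟩
  · rw [hH, hH, ← smul_neg, neg_sub]
  · have hH2 : MemLp (H j k) 2 P := (memLp_congr_ae (hae j k)).2 (Lp.memLp _)
    have e : hH2.toLp _ = h j k :=
      (MemLp.toLp_congr _ (Lp.memLp _) (hae j k)).trans (Lp.toLp_coeFn _ _)
    refine ⟨hH2, by rw [e]; exact M.potential.starProjection_apply_mem _, ?_⟩
    rw [← M.toLp_sub_fluxRot_mem_orthogonal_iff (hHm j k) hH2 hq hq2, e, ← neg_sub]
    exact Submodule.neg_mem _ (Submodule.sub_starProjection_mem_orthogonal _)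

omit [IsProbabilityMeasure P] in
lemma radialPrim_neg (G : Ω → Euc d) (ω : Ω) (x : Euc d) :
    M.radialPrim (fun ω => - G ω) ω x = - M.radialPrim G ω x := by
  simp only [radialPrim, inner_neg_left, integral_neg]

/-- Correctors exist, and their gradients are almost surely unique. -/
theorem exists_isCorrector_unique_gradient :
    ∃ (G : Fin d → Ω → Euc d) (H : Fin d → Fin d → Fin d → Ω → Euc d),
      (∃ φ σ, M.IsCorrector φ σ ∧ (∀ i, M.HasStationaryGradient (φ i) (G i)) ∧
        ∀ i j k, M.HasStationaryGradient (σ i j k) (H i j k)) ∧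
      ∀ φ σ, M.IsCorrector φ σ → (∀ i, M.HasStationaryGradient (φ i) (G i)) ∧
        ∀ i j k, M.HasStationaryGradient (σ i j k) (H i j k) := by
  choose G hG hG2 hGp hGdiv using M.exists_corrector_gradient
  choose H hH hHskew hH2 hHp hHeq using fun i => M.exists_fluxCorrector_gradient
    (M.measurable_flux i (hG i)) (M.memLp_flux i (hG i) (hG2 i))
  have hφ : ∀ i, M.HasStationaryGradient (M.radialPrim (G i)) (G i) := fun i =>
    M.hasStationaryGradient_radialPrim (hG i) (hG2 i) (hGp i)
  have hσ : ∀ i j k, M.HasStationaryGradient (M.radialPrim (H i j k)) (H i j k) := fun i j k =>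
    M.hasStationaryGradient_radialPrim (hH i j k) (hH2 i j k) (hHp i j k)
  refine ⟨G, H, ⟨fun i => M.radialPrim (G i), fun i j k => M.radialPrim (H i j k),
    ⟨G, H, hφ, hσ, fun i j k ω x => ?_, hGdiv, hHeq⟩, hφ, hσ⟩, ?_⟩
  · rw [← radialPrim_neg]
    exact congrArg (fun F => M.radialPrim F ω x) (funext fun ω => hHskew i j k ω)
  rintro φ σ ⟨G', H', hφ', hσ', -, hdiv', heq'⟩
  -- Both gradients are potential fields and both fluxes are orthogonal to these, so `A (G' i - G
  -- i)` is too, and coercivity gives equality.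
  have hGae : ∀ i, G' i =ᵐ[P] G i := fun i => by
    have h1 := (M.toLp_mem_orthogonal_potential_iff (M.measurable_flux i (hG i))
      (M.memLp_flux i (hG i) (hG2 i))).2 (hGdiv i)
    have h2 := (M.toLp_mem_orthogonal_potential_iff (M.measurable_flux i (hφ' i).measurable_grad)
      (M.memLp_flux i (hφ' i).measurable_grad (hφ' i).memLp)).2 (hdiv' i)
    rw [M.toLp_flux i (hG i) (hG2 i)] at h1
    rw [M.toLp_flux i (hφ' i).measurable_grad (hφ' i).memLp] at h2
    have h3 := Submodule.sub_mem _ h2 h1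
    rw [add_sub_add_right_eq_sub] at h3
    exact (MemLp.toLp_eq_toLp_iff _ _).1 (eq_of_sub_mem_orthogonal_of_coercive M.potential M.mulA
      M.ellLo_pos M.mulA_coercive ((hφ' i).toLp_mem_potential M) (hGp i) h3)
  refine ⟨fun i => (hφ' i).congr M (hG i) (hGae i), fun i j k => ?_⟩
  refine (hσ' i j k).congr M (hH i j k) ?_
  have hq' := M.measurable_flux i (hφ' i).measurable_grad
  have hq'2 := M.memLp_flux i (hφ' i).measurable_grad (hφ' i).memLp
  have hq := M.measurable_flux i (hG i)
  have hq2 := M.memLp_flux i (hG i) (hG2 i)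
  have h1 := (M.toLp_sub_fluxRot_mem_orthogonal_iff (hH i j k) (hH2 i j k) hq hq2 j k).2
    (hHeq i j k)
  have h2 := (M.toLp_sub_fluxRot_mem_orthogonal_iff (hσ' i j k).measurable_grad (hσ' i j k).memLp
    hq' hq'2 j k).2 (heq' i j k)
  have e : (memLp_fluxRot hq'2 j k).toLp _ = (memLp_fluxRot hq2 j k).toLp _ := by
    refine MemLp.toLp_congr _ _ ?_
    filter_upwards [hGae i] with ω hω
    simp only [fluxRot, flux, hω]
  rw [e] at h2
  exact (MemLp.toLp_eq_toLp_iff _ _).1 (eq_of_sub_mem_orthogonal M.potential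
    ((hσ' i j k).toLp_mem_potential M) (hHp i j k) h2 h1)

end Medium
end
noncomputable section
set_option linter.unusedSectionVars false

/-! ### The microscopic scale -/

/-- Letting the tolerance shrink with `ε` covers every fixed `ν`, since eventually `ε < ν`; the
extra power of `ε` in the probability beats `ε⁻ᵈ`. -/
lemma tendsto_rescaled_tail {Ω : Type*} [MeasurableSpace Ω] {P : Measure Ω} [IsProbabilityMeasure P]
    (d : ℕ) {X : ℝ → Ω → ℝ≥0∞}
    (h : ∀ᶠ ε in 𝓝[>] (0 : ℝ),
      P {ω | ENNReal.ofReal ε < X ε ω} ≤ ENNReal.ofReal (ε ^ (d + 1))) {ν : ℝ} (hν : 0 < ν) :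
    Tendsto (fun ε : ℝ => 1 / ε ^ d * P.real {ω | ENNReal.ofReal ν < X ε ω}) (𝓝[>] 0) (𝓝 0) := by
  have hid : Tendsto (fun ε : ℝ => ε) (𝓝[>] 0) (𝓝 0) := tendsto_id.mono_left nhdsWithin_le_nhds
  refine tendsto_of_tendsto_of_tendsto_of_le_of_le' tendsto_const_nhds hid ?_ ?_
  · filter_upwards [self_mem_nhdsWithin] with ε hε
    have : 0 < ε := hε
    positivity
  · filter_upwards [self_mem_nhdsWithin, h, hid.eventually (gt_mem_nhds hν)] with ε hε h1 h2
    have hε : 0 < ε := hε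
    have h3 : P.real {ω | ENNReal.ofReal ν < X ε ω} ≤ ε ^ (d + 1) := by
      refine ENNReal.toReal_le_of_le_ofReal (by positivity) (le_trans (measure_mono ?_) h1)
      intro ω hω
      exact (ENNReal.ofReal_le_ofReal h2.le).trans_lt hω
    calc 1 / ε ^ d * P.real {ω | ENNReal.ofReal ν < X ε ω} ≤ 1 / ε ^ d * ε ^ (d + 1) := by gcongr
      _ = ε := by rw [pow_succ]; field_simp

end

theorem mainTheorem4 {Ω : Type*} [MeasurableSpace Ω] (P : Measure Ω) [IsProbabilityMeasure P]
    (d : ℕ) (hd : 1 ≤ d) (M : Medium d P) :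
    (∃ (φ : Fin d → Ω → Euc d → ℝ) (σ : Fin d → Fin d → Fin d → Ω → Euc d → ℝ),
      M.IsCorrector φ σ) ∧
    ∃ δstar : ℝ → ℝ, IsScale δstar ∧
      ∀ (φ : Fin d → Ω → Euc d → ℝ) (σ : Fin d → Fin d → Fin d → Ω → Euc d → ℝ),
        M.IsCorrector φ σ →
        ∀ δ : ℝ → ℝ, (∀ᶠ ε in 𝓝[>] (0 : ℝ), 0 < δ ε ∧ δ ε ≤ δstar ε) →
          SublinearityCondition P φ σ δ ∧ AveragingCondition M δ := by
  obtain ⟨G, H, ⟨φ₀, σ₀, hc, hG, hH⟩, huniq⟩ := M.exists_isCorrector_unique_gradient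
  refine ⟨⟨φ₀, σ₀, hc⟩, ?_⟩
  have hν : ∀ ε : ℝ, 0 < ε → ENNReal.ofReal ε ≠ 0 := fun ε hε => (ENNReal.ofReal_pos.2 hε).ne'
  have hsub := fun (ε : ℝ) (hε : 0 < ε) => M.exists_subGrowth_tail_bound hd
    (fun i => (hG i).measurable_grad) (fun i => (hG i).memLp) (fun i => (hG i).mean_zero)
    (fun i j k => (hH i j k).measurable_grad) (fun i j k => (hH i j k).memLp)
    (fun i j k => (hH i j k).mean_zero) (hν ε hε) ENNReal.ofReal_ne_top
    (hν (ε ^ (d + 1)) (by positivity))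
  have hosc := fun (ε : ℝ) (hε : 0 < ε) => M.exists_osc_tail_bound hd (hν ε hε)
    ENNReal.ofReal_ne_top (hν (ε ^ (d + 1)) (by positivity))
  choose! r₁ hr₁ hS using hsub
  choose! r₂ hr₂ hO using hosc
  -- The radii depend on `ε` and on the almost surely unique gradients `G`, `H`, not on `φ`, `σ`.
  -- The entry `ε⁻¹` ensures `δ_*(ε) / ε = 1 / r(ε) ≤ ε`.
  set r : ℝ → ℝ := fun ε => max (r₁ ε) (max (r₂ ε) ε⁻¹)
  have hr : ∀ ε, 0 < ε → 0 < r ε := fun ε hε => (hr₁ ε hε).trans_le (le_max_left _ _)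
  refine ⟨fun ε => ε / r ε, ⟨fun ε hε => div_pos hε (hr ε hε), ?_⟩, fun φ σ hφσ δ hδ => ?_⟩
  · have hid : Tendsto (fun ε : ℝ => ε) (𝓝[>] 0) (𝓝 0) := tendsto_id.mono_left nhdsWithin_le_nhds
    refine tendsto_of_tendsto_of_tendsto_of_le_of_le' tendsto_const_nhds hid ?_ ?_
    · filter_upwards [self_mem_nhdsWithin] with ε hε
      have h1 := hr ε hε
      have h2 : 0 < ε := hε
      positivity
    · filter_upwards [self_mem_nhdsWithin] with ε hε
      have h2 : 0 < ε := hε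
      rw [div_right_comm, div_self h2.ne', one_div]
      refine inv_le_of_inv_le₀ h2 ?_
      exact (le_max_right _ _).trans (le_max_right _ _)
  · have hle : ∀ᶠ ε in 𝓝[>] (0 : ℝ), 0 < ε ∧ r ε ≤ ε / δ ε := by
      filter_upwards [self_mem_nhdsWithin, hδ] with ε hε h
      have h2 : 0 < ε := hε
      refine ⟨h2, ?_⟩
      rw [le_div_iff₀ h.1, mul_comm]
      exact (le_div_iff₀ (hr ε h2)).1 h.2
    obtain ⟨hφ, hσ⟩ := huniq φ σ hφσ
    refine ⟨fun ν hν => tendsto_rescaled_tail d (X := fun ε => SubGrowth φ σ 0 (ε / δ ε)) ?_ hν,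
      fun ν hν => tendsto_rescaled_tail d (X := fun ε => M.Osc 0 (ε / δ ε)) ?_ hν⟩
    · filter_upwards [hle] with ε h
      exact hS ε h.1 φ σ hφ hσ _ ((le_max_left _ _).trans h.2)
    · filter_upwards [hle] with ε h
      exact hO ε h.1 _ (((le_max_left _ _).trans (le_max_right _ _)).trans h.2)
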